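/- **Theorem.** Let $(\mathcal M,g)$ be a smooth finite-dimensional Riemannian manifold without boundary that is complete for its Riemannian distance $d$, let $\frac{D}{ds}$ denote the Levi-Civita covariant derivative along curves and let $R$ be the curvature tensor, with the convention $R(X,Y)Z=\nabla_X\nabla_YZ-\nabla_Y\nabla_XZ-\nabla_{[X,Y]}Z$. Let $\alpha>0$. Then there is a constant $\rho>0$, depending only on $(\mathcal M,g)$ and $\alpha$, such that the following holds. Let $p,q\in\mathcal M$ and let $c:[0,1]\times[0,\infty)\to\mathcal M$, $(s,\tau)\mapsto c(s,\tau)$, be smooth on $[0,1]\times(0,\infty)$, with every $c(\cdot,\tau)$ differentiable and with $c$ and $\partial_s c$ continuous on $[0,1]\times[0,\infty)$. Suppose that $c$ solves the geometric heat flow with fixed endpoints, $$\partial_\tau c=\alpha\,\frac{D}{ds}\partial_s c \quad\text{on } [0,1]\times(0,\infty),\qquad c(0,\tau)=p,\quad c(1,\tau)=q\quad(\tau\ge 0),$$ and that $J=\partial_\tau c$ satisfies $$\langle J,R(J,\partial_s c)\,\partial_s c\rangle_g<4\,\langle J,J\rangle_g\qquad\text{at every point of } [0,1]\times(0,\infty)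 \text{ where } J\neq0 .$$ Then there are a geodesic $\gamma:[0,1]\to\mathcal M$ (a smooth curve with $\frac{D}{ds}\partial_s\gamma=0$) with $\gamma(0)=p$, $\gamma(1)=q$, and a constant $C>0$ such that, for all $\tau\ge0$, $$\Bigl(\int_0^1 d\bigl(c(s,\tau),\gamma(s)\bigr)^2\,ds\Bigr)^{1/2}\le C e^{-\rho\tau}\qquad\text{and}\qquad \bigl|\mathcal E(c(\cdot,\tau))-\mathcal E(\gamma)\bigr|\le C e^{-\rho\tau},$$ where $\mathcal E(x)=\frac12\int_0^1\langle\partial_s x,\partial_s x\rangle_g\,ds$ is the Riemannian energy. -/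

import Mathlib

open Set MeasureTheory Bundle
open scoped Manifold ContDiff ENNReal

noncomputable section

namespace GeomHeatFlow

/-! ### The Levi-Civita connection and the curvature tensor in charts

`M` is a manifold without boundary modelled on `ℝⁿ` with an inner product on every tangent space.
All coordinate expressions at a point `p` use the preferred chart `extChartAt (𝓡 n) p`; the tangent
space `TangentSpace (𝓡 n) p` is by definition the model space `ℝⁿ`, a vector being identified with
its coordinates in this preferred chart. -/

section Local

variable {n : ℕ} {M : Type*} [TopologicalSpace M] [ChartedSpace (EuclideanSpace ℝ (Fin n)) M]

/-- The tangent vector of `M` at the point with coordinates `y` whose coordinates in the chart at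
`p` are `v`. -/
def ofCoord (p : M) (y v : EuclideanSpace ℝ (Fin n)) :
    TangentSpace (𝓡 n) ((extChartAt (𝓡 n) p).symm y) :=
  mfderiv (𝓡 n) (𝓡 n) (extChartAt (𝓡 n) p).symm y v

/-- The coordinates in the chart at `p` of a tangent vector `v` at `x`. -/
def toCoord (p x : M) (v : TangentSpace (𝓡 n) x) : EuclideanSpace ℝ (Fin n) :=
  mfderiv (𝓡 n) (𝓡 n) (extChartAt (𝓡 n) p) x v

variable [RiemannianBundle (fun x : M => TangentSpace (𝓡 n) x)]

/-- The matrix `(g_{ij}(y))` of the metric in the chart at `p`. -/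
def metricMatrix (p : M) (y : EuclideanSpace ℝ (Fin n)) : Matrix (Fin n) (Fin n) ℝ :=
  Matrix.of fun i j =>
    inner ℝ (ofCoord p y (EuclideanSpace.single i 1)) (ofCoord p y (EuclideanSpace.single j 1))

/-- `∂g_{ij}/∂x_k` in the chart at `p`. -/
def metricDeriv (p : M) (y : EuclideanSpace ℝ (Fin n)) (i j k : Fin n) : ℝ :=
  fderiv ℝ (fun z => metricMatrix p z i j) y (EuclideanSpace.single k 1)

/-- The Christoffel symbol `Γ^i_{jk}` in the chart at `p`. -/
def christoffel (p : M) (y : EuclideanSpace ℝ (Fin n)) (i j k : Fin n) : ℝ :=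
  (1 / 2) * ∑ m : Fin n, (metricMatrix p y)⁻¹ i m *
    (metricDeriv p y m j k + metricDeriv p y m k j - metricDeriv p y j k m)

/-- The vector `Γ(u, v)` with components `∑ j k, Γ^i_{jk} u_j v_k`, in the chart at `p`. -/
def christoffelMap (p : M) (y u v : EuclideanSpace ℝ (Fin n)) : EuclideanSpace ℝ (Fin n) :=
  WithLp.toLp 2 fun i => ∑ j : Fin n, ∑ k : Fin n, christoffel p y i j k * u j * v k

/-- The Riemann curvature tensor `R(u, v) w` at `p`, with the sign convention
`R(X, Y) Z = ∇_X ∇_Y Z - ∇_Y ∇_X Z - ∇_{[X, Y]} Z`; in the chart at `p`,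
`R(u, v) w = (∂_u Γ)(v, w) - (∂_v Γ)(u, w) + Γ(u, Γ(v, w)) - Γ(v, Γ(u, w))`. -/
def curvature (p : M) (u v w : TangentSpace (𝓡 n) p) : TangentSpace (𝓡 n) p :=
  letI y : EuclideanSpace ℝ (Fin n) := extChartAt (𝓡 n) p p
  letI u' : EuclideanSpace ℝ (Fin n) := toCoord p p u
  letI v' : EuclideanSpace ℝ (Fin n) := toCoord p p v
  letI w' : EuclideanSpace ℝ (Fin n) := toCoord p p w
  (fderiv ℝ (fun z => christoffelMap p z v' w') y u'
    - fderiv ℝ (fun z => christoffelMap p z u' w') y v'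
    + christoffelMap p y u' (christoffelMap p y v' w')
    - christoffelMap p y v' (christoffelMap p y u' w') : EuclideanSpace ℝ (Fin n))

end Local

/-! ### Curves `[0, 1] → M`

A curve is given by a function on `ℝ` of which only the values on `[0, 1]` are used. -/

section Curves

variable {n : ℕ} {M : Type*} [TopologicalSpace M] [ChartedSpace (EuclideanSpace ℝ (Fin n)) M]

/-- The velocity `∂_s x` of a curve `x : [0, 1] → M` (one-sided at the endpoints). -/
def velocity (x : ℝ → M) (s : ℝ) : TangentSpace (𝓡 n) (x s) :=
  mfderivWithin 𝓘(ℝ, ℝ) (𝓡 n) x (Icc 0 1) s (1 : ℝ)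

variable [RiemannianBundle (fun x : M => TangentSpace (𝓡 n) x)]

/-- The covariant derivative `D V / ds` at `s` of a vector field `V` along `x : [0, 1] → M`: in the
chart at `x s`, it is `dV/ds + Γ(dx/ds, V)`. -/
def covDeriv (x : ℝ → M) (V : ∀ s : ℝ, TangentSpace (𝓡 n) (x s)) (s : ℝ) :
    TangentSpace (𝓡 n) (x s) :=
  (derivWithin (fun σ => toCoord (x s) (x σ) (V σ)) (Icc 0 1) s
    + christoffelMap (x s) (extChartAt (𝓡 n) (x s) (x s))
        (toCoord (x s) (x s) (velocity x s)) (toCoord (x s) (x s) (V s)) :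
    EuclideanSpace ℝ (Fin n))

/-- `γ : [0, 1] → M` is a geodesic: it is smooth and `D (∂_s γ) / ds = 0`. -/
structure IsGeodesic (n : ℕ) {M : Type*} [TopologicalSpace M]
    [ChartedSpace (EuclideanSpace ℝ (Fin n)) M]
    [RiemannianBundle (fun x : M => TangentSpace (𝓡 n) x)] (γ : ℝ → M) : Prop where
  smooth : ContMDiffOn 𝓘(ℝ, ℝ) (𝓡 n) ∞ γ (Icc 0 1)
  covDeriv_eq_zero : ∀ s ∈ Icc (0 : ℝ) 1, covDeriv (n := n) γ (velocity γ) s = 0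

/-- The Riemannian energy `½ ∫₀¹ ⟨∂_s x, ∂_s x⟩ ds` of a curve. -/
def energy (n : ℕ) {M : Type*} [TopologicalSpace M]
    [ChartedSpace (EuclideanSpace ℝ (Fin n)) M]
    [RiemannianBundle (fun x : M => TangentSpace (𝓡 n) x)] (x : ℝ → M) : ℝ :=
  (1 / 2) * ∫ s in (0 : ℝ)..1, inner ℝ (velocity (n := n) x s) (velocity (n := n) x s)

/-- `∂_τ c (s, τ)`. -/
def timeDeriv (c : ℝ → ℝ → M) (s τ : ℝ) : TangentSpace (𝓡 n) (c s τ) :=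
  mfderiv 𝓘(ℝ, ℝ) (𝓡 n) (fun t => c s t) τ (1 : ℝ)

/-- `∂_s c (s, τ)`. -/
def spaceDeriv (c : ℝ → ℝ → M) (s τ : ℝ) : TangentSpace (𝓡 n) (c s τ) :=
  velocity (fun σ => c σ τ) s

/-- `c : [0, 1] × [0, ∞) → M` is a (classical) solution of the geometric heat flow
`∂_τ c = α D (∂_s c) / ds` with fixed endpoints `p` and `q`: it is smooth for `τ > 0`, every
`c(·, τ)` is differentiable, and `c`, `∂_s c` are continuous up to `τ = 0`. -/
structure IsHeatFlow (n : ℕ) {M : Type*} [TopologicalSpace M]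
    [ChartedSpace (EuclideanSpace ℝ (Fin n)) M]
    [IsManifold (𝓡 n) 1 M]
    [RiemannianBundle (fun x : M => TangentSpace (𝓡 n) x)]
    (α : ℝ) (p q : M) (c : ℝ → ℝ → M) : Prop where
  smooth : ContMDiffOn 𝓘(ℝ, ℝ × ℝ) (𝓡 n) ∞ (fun z : ℝ × ℝ => c z.1 z.2) (Icc 0 1 ×ˢ Ioi 0)
  mdifferentiableOn : ∀ τ, 0 ≤ τ → MDifferentiableOn 𝓘(ℝ, ℝ) (𝓡 n) (fun s => c s τ) (Icc 0 1)
  continuousOn : ContinuousOn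
    (fun z : ℝ × ℝ => (⟨c z.1 z.2, spaceDeriv c z.1 z.2⟩ : TangentBundle (𝓡 n) M))
    (Icc 0 1 ×ˢ Ici 0)
  left_endpoint : ∀ τ, 0 ≤ τ → c 0 τ = p
  right_endpoint : ∀ τ, 0 ≤ τ → c 1 τ = q
  heat_flow : ∀ s ∈ Icc (0 : ℝ) 1, ∀ τ, 0 < τ →
    timeDeriv (n := n) c s τ = α • covDeriv (fun σ => c σ τ) (fun σ => spaceDeriv c σ τ) s

/-- The curvature bound `⟨J, R(J, ∂_s c) ∂_s c⟩ < 4 ⟨J, J⟩` along `c`, where `J = ∂_τ c`, at all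
points where `J ≠ 0` (where `J = 0` both sides vanish). -/
def CurvatureBound (n : ℕ) {M : Type*} [TopologicalSpace M]
    [ChartedSpace (EuclideanSpace ℝ (Fin n)) M]
    [RiemannianBundle (fun x : M => TangentSpace (𝓡 n) x)] (c : ℝ → ℝ → M) : Prop :=
  ∀ s ∈ Icc (0 : ℝ) 1, ∀ τ, 0 < τ → timeDeriv (n := n) c s τ ≠ 0 →
    inner ℝ (timeDeriv (n := n) c s τ)
        (curvature (c s τ) (timeDeriv c s τ) (spaceDeriv c s τ) (spaceDeriv c s τ))
      < 4 * inner ℝ (timeDeriv (n := n) c s τ) (timeDeriv (n := n) c s τ)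

end Curves

/-- The `L²` distance `(∫₀¹ d(x(s), y(s))² ds)^{1/2}` of two curves `[0, 1] → M`. -/
def l2Dist {M : Type*} [EMetricSpace M] (x y : ℝ → M) : ℝ≥0∞ :=
  (∫⁻ s in Icc (0 : ℝ) 1, edist (x s) (y s) ^ 2) ^ (1 / 2 : ℝ)

end GeomHeatFlow

end

/-! # Exponential convergence of the geometric heat flow to a geodesic

The rate is `ρ = α`, and all estimates are pointwise, by maximum principles on `[0, 1]`.

Let `J = ∂_τ c`. Differentiating the flow equation gives `D_τ J = α (D_s D_s J + R(J, ∂_s c) ∂_s c)`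
(`IsLeviCivitaOn.covAlong_flow`), so where `J ≠ 0` the curvature bound yields
`∂_τ |J| < α ∂_s² |J| + 4 α |J|`, with `J = 0` at `s = 0, 1`. The first Dirichlet eigenvalue `π²` of
`[0, 1]` exceeds `4 + 1`, and the explicit barrier `(1/8 + s - s²) exp (-α τ)` shows
`|J| ≤ B exp (-α τ)` for `τ ≥ 1` (`dirichlet_decay`, `IsHeatFlow.exists_flowSq_le`).

The squared speed satisfies `∂_τ |∂_s c|² = α ∂_s² |∂_s c|² - 2 α⁻¹ |J|²` with Neumann boundary
conditions, since `∂_s |∂_s c|² = 2 α⁻¹ ⟨∂_s c, J⟩` vanishes at the fixed endpoints. The maximum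
principle `neumann_max` bounds it by its initial maximum and, together with the decay of `J`, shows
that it converges exponentially fast, to a constant in `s` (`IsHeatFlow.exists_abs_speedSq_sub_le`,
`IsHeatFlow.abs_speedSq_sub_le`). This gives the decay of the energy.

Integrating `|J|` in time and using completeness, `c(·, τ)` converges uniformly and exponentially
fast to some `γ` (`IsHeatFlow.exists_limit`). In a chart around a point of `γ` the coordinates of
`c(·, τ)` satisfy `x'' = -Γ(x)(x', x') + α⁻¹ J` with `x'` bounded and `J → 0`, so their velocities
converge as well and the limit solves the geodesic equation (`limit_secondOrder`), which makes it
smooth (`contDiffOn_of_secondOrder`).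

The computations take place in charts. There the Christoffel symbols are characterised by the Koszul
formula (`metricForm_christoffelForm`), which yields metric compatibility and the independence of the
covariant derivative from the chart (`fderiv_transition_christoffelForm`, `toCoord_covDeriv`). -/

noncomputable section

namespace GeomHeatFlow

set_option linter.unusedSectionVars false
set_option synthInstance.maxHeartbeats 200000

/-! ### Bilinear maps depending on a base point -/

section BilinearFamily

variable {E F : Type*} [NormedAddCommGroup E] [NormedSpace ℝ E] [NormedAddCommGroup F]
  [NormedSpace ℝ F]

theorem contDiffOn_bilinear_of_apply [FiniteDimensional ℝ E] {s : Set E} {k : ℕ∞ω}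
    {B : E → E →L[ℝ] E →L[ℝ] F} (h : ∀ u v, ContDiffOn ℝ k (fun z => B z u v) s) :
    ContDiffOn ℝ k B s :=
  contDiffOn_clm_apply.2 fun u => contDiffOn_clm_apply.2 fun v => h u v

theorem fderiv_bilinear_apply {B : E → E →L[ℝ] E →L[ℝ] F} {y : E} (hB : DifferentiableAt ℝ B y)
    (u v w : E) : fderiv ℝ B y u v w = fderiv ℝ (fun z => B z v w) y u := by
  have h1 := (hB.hasFDerivAt.clm_apply (hasFDerivAt_const v y)).clm_apply (hasFDerivAt_const w y)
  rw [h1.fderiv]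
  simp

variable {X H : Type*} [NormedAddCommGroup X] [NormedSpace ℝ X] [NormedAddCommGroup H]
  [NormedSpace ℝ H] {B : E → F →L[ℝ] F →L[ℝ] H} {x : X → E} {V W : X → F} {z : X}

/-- The product rule for a bilinear map depending on a base point. -/
theorem fderiv_bilinear_comp (hB : DifferentiableAt ℝ B (x z))
    (hx : DifferentiableAt ℝ x z) (hV : DifferentiableAt ℝ V z) (hW : DifferentiableAt ℝ W z)
    (e : X) : fderiv ℝ (fun y => B (x y) (V y) (W y)) z e
      = fderiv ℝ B (x z) (fderiv ℝ x z e) (V z) (W z) + B (x z) (fderiv ℝ V z e) (W z)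
        + B (x z) (V z) (fderiv ℝ W z e) := by
  have h0 : HasFDerivAt (fun y => B (x y)) (fderiv ℝ B (x z) ∘SL fderiv ℝ x z) z :=
    HasFDerivAt.comp (G := F →L[ℝ] F →L[ℝ] H) (g := B) z hB.hasFDerivAt hx.hasFDerivAt
  have h1 := h0.clm_apply hV.hasFDerivAt
  have h := h1.clm_apply hW.hasFDerivAt
  rw [h.fderiv]
  simp
  abel

theorem hasDerivWithinAt_bilinear_comp {x : ℝ → E} {V W : ℝ → F} {x' : E} {V' W' : F} {s : ℝ}
    {S : Set ℝ} (hB : DifferentiableAt ℝ B (x s)) (hx : HasDerivWithinAt x x' S s)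
    (hV : HasDerivWithinAt V V' S s) (hW : HasDerivWithinAt W W' S s) :
    HasDerivWithinAt (fun y => B (x y) (V y) (W y))
      (fderiv ℝ B (x s) x' (V s) (W s) + B (x s) V' (W s) + B (x s) (V s) W') S s := by
  have h0 : HasDerivWithinAt (fun y => B (x y)) (fderiv ℝ B (x s) x') S s :=
    HasFDerivAt.comp_hasDerivWithinAt (E := F →L[ℝ] F →L[ℝ] H) (F := E) (l := B) s hB.hasFDerivAt hx
  have h1 := h0.clm_apply hV
  have h := h1.clm_apply hW
  simpa using h

end BilinearFamily

/-! ### Smoothness of determinants and inverse matrices -/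

section MatrixSmooth

variable {E : Type*} [NormedAddCommGroup E] [NormedSpace ℝ E] {n : ℕ} {s : Set E} {k : ℕ∞ω}

theorem contDiffOn_matrix_det {A : E → Matrix (Fin n) (Fin n) ℝ}
    (hA : ∀ i j, ContDiffOn ℝ k (fun y => A y i j) s) : ContDiffOn ℝ k (fun y => (A y).det) s := by
  simp only [Matrix.det_apply]
  refine ContDiffOn.sum fun σ _ => ContDiffOn.const_smul _ ?_
  exact contDiffOn_prod fun i _ => hA _ _

theorem contDiffOn_matrix_inv {A : E → Matrix (Fin n) (Fin n) ℝ}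
    (hA : ∀ i j, ContDiffOn ℝ k (fun y => A y i j) s) (hdet : ∀ y ∈ s, (A y).det ≠ 0)
    (i j : Fin n) : ContDiffOn ℝ k (fun y => (A y)⁻¹ i j) s := by
  simp only [Matrix.inv_def, Ring.inverse_eq_inv', Matrix.smul_apply, smul_eq_mul,
    Matrix.adjugate_apply]
  refine ((contDiffOn_matrix_det hA).inv hdet).mul (contDiffOn_matrix_det fun a b => ?_)
  by_cases h : a = j
  · subst h
    simpa using contDiffOn_const
  · simpa [Matrix.updateRow_apply, h] using hA a b

end MatrixSmooth

/-! ### The metric in a chart -/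

section ChartGeometry

variable {n : ℕ} {M : Type*} [TopologicalSpace M] [ChartedSpace (EuclideanSpace ℝ (Fin n)) M]
  [IsManifold (𝓡 n) ∞ M]

theorem ofCoord_toCoord (p : M) {y : EuclideanSpace ℝ (Fin n)}
    (hy : y ∈ (extChartAt (𝓡 n) p).target)
    (v : TangentSpace (𝓡 n) ((extChartAt (𝓡 n) p).symm y)) :
    ofCoord p y (toCoord p ((extChartAt (𝓡 n) p).symm y) v) = v := by
  have : IsManifold (𝓡 n) 1 M := IsManifold.of_le (n := ∞) (by simp)
  have h := mfderivWithin_extChartAt_symm_comp_mfderiv_extChartAt (I := 𝓡 n) hy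
  simp only [modelWithCornersSelf_coe, range_id, mfderivWithin_univ] at h
  exact DFunLike.congr_fun h v

theorem toCoord_ofCoord (p : M) {y : EuclideanSpace ℝ (Fin n)}
    (hy : y ∈ (extChartAt (𝓡 n) p).target) (v : EuclideanSpace ℝ (Fin n)) :
    toCoord p ((extChartAt (𝓡 n) p).symm y) (ofCoord p y v) = v := by
  have : IsManifold (𝓡 n) 1 M := IsManifold.of_le (n := ∞) (by simp)
  have h := mfderiv_extChartAt_comp_mfderivWithin_extChartAt_symm (I := 𝓡 n) hy
  simp only [modelWithCornersSelf_coe, range_id, mfderivWithin_univ] at h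
  exact DFunLike.congr_fun h v

theorem toCoord_self (p : M) (v : TangentSpace (𝓡 n) p) : toCoord p p v = v := by
  have : IsManifold (𝓡 n) 1 M := IsManifold.of_le (n := ∞) (by simp)
  have h := mfderiv_extChartAt_self (I := 𝓡 n) (x := p)
  exact DFunLike.congr_fun h v

variable [RiemannianBundle (fun x : M => TangentSpace (𝓡 n) x)]

/-- The metric in the chart at `p`, as a bilinear form depending on the coordinates `y`. -/
def metricForm (p : M) (y : EuclideanSpace ℝ (Fin n)) :
    EuclideanSpace ℝ (Fin n) →L[ℝ] EuclideanSpace ℝ (Fin n) →L[ℝ] ℝ :=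
  ∑ i : Fin n, ∑ j : Fin n, metricMatrix p y i j •
    (EuclideanSpace.proj i : EuclideanSpace ℝ (Fin n) →L[ℝ] ℝ).smulRight
      (EuclideanSpace.proj j : EuclideanSpace ℝ (Fin n) →L[ℝ] ℝ)

theorem metricForm_eq_sum (p : M) (y u v : EuclideanSpace ℝ (Fin n)) :
    metricForm p y u v = ∑ i, ∑ j, metricMatrix p y i j * (u i * v j) := by
  simp [metricForm]

theorem metricForm_apply (p : M) (y u v : EuclideanSpace ℝ (Fin n)) :
    metricForm p y u v = inner ℝ (ofCoord p y u) (ofCoord p y v) := by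
  have hexp (w : EuclideanSpace ℝ (Fin n)) :
      ofCoord p y w = ∑ i, w i • ofCoord p y (EuclideanSpace.single i 1) := by
    have : w = ∑ i, w i • EuclideanSpace.single i (1 : ℝ) := by
      simpa using ((EuclideanSpace.basisFun (Fin n) ℝ).sum_repr w).symm
    let L : EuclideanSpace ℝ (Fin n) →L[ℝ] TangentSpace (𝓡 n) ((extChartAt (𝓡 n) p).symm y) :=
      mfderiv (𝓡 n) (𝓡 n) (extChartAt (𝓡 n) p).symm y
    change L w = ∑ i, w i • L (EuclideanSpace.single i 1)
    conv_lhs => rw [this]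
    simp only [map_sum, map_smul]
  rw [hexp u, hexp v, metricForm_eq_sum]
  simp only [sum_inner, inner_sum, real_inner_smul_left, real_inner_smul_right, metricMatrix,
    Matrix.of_apply]
  rw [Finset.sum_comm]
  refine Finset.sum_congr rfl fun i _ => Finset.sum_congr rfl fun j _ => by ring

theorem metricForm_comm (p : M) (y u v : EuclideanSpace ℝ (Fin n)) :
    metricForm p y u v = metricForm p y v u := by
  rw [metricForm_apply, metricForm_apply, real_inner_comm]

theorem metricForm_single (p : M) (y : EuclideanSpace ℝ (Fin n)) (i j : Fin n) :
    metricForm p y (EuclideanSpace.single i 1) (EuclideanSpace.single j 1)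
      = metricMatrix p y i j := by
  rw [metricForm_apply]; rfl

theorem metricForm_sq_le (p : M) (y u v : EuclideanSpace ℝ (Fin n)) :
    metricForm p y u v ^ 2 ≤ metricForm p y u u * metricForm p y v v := by
  simp only [metricForm_apply]
  rw [sq]
  exact real_inner_mul_inner_self_le _ _

theorem eq_zero_of_metricForm_self (p : M) {y : EuclideanSpace ℝ (Fin n)}
    (hy : y ∈ (extChartAt (𝓡 n) p).target) {v : EuclideanSpace ℝ (Fin n)}
    (h : metricForm p y v v = 0) : v = 0 := by
  rw [metricForm_apply, inner_self_eq_zero] at h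
  have := toCoord_ofCoord p hy v
  rw [h] at this
  rw [← this]
  unfold toCoord
  exact map_zero _

/-- The inner product in the coordinates of a chart whose centre may differ from the base point. -/
theorem inner_eq_metricForm (p : M) {x : M} (hx : x ∈ (extChartAt (𝓡 n) p).source)
    (v w : TangentSpace (𝓡 n) x) :
    inner ℝ v w = metricForm p (extChartAt (𝓡 n) p x) (toCoord p x v) (toCoord p x w) := by
  obtain ⟨y, hy, rfl⟩ : ∃ y ∈ (extChartAt (𝓡 n) p).target, (extChartAt (𝓡 n) p).symm y = x :=
    ⟨_, (extChartAt (𝓡 n) p).map_source hx, (extChartAt (𝓡 n) p).left_inv hx⟩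
  rw [(extChartAt (𝓡 n) p).right_inv hy, metricForm_apply, ofCoord_toCoord p hy,
    ofCoord_toCoord p hy]

variable [IsContMDiffRiemannianBundle (𝓡 n) ∞ (EuclideanSpace ℝ (Fin n))
      (fun x : M => TangentSpace (𝓡 n) x)]

theorem contDiffOn_metricMatrix (p : M) (i j : Fin n) :
    ContDiffOn ℝ ∞ (fun y => metricMatrix p y i j) (extChartAt (𝓡 n) p).target := by
  have h1 : IsManifold (𝓡 n) 1 M := IsManifold.of_le (n := ∞) (by simp)
  have key (u : EuclideanSpace ℝ (Fin n)) : ContMDiffOn 𝓘(ℝ, EuclideanSpace ℝ (Fin n))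
      ((𝓡 n).prod 𝓘(ℝ, EuclideanSpace ℝ (Fin n))) ∞
      (fun y => (⟨(extChartAt (𝓡 n) p).symm y, ofCoord p y u⟩ : TangentBundle (𝓡 n) M))
      (extChartAt (𝓡 n) p).target := by
    have h := (contMDiffOn_extChartAt_symm (I := 𝓡 n) (n := ∞) p).contMDiffOn_tangentMapWithin
      (m := ∞) (by simp) (isOpen_extChartAt_target (I := 𝓡 n) p).uniqueMDiffOn
    have hs : ContMDiff 𝓘(ℝ, EuclideanSpace ℝ (Fin n))
      ((𝓡 n).prod 𝓘(ℝ, EuclideanSpace ℝ (Fin n))) ∞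
      (fun y : EuclideanSpace ℝ (Fin n) =>
        (⟨y, u⟩ : TangentBundle 𝓘(ℝ, EuclideanSpace ℝ (Fin n)) (EuclideanSpace ℝ (Fin n)))) :=
      contMDiff_vectorSpace_iff_contDiff.2 contDiff_const
    refine (h.comp (hs.contMDiffOn (s := (extChartAt (𝓡 n) p).target)) ?_).congr ?_
    · intro y hy; exact hy
    · intro y hy
      simp only [Function.comp, tangentMapWithin, ofCoord]
      rw [mfderivWithin_of_mem_nhds ((isOpen_extChartAt_target (I := 𝓡 n) p).mem_nhds hy)]
  have := (key (EuclideanSpace.single i 1)).inner_bundle (key (EuclideanSpace.single j 1))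
  exact contMDiffOn_iff_contDiffOn.1 this

end ChartGeometry

/-! ### The Christoffel symbols -/

section Christoffel

variable {n : ℕ} {M : Type*} [TopologicalSpace M] [ChartedSpace (EuclideanSpace ℝ (Fin n)) M]
  [IsManifold (𝓡 n) ∞ M] [RiemannianBundle (fun x : M => TangentSpace (𝓡 n) x)]
  [IsContMDiffRiemannianBundle (𝓡 n) ∞ (EuclideanSpace ℝ (Fin n))
      (fun x : M => TangentSpace (𝓡 n) x)]

theorem metricMatrix_symm (p : M) (y : EuclideanSpace ℝ (Fin n)) (i j : Fin n) :
    metricMatrix p y i j = metricMatrix p y j i := by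
  rw [← metricForm_single, ← metricForm_single, metricForm_comm]

theorem metricDeriv_symm (p : M) (y : EuclideanSpace ℝ (Fin n)) (i j k : Fin n) :
    metricDeriv p y i j k = metricDeriv p y j i k := by
  unfold metricDeriv
  congr 2
  ext z
  exact metricMatrix_symm p z i j

theorem isUnit_det_metricMatrix (p : M) {y : EuclideanSpace ℝ (Fin n)}
    (hy : y ∈ (extChartAt (𝓡 n) p).target) : IsUnit (metricMatrix p y).det := by
  rw [isUnit_iff_ne_zero]
  intro h
  obtain ⟨v, hv, hv0⟩ := Matrix.exists_mulVec_eq_zero_iff.2 h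
  have : metricForm p y (WithLp.toLp 2 v) (WithLp.toLp 2 v) = 0 := by
    rw [metricForm_eq_sum]
    refine Finset.sum_eq_zero fun i _ => ?_
    have hi : ∑ j, metricMatrix p y i j * v j = 0 := congrFun hv0 i
    calc _ = v i * ∑ j, metricMatrix p y i j * v j := by
          rw [Finset.mul_sum]; exact Finset.sum_congr rfl fun j _ => by simp; ring
      _ = 0 := by rw [hi, mul_zero]
  have := eq_zero_of_metricForm_self p hy this
  exact hv (by simpa using congrArg WithLp.ofLp this)

theorem contDiffOn_metricForm (p : M) :
    ContDiffOn ℝ ∞ (metricForm p) (extChartAt (𝓡 n) p).target := by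
  refine contDiffOn_bilinear_of_apply fun u v => ?_
  simp only [metricForm_eq_sum]
  exact ContDiffOn.sum fun i _ => ContDiffOn.sum fun j _ =>
    (contDiffOn_metricMatrix p i j).mul contDiffOn_const

theorem differentiableAt_metricForm (p : M) {y : EuclideanSpace ℝ (Fin n)}
    (hy : y ∈ (extChartAt (𝓡 n) p).target) : DifferentiableAt ℝ (metricForm p) y :=
  ((contDiffOn_metricForm p).contDiffAt
    ((isOpen_extChartAt_target (I := 𝓡 n) p).mem_nhds hy)).differentiableAt (by simp)

theorem contDiffOn_metricDeriv (p : M) (i j k : Fin n) :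
    ContDiffOn ℝ ∞ (fun y => metricDeriv p y i j k) (extChartAt (𝓡 n) p).target := by
  unfold metricDeriv
  exact ((contDiffOn_metricMatrix p i j).fderiv_of_isOpen
    (isOpen_extChartAt_target (I := 𝓡 n) p) (m := ∞) (by simp)).clm_apply contDiffOn_const

theorem contDiffOn_christoffel (p : M) (i j k : Fin n) :
    ContDiffOn ℝ ∞ (fun y => christoffel p y i j k) (extChartAt (𝓡 n) p).target := by
  unfold christoffel
  refine contDiffOn_const.mul (ContDiffOn.sum fun m _ => ?_)
  refine (contDiffOn_matrix_inv (contDiffOn_metricMatrix p)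
    (fun y hy => (isUnit_det_metricMatrix p hy).ne_zero) i m).mul ?_
  exact ((contDiffOn_metricDeriv p _ _ _).add (contDiffOn_metricDeriv p _ _ _)).sub
    (contDiffOn_metricDeriv p _ _ _)

/-- The bilinear map `Γ(u, v)` of the chart at `p`, as a function of the coordinates `y`. -/
def christoffelForm (p : M) (y : EuclideanSpace ℝ (Fin n)) :
    EuclideanSpace ℝ (Fin n) →L[ℝ] EuclideanSpace ℝ (Fin n) →L[ℝ] EuclideanSpace ℝ (Fin n) :=
  ∑ i : Fin n, ∑ j : Fin n, ∑ k : Fin n, christoffel p y i j k •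
    (EuclideanSpace.proj j : EuclideanSpace ℝ (Fin n) →L[ℝ] ℝ).smulRight
      ((EuclideanSpace.proj k : EuclideanSpace ℝ (Fin n) →L[ℝ] ℝ).smulRight
        (EuclideanSpace.single i (1 : ℝ)))

theorem christoffelForm_apply (p : M) (y u v : EuclideanSpace ℝ (Fin n)) :
    christoffelForm p y u v = christoffelMap p y u v := by
  ext l
  simp [christoffelForm, christoffelMap, mul_assoc, Pi.single_apply, Finset.sum_apply]

theorem contDiffOn_christoffelForm (p : M) :
    ContDiffOn ℝ ∞ (christoffelForm p) (extChartAt (𝓡 n) p).target := by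
  refine contDiffOn_bilinear_of_apply fun u v => ?_
  simp only [christoffelForm_apply, christoffelMap]
  refine (PiLp.continuousLinearEquiv 2 ℝ (fun _ : Fin n => ℝ)).symm.contDiff.comp_contDiffOn
    (contDiffOn_pi.2 fun i => ?_)
  exact ContDiffOn.sum fun j _ => ContDiffOn.sum fun k _ =>
    ((contDiffOn_christoffel p i j k).mul contDiffOn_const).mul contDiffOn_const

theorem differentiableAt_christoffelForm (p : M) {y : EuclideanSpace ℝ (Fin n)}
    (hy : y ∈ (extChartAt (𝓡 n) p).target) : DifferentiableAt ℝ (christoffelForm p) y :=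
  ((contDiffOn_christoffelForm p).contDiffAt
    ((isOpen_extChartAt_target (I := 𝓡 n) p).mem_nhds hy)).differentiableAt (by simp)

theorem christoffel_symm (p : M) (y : EuclideanSpace ℝ (Fin n)) (i j k : Fin n) :
    christoffel p y i j k = christoffel p y i k j := by
  unfold christoffel
  congr 1
  refine Finset.sum_congr rfl fun m _ => ?_
  rw [metricDeriv_symm p y j k m]; ring

theorem christoffelForm_comm (p : M) (y u v : EuclideanSpace ℝ (Fin n)) :
    christoffelForm p y u v = christoffelForm p y v u := by
  simp only [christoffelForm_apply, christoffelMap]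
  congr 1
  ext i
  rw [Finset.sum_comm]
  refine Finset.sum_congr rfl fun j _ => Finset.sum_congr rfl fun k _ => ?_
  rw [christoffel_symm]; ring

theorem fderiv_metricForm_apply (p : M) {y : EuclideanSpace ℝ (Fin n)}
    (hy : y ∈ (extChartAt (𝓡 n) p).target) (u v w : EuclideanSpace ℝ (Fin n)) :
    fderiv ℝ (metricForm p) y u v w
      = ∑ i, ∑ j, ∑ k, metricDeriv p y i j k * (u k * v i * w j) := by
  have hd (i j : Fin n) : DifferentiableAt ℝ (fun z => metricMatrix p z i j) y :=
    ((contDiffOn_metricMatrix p i j).contDiffAt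
      ((isOpen_extChartAt_target (I := 𝓡 n) p).mem_nhds hy)).differentiableAt (by simp)
  have hu : u = ∑ k, u k • EuclideanSpace.single k (1 : ℝ) := by
    simpa using ((EuclideanSpace.basisFun (Fin n) ℝ).sum_repr u).symm
  rw [fderiv_bilinear_apply (differentiableAt_metricForm p hy)]
  have h : HasFDerivAt (fun z => metricForm p z v w) (∑ i : Fin n, ∑ j : Fin n,
      (v i * w j) • fderiv ℝ (fun z => metricMatrix p z i j) y) y := by
    simp only [metricForm_eq_sum]
    exact HasFDerivAt.fun_sum fun i _ => HasFDerivAt.fun_sum fun j _ =>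
      (hd i j).hasFDerivAt.mul_const _
  rw [h.fderiv]
  simp only [_root_.sum_apply, _root_.smul_apply, smul_eq_mul]
  refine Finset.sum_congr rfl fun i _ => Finset.sum_congr rfl fun j _ => ?_
  have : fderiv ℝ (fun z => metricMatrix p z i j) y u = ∑ k, u k * metricDeriv p y i j k := by
    conv_lhs => rw [hu]
    simp [metricDeriv]
  rw [this, Finset.mul_sum]
  refine Finset.sum_congr rfl fun k _ => by ring

theorem sum_metricMatrix_christoffel (p : M) {y : EuclideanSpace ℝ (Fin n)}
    (hy : y ∈ (extChartAt (𝓡 n) p).target) (l j k : Fin n) :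
    ∑ i, metricMatrix p y i l * christoffel p y i j k
      = (1 / 2) * (metricDeriv p y l j k + metricDeriv p y l k j - metricDeriv p y j k l) := by
  set V : Fin n → ℝ := fun m =>
    metricDeriv p y m j k + metricDeriv p y m k j - metricDeriv p y j k m with hV
  have h1 : ∀ i, christoffel p y i j k = (1 / 2) * ((metricMatrix p y)⁻¹.mulVec V) i := fun i => rfl
  have h2 : (metricMatrix p y).mulVec ((metricMatrix p y)⁻¹.mulVec V) = V := by
    rw [Matrix.mulVec_mulVec, Matrix.mul_nonsing_inv _ (isUnit_det_metricMatrix p hy),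
      Matrix.one_mulVec]
  calc _ = (1 / 2) * ∑ i, metricMatrix p y l i * ((metricMatrix p y)⁻¹.mulVec V) i := by
        rw [Finset.mul_sum]
        refine Finset.sum_congr rfl fun i _ => ?_
        rw [h1, metricMatrix_symm p y i l]; ring
    _ = (1 / 2) * V l := by rw [← congrFun h2 l]; rfl

/-- The Koszul formula in a chart, which characterises the Christoffel symbols. -/
theorem metricForm_christoffelForm (p : M) {y : EuclideanSpace ℝ (Fin n)}
    (hy : y ∈ (extChartAt (𝓡 n) p).target) (u v w : EuclideanSpace ℝ (Fin n)) :
    metricForm p y (christoffelForm p y u v) w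
      = (1 / 2) * (fderiv ℝ (metricForm p) y u v w + fderiv ℝ (metricForm p) y v u w
        - fderiv ℝ (metricForm p) y w u v) := by
  have e1 : fderiv ℝ (metricForm p) y u v w
      = ∑ l, ∑ j, ∑ k, metricDeriv p y l k j * (u j * v k * w l) := by
    rw [fderiv_metricForm_apply p hy, Finset.sum_comm]
    refine Finset.sum_congr rfl fun l _ => ?_
    rw [Finset.sum_comm]
    refine Finset.sum_congr rfl fun j _ => Finset.sum_congr rfl fun k _ => ?_
    rw [metricDeriv_symm p y k l j]
  have e2 : fderiv ℝ (metricForm p) y v u w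
      = ∑ l, ∑ j, ∑ k, metricDeriv p y l j k * (u j * v k * w l) := by
    rw [fderiv_metricForm_apply p hy, Finset.sum_comm]
    refine Finset.sum_congr rfl fun l _ => ?_
    refine Finset.sum_congr rfl fun j _ => Finset.sum_congr rfl fun k _ => ?_
    rw [metricDeriv_symm p y j l k]; ring
  have e3 : fderiv ℝ (metricForm p) y w u v
      = ∑ l, ∑ j, ∑ k, metricDeriv p y j k l * (u j * v k * w l) := by
    rw [fderiv_metricForm_apply p hy]
    simp_rw [fun j : Fin n => Finset.sum_comm (s := (Finset.univ : Finset (Fin n)))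
      (t := (Finset.univ : Finset (Fin n)))
      (f := fun k l => metricDeriv p y j k l * (w l * u j * v k))]
    rw [Finset.sum_comm]
    refine Finset.sum_congr rfl fun l _ => ?_
    refine Finset.sum_congr rfl fun j _ => Finset.sum_congr rfl fun k _ => by ring
  have e0 : metricForm p y (christoffelForm p y u v) w = ∑ l, ∑ j, ∑ k,
      (∑ i, metricMatrix p y i l * christoffel p y i j k) * (u j * v k * w l) := by
    rw [metricForm_eq_sum, Finset.sum_comm]
    refine Finset.sum_congr rfl fun l _ => ?_
    simp only [christoffelForm_apply, christoffelMap, Finset.sum_mul, Finset.mul_sum]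
    rw [Finset.sum_comm]
    refine Finset.sum_congr rfl fun j _ => ?_
    rw [Finset.sum_comm]
    refine Finset.sum_congr rfl fun k _ => Finset.sum_congr rfl fun i _ => by ring
  rw [e0, e1, e2, e3]
  simp only [← Finset.sum_add_distrib, ← Finset.sum_sub_distrib, Finset.mul_sum,
    sum_metricMatrix_christoffel p hy]
  refine Finset.sum_congr rfl fun l _ =>
    Finset.sum_congr rfl fun j _ => Finset.sum_congr rfl fun k _ => by ring

theorem fderiv_metricForm_comm (p : M) {y : EuclideanSpace ℝ (Fin n)}
    (hy : y ∈ (extChartAt (𝓡 n) p).target) (u v w : EuclideanSpace ℝ (Fin n)) :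
    fderiv ℝ (metricForm p) y u v w = fderiv ℝ (metricForm p) y u w v := by
  rw [fderiv_metricForm_apply p hy, fderiv_metricForm_apply p hy, Finset.sum_comm]
  refine Finset.sum_congr rfl fun l _ =>
    Finset.sum_congr rfl fun j _ => Finset.sum_congr rfl fun k _ => ?_
  rw [metricDeriv_symm]; ring

/-- The Levi-Civita connection is compatible with the metric. -/
theorem fderiv_metricForm_eq (p : M) {y : EuclideanSpace ℝ (Fin n)}
    (hy : y ∈ (extChartAt (𝓡 n) p).target) (u v w : EuclideanSpace ℝ (Fin n)) :
    fderiv ℝ (metricForm p) y u v w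
      = metricForm p y (christoffelForm p y u v) w + metricForm p y v (christoffelForm p y u w) := by
  rw [metricForm_comm p y v, metricForm_christoffelForm p hy, metricForm_christoffelForm p hy,
    fderiv_metricForm_comm p hy u w v, fderiv_metricForm_comm p hy v u w,
    fderiv_metricForm_comm p hy w u v]
  ring

end Christoffel

/-! ### Change of chart -/

section ChangeOfChart

open Filter Topology

variable {n : ℕ} {M : Type*} [TopologicalSpace M] [ChartedSpace (EuclideanSpace ℝ (Fin n)) M]

/-- The change of coordinates from the chart at `q` to the chart at `p`. -/
def transition (q p : M) (z : EuclideanSpace ℝ (Fin n)) : EuclideanSpace ℝ (Fin n) :=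
  extChartAt (𝓡 n) p ((extChartAt (𝓡 n) q).symm z)

theorem eventually_symm_mem_source {q p x : M} (hq : x ∈ (extChartAt (𝓡 n) q).source)
    (hp : x ∈ (extChartAt (𝓡 n) p).source) :
    ∀ᶠ z in 𝓝 (extChartAt (𝓡 n) q x), z ∈ (extChartAt (𝓡 n) q).target ∧
      (extChartAt (𝓡 n) q).symm z ∈ (extChartAt (𝓡 n) p).source := by
  have h1 : (extChartAt (𝓡 n) q).target ∈ 𝓝 (extChartAt (𝓡 n) q x) :=
    (isOpen_extChartAt_target (I := 𝓡 n) q).mem_nhds ((extChartAt (𝓡 n) q).map_source hq)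
  have h2 : ContinuousAt (extChartAt (𝓡 n) q).symm (extChartAt (𝓡 n) q x) :=
    continuousAt_extChartAt_symm' hq
  refine (eventually_of_mem h1 fun z hz => hz).and (h2.eventually_mem ?_)
  rw [(extChartAt (𝓡 n) q).left_inv hq]
  exact (isOpen_extChartAt_source (I := 𝓡 n) p).mem_nhds hp

variable [IsManifold (𝓡 n) ∞ M]

theorem contDiffAt_transition {q p x : M} (hq : x ∈ (extChartAt (𝓡 n) q).source)
    (hp : x ∈ (extChartAt (𝓡 n) p).source) :
    ContDiffAt ℝ ∞ (transition q p) (extChartAt (𝓡 n) q x) := by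
  have h1 : ContMDiffAt (𝓡 n) (𝓡 n) ∞ (extChartAt (𝓡 n) q).symm (extChartAt (𝓡 n) q x) :=
    (contMDiffOn_extChartAt_symm (I := 𝓡 n) (n := ∞) q).contMDiffAt
      ((isOpen_extChartAt_target (I := 𝓡 n) q).mem_nhds ((extChartAt (𝓡 n) q).map_source hq))
  have h2 : ContMDiffAt (𝓡 n) (𝓡 n) ∞ (extChartAt (𝓡 n) p)
      ((extChartAt (𝓡 n) q).symm (extChartAt (𝓡 n) q x)) := by
    rw [(extChartAt (𝓡 n) q).left_inv hq]
    exact contMDiffAt_extChartAt' (by simpa using hp)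
  exact (h2.comp _ h1).contDiffAt

theorem toCoord_eq_fderiv_transition {q p x : M} (hq : x ∈ (extChartAt (𝓡 n) q).source)
    (hp : x ∈ (extChartAt (𝓡 n) p).source) (v : TangentSpace (𝓡 n) x) :
    toCoord p x v = fderiv ℝ (transition q p) (extChartAt (𝓡 n) q x) (toCoord q x v) := by
  have : IsManifold (𝓡 n) 1 M := IsManifold.of_le (n := ∞) (by simp)
  have h1 : MDifferentiableAt (𝓡 n) (𝓡 n) (extChartAt (𝓡 n) q) x :=
    mdifferentiableAt_extChartAt (by simpa using hq)
  have h2 : MDifferentiableAt (𝓡 n) (𝓡 n) (transition q p) (extChartAt (𝓡 n) q x) :=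
    ((contDiffAt_transition hq hp).differentiableAt (by simp)).mdifferentiableAt
  have h3 : (extChartAt (𝓡 n) p : M → EuclideanSpace ℝ (Fin n)) =ᶠ[𝓝 x]
      transition q p ∘ extChartAt (𝓡 n) q := by
    filter_upwards [(isOpen_extChartAt_source (I := 𝓡 n) q).mem_nhds hq] with z hz
    simp only [transition, Function.comp, (extChartAt (𝓡 n) q).left_inv hz]
  have h4 := mfderiv_comp x h2 h1
  unfold toCoord
  rw [h3.mfderiv_eq, h4, ← mfderiv_eq_fderiv]
  rfl

variable [RiemannianBundle (fun x : M => TangentSpace (𝓡 n) x)]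

theorem metricForm_transition {q p x : M} (hq : x ∈ (extChartAt (𝓡 n) q).source)
    (hp : x ∈ (extChartAt (𝓡 n) p).source) (u v : EuclideanSpace ℝ (Fin n)) :
    metricForm q (extChartAt (𝓡 n) q x) u v
      = metricForm p (extChartAt (𝓡 n) p x) (fderiv ℝ (transition q p) (extChartAt (𝓡 n) q x) u)
        (fderiv ℝ (transition q p) (extChartAt (𝓡 n) q x) v) := by
  obtain ⟨y, hy, rfl⟩ : ∃ y ∈ (extChartAt (𝓡 n) q).target, (extChartAt (𝓡 n) q).symm y = x :=
    ⟨_, (extChartAt (𝓡 n) q).map_source hq, (extChartAt (𝓡 n) q).left_inv hq⟩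
  have e (w : EuclideanSpace ℝ (Fin n)) : fderiv ℝ (transition q p)
      (extChartAt (𝓡 n) q ((extChartAt (𝓡 n) q).symm y)) w
        = toCoord p _ (ofCoord q y w) := by
    rw [toCoord_eq_fderiv_transition hq hp, toCoord_ofCoord q hy]
  rw [e, e, ← inner_eq_metricForm p hp, (extChartAt (𝓡 n) q).right_inv hy, metricForm_apply]

theorem fderiv_transition_injective {q p x : M} (hq : x ∈ (extChartAt (𝓡 n) q).source)
    (hp : x ∈ (extChartAt (𝓡 n) p).source) :
    Function.Injective (fderiv ℝ (transition q p) (extChartAt (𝓡 n) q x)) := by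
  refine (injective_iff_map_eq_zero _).2 fun u hu => ?_
  refine eq_zero_of_metricForm_self q ((extChartAt (𝓡 n) q).map_source hq) ?_
  rw [metricForm_transition hq hp, hu, map_zero]

variable [IsContMDiffRiemannianBundle (𝓡 n) ∞ (EuclideanSpace ℝ (Fin n))
      (fun x : M => TangentSpace (𝓡 n) x)]

/-- The transformation law of the Christoffel symbols. It holds because the Koszul formula
determines them from the metric. -/
theorem fderiv_transition_christoffelForm {q p x : M} (hq : x ∈ (extChartAt (𝓡 n) q).source)
    (hp : x ∈ (extChartAt (𝓡 n) p).source) (u v : EuclideanSpace ℝ (Fin n)) :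
    fderiv ℝ (transition q p) (extChartAt (𝓡 n) q x)
        (christoffelForm q (extChartAt (𝓡 n) q x) u v)
      = christoffelForm p (extChartAt (𝓡 n) p x)
          (fderiv ℝ (transition q p) (extChartAt (𝓡 n) q x) u)
          (fderiv ℝ (transition q p) (extChartAt (𝓡 n) q x) v)
        + fderiv ℝ (fderiv ℝ (transition q p)) (extChartAt (𝓡 n) q x) u v := by
  set z := extChartAt (𝓡 n) q x with hz
  set φ : EuclideanSpace ℝ (Fin n) → EuclideanSpace ℝ (Fin n) := transition q p with hφ
  set D := fderiv ℝ φ z with hD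
  set D2 := fderiv ℝ (fderiv ℝ φ) z with hD2
  have hzt : z ∈ (extChartAt (𝓡 n) q).target := (extChartAt (𝓡 n) q).map_source hq
  have hpt : extChartAt (𝓡 n) p x ∈ (extChartAt (𝓡 n) p).target :=
    (extChartAt (𝓡 n) p).map_source hp
  have hφz : φ z = extChartAt (𝓡 n) p x := by
    simp only [hφ, transition, hz, (extChartAt (𝓡 n) q).left_inv hq]
  have hφs : ContDiffAt ℝ ∞ φ z := contDiffAt_transition hq hp
  have hd : HasFDerivAt φ D z := (hφs.differentiableAt (by simp)).hasFDerivAt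
  have hd2 : HasFDerivAt (fderiv ℝ φ) D2 z :=
    ((hφs.fderiv_right (m := ∞) (by simp)).differentiableAt (by simp)).hasFDerivAt
  have hsymm (a b : EuclideanSpace ℝ (Fin n)) : D2 a b = D2 b a :=
    (hφs.isSymmSndFDerivAt (by simpa using (ENat.LEInfty.out : (2 : WithTop ℕ∞) ≤ _))) a b
  -- the derivative of the pulled back metric
  have hder (a b c : EuclideanSpace ℝ (Fin n)) : fderiv ℝ (metricForm q) z a b c
      = fderiv ℝ (metricForm p) (φ z) (D a) (D b) (D c)
        + metricForm p (φ z) (D2 a b) (D c) + metricForm p (φ z) (D b) (D2 a c) := by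
    rw [fderiv_bilinear_apply (differentiableAt_metricForm q hzt)]
    have h1 : (fun y => metricForm q y b c) =ᶠ[𝓝 z]
        fun y => metricForm p (φ y) (fderiv ℝ φ y b) (fderiv ℝ φ y c) := by
      filter_upwards [eventually_symm_mem_source hq hp] with y hy
      have := metricForm_transition ((extChartAt (𝓡 n) q).map_target hy.1) hy.2 b c
      rwa [(extChartAt (𝓡 n) q).right_inv hy.1] at this
    rw [h1.fderiv_eq]
    have hG : DifferentiableAt ℝ (metricForm p) (φ z) := by
      rw [hφz]; exact differentiableAt_metricForm p hpt
    have hc (c : EuclideanSpace ℝ (Fin n)) : HasFDerivAt (fun y => fderiv ℝ φ y c)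
        (D2.flip c) z := by
      simpa using! hd2.clm_apply (hasFDerivAt_const c z)
    rw [fderiv_bilinear_comp hG hd.differentiableAt (hc b).differentiableAt
      (hc c).differentiableAt, (hc b).fderiv, (hc c).fderiv]
    rfl
  have hinj : Function.Injective D := fderiv_transition_injective hq hp
  have hsurj : Function.Surjective D :=
    (LinearMap.injective_iff_surjective (f := (D : EuclideanSpace ℝ (Fin n) →ₗ[ℝ] _))).1 hinj
  rw [← sub_eq_zero]
  refine eq_zero_of_metricForm_self p hpt ?_
  suffices H : ∀ w, metricForm p (extChartAt (𝓡 n) p x)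
      (D (christoffelForm q z u v) - (christoffelForm p (extChartAt (𝓡 n) p x) (D u) (D v)
        + D2 u v)) w = 0 from H _
  intro w
  obtain ⟨w, rfl⟩ := hsurj w
  have k1 := metricForm_christoffelForm q hzt u v w
  have k2 := metricForm_christoffelForm p hpt (D u) (D v) (D w)
  rw [metricForm_transition hq hp, hder, hder, hder, hφz] at k1
  simp only [map_sub, map_add, _root_.sub_apply, _root_.add_apply]
  change metricForm p (extChartAt (𝓡 n) p x) (D (christoffelForm q z u v)) (D w) = _ at k1
  rw [k1, k2, hsymm v u, hsymm w u, hsymm w v, metricForm_comm p _ (D u) (D2 v w),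
    metricForm_comm p _ (D v) (D2 u w)]
  ring

end ChangeOfChart

/-! ### Curves in a chart -/

section AlongCurves

open Filter Topology

variable {n : ℕ} {M : Type*} [TopologicalSpace M] [ChartedSpace (EuclideanSpace ℝ (Fin n)) M]
  [IsManifold (𝓡 n) ∞ M]

theorem hasDerivWithinAt_velocity {q : M} {x : ℝ → M} {s : ℝ}
    (hx : MDifferentiableWithinAt 𝓘(ℝ, ℝ) (𝓡 n) x (Icc 0 1) s)
    (hq : x s ∈ (extChartAt (𝓡 n) q).source) :
    HasDerivWithinAt (fun σ => extChartAt (𝓡 n) q (x σ)) (toCoord q (x s) (velocity x s))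
      (Icc 0 1) s := by
  have : IsManifold (𝓡 n) 1 M := IsManifold.of_le (n := ∞) (by simp)
  have h1 : MDifferentiableAt (𝓡 n) (𝓡 n) (extChartAt (𝓡 n) q) (x s) :=
    mdifferentiableAt_extChartAt (by simpa using hq)
  have h2 := (h1.hasMFDerivAt.comp_hasMFDerivWithinAt s hx.hasMFDerivWithinAt)
  let L : ℝ →L[ℝ] EuclideanSpace ℝ (Fin n) :=
    (mfderiv (𝓡 n) (𝓡 n) (extChartAt (𝓡 n) q) (x s)).comp
      (mfderivWithin 𝓘(ℝ, ℝ) (𝓡 n) x (Icc 0 1) s)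
  have h3 : HasFDerivWithinAt (fun σ => extChartAt (𝓡 n) q (x σ)) L (Icc 0 1) s :=
    h2.hasFDerivWithinAt
  exact h3.hasDerivWithinAt

theorem hasDerivAt_timeDeriv {q : M} {c : ℝ → ℝ → M} {s τ : ℝ}
    (hx : MDifferentiableAt 𝓘(ℝ, ℝ) (𝓡 n) (fun t => c s t) τ)
    (hq : c s τ ∈ (extChartAt (𝓡 n) q).source) :
    HasDerivAt (fun t => extChartAt (𝓡 n) q (c s t)) (toCoord q (c s τ) (timeDeriv c s τ)) τ := by
  have : IsManifold (𝓡 n) 1 M := IsManifold.of_le (n := ∞) (by simp)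
  have h1 : MDifferentiableAt (𝓡 n) (𝓡 n) (extChartAt (𝓡 n) q) (c s τ) :=
    mdifferentiableAt_extChartAt (by simpa using hq)
  have h2 := (HasMFDerivAt.comp (x := τ) (f := fun t => c s t) h1.hasMFDerivAt hx.hasMFDerivAt)
  let L : ℝ →L[ℝ] EuclideanSpace ℝ (Fin n) :=
    (mfderiv (𝓡 n) (𝓡 n) (extChartAt (𝓡 n) q) (c s τ)).comp
      (mfderiv 𝓘(ℝ, ℝ) (𝓡 n) (fun t => c s t) τ)
  have h3 : HasFDerivAt (fun t => extChartAt (𝓡 n) q (c s t)) L τ := h2.hasFDerivAt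
  exact h3.hasDerivAt

variable [RiemannianBundle (fun x : M => TangentSpace (𝓡 n) x)]
  [IsContMDiffRiemannianBundle (𝓡 n) ∞ (EuclideanSpace ℝ (Fin n))
      (fun x : M => TangentSpace (𝓡 n) x)]

/-- The covariant derivative along a curve is given by the same formula in every chart. -/
theorem toCoord_covDeriv {q : M} {x : ℝ → M} {V : ∀ s : ℝ, TangentSpace (𝓡 n) (x s)} {s : ℝ}
    (hs : s ∈ Icc (0 : ℝ) 1) (hx : MDifferentiableWithinAt 𝓘(ℝ, ℝ) (𝓡 n) x (Icc 0 1) s)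
    (hq : x s ∈ (extChartAt (𝓡 n) q).source)
    {V' : EuclideanSpace ℝ (Fin n)}
    (hV : HasDerivWithinAt (fun σ => toCoord q (x σ) (V σ)) V' (Icc 0 1) s) :
    toCoord q (x s) (covDeriv x V s) = V' + christoffelForm q (extChartAt (𝓡 n) q (x s))
      (toCoord q (x s) (velocity x s)) (toCoord q (x s) (V s)) := by
  set p := x s with hp
  have hps : p ∈ (extChartAt (𝓡 n) p).source := mem_extChartAt_source p
  set ψ : EuclideanSpace ℝ (Fin n) → EuclideanSpace ℝ (Fin n) := transition q p with hψ
  set z := extChartAt (𝓡 n) q p with hz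
  have hψs : ContDiffAt ℝ ∞ ψ z := contDiffAt_transition hq hps
  have hd2 : HasFDerivAt (fderiv ℝ ψ) (fderiv ℝ (fderiv ℝ ψ) z) z :=
    ((hψs.fderiv_right (m := ∞) (by simp)).differentiableAt (by simp)).hasFDerivAt
  have hvel := hasDerivWithinAt_velocity hx hq
  have hu : UniqueDiffWithinAt ℝ (Icc (0 : ℝ) 1) s := uniqueDiffOn_Icc zero_lt_one s hs
  have hcont : ∀ᶠ σ in 𝓝[Icc 0 1] s, x σ ∈ (extChartAt (𝓡 n) q).source ∩
      (extChartAt (𝓡 n) p).source :=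
    hx.continuousWithinAt.eventually_mem (((isOpen_extChartAt_source (I := 𝓡 n) q).inter
      (isOpen_extChartAt_source (I := 𝓡 n) p)).mem_nhds ⟨hq, hps⟩)
  have hVp : HasDerivWithinAt (fun σ => toCoord p (x σ) (V σ))
      (fderiv ℝ (fderiv ℝ ψ) z (toCoord q p (velocity x s)) (toCoord q p (V s))
        + fderiv ℝ ψ z V') (Icc 0 1) s := by
    have h1 : HasDerivWithinAt (fun σ => fderiv ℝ ψ (extChartAt (𝓡 n) q (x σ)))
        (fderiv ℝ (fderiv ℝ ψ) z (toCoord q p (velocity x s))) (Icc 0 1) s :=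
      hd2.comp_hasDerivWithinAt s hvel
    refine (h1.clm_apply hV).congr_of_eventuallyEq ?_ ?_
    · filter_upwards [hcont] with σ hσ
      exact toCoord_eq_fderiv_transition hσ.1 hσ.2 _
    · exact toCoord_eq_fderiv_transition hq hps _
  apply fderiv_transition_injective hq hps
  rw [← toCoord_eq_fderiv_transition hq hps, map_add, fderiv_transition_christoffelForm hq hps,
    ← toCoord_eq_fderiv_transition hq hps, ← toCoord_eq_fderiv_transition hq hps]
  rw [toCoord_self p]
  unfold covDeriv
  rw [hVp.derivWithin hu, ← christoffelForm_apply]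
  have haux (a b c : EuclideanSpace ℝ (Fin n)) : a + b + c = b + (c + a) := by abel
  exact haux _ _ _

end AlongCurves

/-! ### Covariant derivatives along maps into a vector space -/

section ModelCalculus

open Filter Topology

variable {E X : Type*} [NormedAddCommGroup E] [NormedSpace ℝ E] [NormedAddCommGroup X]
  [NormedSpace ℝ X]

/-- A metric `G` and a connection `Γ` on an open subset `U` of a vector space, both smooth,
the connection being torsion free and compatible with the metric. -/
structure IsLeviCivitaOn (G : E → E →L[ℝ] E →L[ℝ] ℝ) (Γ : E → E →L[ℝ] E →L[ℝ] E) (U : Set E) :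
    Prop where
  isOpen : IsOpen U
  contDiffOn_metric : ContDiffOn ℝ ∞ G U
  contDiffOn_connection : ContDiffOn ℝ ∞ Γ U
  metric_comm : ∀ y u v, G y u v = G y v u
  connection_comm : ∀ y u v, Γ y u v = Γ y v u
  fderiv_metric : ∀ y ∈ U, ∀ u v w, fderiv ℝ G y u v w = G y (Γ y u v) w + G y v (Γ y u w)

/-- The covariant derivative in the direction `e` of a vector field `V` along a map `x`. -/
def covAlong (Γ : E → E →L[ℝ] E →L[ℝ] E) (x : X → E) (e : X) (V : X → E) (z : X) : E :=
  fderiv ℝ V z e + Γ (x z) (fderiv ℝ x z e) (V z)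

/-- The curvature of the connection `Γ`. -/
def modelCurvature (Γ : E → E →L[ℝ] E →L[ℝ] E) (y u v w : E) : E :=
  fderiv ℝ Γ y u v w - fderiv ℝ Γ y v u w + Γ y u (Γ y v w) - Γ y v (Γ y u w)

variable {G : E → E →L[ℝ] E →L[ℝ] ℝ} {Γ : E → E →L[ℝ] E →L[ℝ] E} {U : Set E} {x : X → E} {z : X}
  {V W : X → E}

theorem IsLeviCivitaOn.contDiffAt_metric (h : IsLeviCivitaOn G Γ U) {y : E} (hy : y ∈ U) :
    ContDiffAt ℝ ∞ G y :=
  h.contDiffOn_metric.contDiffAt (h.isOpen.mem_nhds hy)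

theorem IsLeviCivitaOn.contDiffAt_connection (h : IsLeviCivitaOn G Γ U) {y : E} (hy : y ∈ U) :
    ContDiffAt ℝ ∞ Γ y :=
  h.contDiffOn_connection.contDiffAt (h.isOpen.mem_nhds hy)

theorem contDiffAt_bilinear_comp {F : Type*} [NormedAddCommGroup F] [NormedSpace ℝ F]
    {B : E → E →L[ℝ] E →L[ℝ] F} (hB : ContDiffAt ℝ ∞ B (x z)) (hx : ContDiffAt ℝ ∞ x z)
    (hV : ContDiffAt ℝ ∞ V z) (hW : ContDiffAt ℝ ∞ W z) :
    ContDiffAt ℝ ∞ (fun y => B (x y) (V y) (W y)) z :=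
  ((ContDiffAt.comp z hB hx).clm_apply hV).clm_apply hW

theorem contDiffAt_fderiv_apply {f : X → E} (hf : ContDiffAt ℝ ∞ f z) (e : X) :
    ContDiffAt ℝ ∞ (fun y => fderiv ℝ f y e) z :=
  (hf.fderiv_right (m := ∞) (by simp)).clm_apply contDiffAt_const

theorem IsLeviCivitaOn.contDiffAt_covAlong (h : IsLeviCivitaOn G Γ U) (hz : x z ∈ U)
    (hx : ContDiffAt ℝ ∞ x z) (hV : ContDiffAt ℝ ∞ V z) (e : X) :
    ContDiffAt ℝ ∞ (covAlong Γ x e V) z :=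
  (contDiffAt_fderiv_apply hV e).add
    (contDiffAt_bilinear_comp (h.contDiffAt_connection hz) hx (contDiffAt_fderiv_apply hx e) hV)

theorem covAlong_congr (hVW : V =ᶠ[𝓝 z] W) (e : X) : covAlong Γ x e V z = covAlong Γ x e W z := by
  unfold covAlong
  rw [hVW.fderiv_eq, hVW.eq_of_nhds]

theorem covAlong_const_smul (hV : ContDiffAt ℝ ∞ V z) (a : ℝ) (e : X) :
    covAlong Γ x e (fun y => a • V y) z = a • covAlong Γ x e V z := by
  unfold covAlong
  rw [fderiv_fun_const_smul (hV.differentiableAt (by simp))]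
  simp

/-- Metric compatibility along a map. -/
theorem IsLeviCivitaOn.fderiv_metric_comp (h : IsLeviCivitaOn G Γ U) (hz : x z ∈ U)
    (hx : ContDiffAt ℝ ∞ x z) (hV : ContDiffAt ℝ ∞ V z) (hW : ContDiffAt ℝ ∞ W z) (e : X) :
    fderiv ℝ (fun y => G (x y) (V y) (W y)) z e
      = G (x z) (covAlong Γ x e V z) (W z) + G (x z) (V z) (covAlong Γ x e W z) := by
  rw [fderiv_bilinear_comp ((h.contDiffAt_metric hz).differentiableAt (by simp))
    (hx.differentiableAt (by simp)) (hV.differentiableAt (by simp))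
    (hW.differentiableAt (by simp)), h.fderiv_metric _ hz]
  simp only [covAlong, map_add, _root_.add_apply]
  ring

theorem fderiv_fderiv_apply_comm {f : X → E} (hf : ContDiffAt ℝ 2 f z) (e e' : X) :
    fderiv ℝ (fun y => fderiv ℝ f y e) z e' = fderiv ℝ (fun y => fderiv ℝ f y e') z e := by
  have hd : DifferentiableAt ℝ (fderiv ℝ f) z :=
    (hf.fderiv_right (m := 1) (by norm_num)).differentiableAt (by simp)
  have hc (a : X) : HasFDerivAt (fun y => fderiv ℝ f y a) ((fderiv ℝ (fderiv ℝ f) z).flip a) z := by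
    simpa using! hd.hasFDerivAt.clm_apply (hasFDerivAt_const a z)
  rw [(hc e).fderiv, (hc e').fderiv]
  exact (hf.isSymmSndFDerivAt (by simp)) e' e

/-- Vanishing of the torsion along a map. -/
theorem IsLeviCivitaOn.covAlong_fderiv_comm (h : IsLeviCivitaOn G Γ U)
    (hx : ContDiffAt ℝ 2 x z) (e e' : X) :
    covAlong Γ x e (fun y => fderiv ℝ x y e') z = covAlong Γ x e' (fun y => fderiv ℝ x y e) z := by
  unfold covAlong
  rw [fderiv_fderiv_apply_comm hx, h.connection_comm]

/-- The commutator of two covariant derivatives along a map is given by the curvature. -/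
theorem IsLeviCivitaOn.covAlong_covAlong (h : IsLeviCivitaOn G Γ U) (hz : x z ∈ U)
    (hx : ContDiffAt ℝ ∞ x z) (hV : ContDiffAt ℝ ∞ V z) (e e' : X) :
    covAlong Γ x e (covAlong Γ x e' V) z = covAlong Γ x e' (covAlong Γ x e V) z
      + modelCurvature Γ (x z) (fderiv ℝ x z e) (fderiv ℝ x z e') (V z) := by
  have key (e e' : X) : covAlong Γ x e (covAlong Γ x e' V) z
      = fderiv ℝ (fun y => fderiv ℝ V y e') z e
        + (fderiv ℝ Γ (x z) (fderiv ℝ x z e) (fderiv ℝ x z e') (V z)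
          + Γ (x z) (fderiv ℝ (fun y => fderiv ℝ x y e') z e) (V z)
          + Γ (x z) (fderiv ℝ x z e') (fderiv ℝ V z e))
        + (Γ (x z) (fderiv ℝ x z e) (fderiv ℝ V z e')
          + Γ (x z) (fderiv ℝ x z e) (Γ (x z) (fderiv ℝ x z e') (V z))) := by
    have hΓ := h.contDiffAt_connection hz
    have hxe := contDiffAt_fderiv_apply hx e'
    have hVe := contDiffAt_fderiv_apply hV e'
    have hc := contDiffAt_bilinear_comp hΓ hx hxe hV
    conv_lhs => unfold covAlong
    rw [map_add]
    congr 1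
    rw [fderiv_fun_add (hVe.differentiableAt (by simp)) (hc.differentiableAt (by simp)),
      _root_.add_apply,
      fderiv_bilinear_comp (hΓ.differentiableAt (by simp)) (hx.differentiableAt (by simp))
        (hxe.differentiableAt (by simp)) (hV.differentiableAt (by simp))]
  rw [key e e', key e' e, fderiv_fderiv_apply_comm (hV.of_le ENat.LEInfty.out) e e',
    fderiv_fderiv_apply_comm (hx.of_le ENat.LEInfty.out) e e']
  unfold modelCurvature
  abel

/-- The Jacobi-type evolution equation of `∂_t x` along a solution of `∂_t x = α D_s ∂_s x`. -/
theorem IsLeviCivitaOn.covAlong_flow (h : IsLeviCivitaOn G Γ U) (hz : x z ∈ U)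
    (hx : ContDiffAt ℝ ∞ x z) {es et : X} {α : ℝ}
    (hflow : ∀ᶠ y in 𝓝 z, fderiv ℝ x y et = α • covAlong Γ x es (fun y => fderiv ℝ x y es) y) :
    covAlong Γ x et (fun y => fderiv ℝ x y et) z
      = α • (covAlong Γ x es (covAlong Γ x es (fun y => fderiv ℝ x y et)) z
        + modelCurvature Γ (x z) (fderiv ℝ x z et) (fderiv ℝ x z es) (fderiv ℝ x z es)) := by
  have hw := contDiffAt_fderiv_apply hx es
  rw [covAlong_congr hflow, covAlong_const_smul (h.contDiffAt_covAlong hz hx hw es),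
    h.covAlong_covAlong hz hx hw et es]
  congr 2
  refine covAlong_congr ?_ _
  have hx' : ∀ᶠ y in 𝓝 z, ContDiffAt ℝ 2 x y :=
    (hx.of_le ENat.LEInfty.out).eventually (by simp)
  filter_upwards [hx'] with y hy using h.covAlong_fderiv_comm hy et es

end ModelCalculus

/-! ### The heat flow in a chart -/

section FlowInCharts

open Filter Topology

variable {n : ℕ} {M : Type*} [TopologicalSpace M] [ChartedSpace (EuclideanSpace ℝ (Fin n)) M]
  [IsManifold (𝓡 n) ∞ M] [RiemannianBundle (fun x : M => TangentSpace (𝓡 n) x)]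
  [IsContMDiffRiemannianBundle (𝓡 n) ∞ (EuclideanSpace ℝ (Fin n))
      (fun x : M => TangentSpace (𝓡 n) x)]

theorem isLeviCivitaOn_chart (p : M) :
    IsLeviCivitaOn (metricForm p) (christoffelForm p) (extChartAt (𝓡 n) p).target where
  isOpen := isOpen_extChartAt_target p
  contDiffOn_metric := contDiffOn_metricForm p
  contDiffOn_connection := contDiffOn_christoffelForm p
  metric_comm := metricForm_comm p
  connection_comm := christoffelForm_comm p
  fderiv_metric := fun _ hy => fderiv_metricForm_eq p hy

theorem curvature_eq_modelCurvature (p : M) (u v w : TangentSpace (𝓡 n) p) :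
    toCoord p p (curvature p u v w) = modelCurvature (christoffelForm p) (extChartAt (𝓡 n) p p)
      (toCoord p p u) (toCoord p p v) (toCoord p p w) := by
  have hd := differentiableAt_christoffelForm p (mem_extChartAt_target (I := 𝓡 n) p)
  rw [toCoord_self]
  unfold modelCurvature
  rw [fderiv_bilinear_apply hd, fderiv_bilinear_apply hd]
  simp only [christoffelForm_apply]
  rfl

variable {α : ℝ} {p q : M} {c : ℝ → ℝ → M} {s τ : ℝ}

theorem IsHeatFlow.contMDiffOn_space (hc : IsHeatFlow n α p q c) (hτ : 0 < τ) :
    ContMDiffOn 𝓘(ℝ, ℝ) (𝓡 n) ∞ (fun σ => c σ τ) (Icc 0 1) := by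
  have h : ContMDiffOn 𝓘(ℝ, ℝ) 𝓘(ℝ, ℝ × ℝ) ∞ (fun σ : ℝ => (σ, τ)) (Icc 0 1) :=
    (contDiff_id.prodMk contDiff_const).contDiffOn.contMDiffOn
  exact hc.smooth.comp h fun σ hσ => ⟨hσ, hτ⟩

theorem IsHeatFlow.contMDiffOn_time (hc : IsHeatFlow n α p q c) (hs : s ∈ Icc (0 : ℝ) 1) :
    ContMDiffOn 𝓘(ℝ, ℝ) (𝓡 n) ∞ (fun t => c s t) (Ioi 0) := by
  have h : ContMDiffOn 𝓘(ℝ, ℝ) 𝓘(ℝ, ℝ × ℝ) ∞ (fun t : ℝ => (s, t)) (Ioi 0) :=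
    (contDiff_const.prodMk contDiff_id).contDiffOn.contMDiffOn
  exact hc.smooth.comp h fun σ hσ => ⟨hs, hσ⟩

theorem IsHeatFlow.mdifferentiableAt_time (hc : IsHeatFlow n α p q c) (hs : s ∈ Icc (0 : ℝ) 1)
    (hτ : 0 < τ) : MDifferentiableAt 𝓘(ℝ, ℝ) (𝓡 n) (fun t => c s t) τ :=
  ((hc.contMDiffOn_time hs).contMDiffAt (Ioi_mem_nhds hτ)).mdifferentiableAt (by simp)

theorem IsHeatFlow.mdifferentiableWithinAt_space (hc : IsHeatFlow n α p q c)
    (hs : s ∈ Icc (0 : ℝ) 1) (hτ : 0 ≤ τ) :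
    MDifferentiableWithinAt 𝓘(ℝ, ℝ) (𝓡 n) (fun σ => c σ τ) (Icc 0 1) s :=
  hc.mdifferentiableOn τ hτ s hs

/-- The heat flow equation in the chart at an arbitrary point `a`, as a second order equation for
the coordinates of the curve `c(·, τ)`. -/
theorem IsHeatFlow.hasDerivWithinAt_spaceDeriv (hc : IsHeatFlow n α p q c) (hα : 0 < α)
    (hs : s ∈ Icc (0 : ℝ) 1) (hτ : 0 < τ) {a : M} (ha : c s τ ∈ (extChartAt (𝓡 n) a).source) :
    HasDerivWithinAt (fun σ => toCoord a (c σ τ) (spaceDeriv c σ τ))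
      (α⁻¹ • toCoord a (c s τ) (timeDeriv c s τ)
        - christoffelForm a (extChartAt (𝓡 n) a (c s τ)) (toCoord a (c s τ) (spaceDeriv c s τ))
          (toCoord a (c s τ) (spaceDeriv c s τ))) (Icc 0 1) s := by
  have hU : UniqueDiffOn ℝ (Icc (0 : ℝ) 1) := uniqueDiffOn_Icc zero_lt_one
  have hsrc : ∀ᶠ σ in 𝓝[Icc 0 1] s, c σ τ ∈ (extChartAt (𝓡 n) a).source :=
    (hc.mdifferentiableWithinAt_space hs hτ.le).continuousWithinAt.eventually_mem
      ((isOpen_extChartAt_source (I := 𝓡 n) a).mem_nhds ha)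
  have hξ : ContDiffWithinAt ℝ ∞ (fun σ => extChartAt (𝓡 n) a (c σ τ)) (Icc 0 1) s :=
    ((contMDiffAt_extChartAt' (n := ∞) (by simpa using ha)).comp_contMDiffWithinAt s
      (hc.contMDiffOn_space hτ s hs)).contDiffWithinAt
  have heq : ∀ σ ∈ Icc (0 : ℝ) 1, c σ τ ∈ (extChartAt (𝓡 n) a).source →
      toCoord a (c σ τ) (spaceDeriv c σ τ)
        = derivWithin (fun σ => extChartAt (𝓡 n) a (c σ τ)) (Icc 0 1) σ := fun σ hσ hσa =>
    ((hasDerivWithinAt_velocity (hc.mdifferentiableWithinAt_space hσ hτ.le) hσa).derivWithin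
      (hU σ hσ)).symm
  have hd : DifferentiableWithinAt ℝ (fun σ => toCoord (n := n) a (c σ τ) (spaceDeriv c σ τ))
      (Icc 0 1) s := by
    have h1 := (hξ.derivWithin (m := ∞) hU (by simp) hs).differentiableWithinAt (by simp)
    refine h1.congr_of_eventuallyEq ?_ (heq s hs ha)
    filter_upwards [hsrc, self_mem_nhdsWithin] with σ h1 h2 using heq σ h2 h1
  have h2 := toCoord_covDeriv hs (hc.mdifferentiableWithinAt_space hs hτ.le) ha
    hd.hasDerivWithinAt
  have h3 : toCoord a (c s τ) (timeDeriv c s τ) = α • toCoord a (c s τ)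
      (covDeriv (n := n) (fun σ => c σ τ) (fun σ => spaceDeriv c σ τ) s) := by
    rw [hc.heat_flow s hs τ hτ]
    exact map_smul (mfderiv (𝓡 n) (𝓡 n) (extChartAt (𝓡 n) a) (c s τ)) α
      (covDeriv (n := n) (fun σ => c σ τ) (fun σ => spaceDeriv c σ τ) s)
  rw [h3, h2, smul_smul, inv_mul_cancel₀ hα.ne', one_smul]
  refine hd.hasDerivWithinAt.congr_deriv (Eq.symm ?_)
  exact add_sub_cancel_right (G := EuclideanSpace ℝ (Fin n)) _ _

/-- The squared speed `|∂_s c|²`. -/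
def speedSq (n : ℕ) {M : Type*} [TopologicalSpace M]
    [ChartedSpace (EuclideanSpace ℝ (Fin n)) M]
    [RiemannianBundle (fun x : M => TangentSpace (𝓡 n) x)] (c : ℝ → ℝ → M) (s τ : ℝ) : ℝ :=
  inner ℝ (spaceDeriv (n := n) c s τ) (spaceDeriv (n := n) c s τ)

/-- The squared norm `|∂_τ c|²` of the flow velocity. -/
def flowSq (n : ℕ) {M : Type*} [TopologicalSpace M]
    [ChartedSpace (EuclideanSpace ℝ (Fin n)) M]
    [RiemannianBundle (fun x : M => TangentSpace (𝓡 n) x)] (c : ℝ → ℝ → M) (s τ : ℝ) : ℝ :=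
  inner ℝ (timeDeriv (n := n) c s τ) (timeDeriv (n := n) c s τ)

theorem IsHeatFlow.hasDerivWithinAt_speedSq (hc : IsHeatFlow n α p q c) (hα : 0 < α)
    (hs : s ∈ Icc (0 : ℝ) 1) (hτ : 0 < τ) :
    HasDerivWithinAt (fun σ => speedSq n c σ τ)
      (2 * α⁻¹ * inner ℝ (spaceDeriv (n := n) c s τ) (timeDeriv (n := n) c s τ)) (Icc 0 1) s := by
  set a := c s τ with ha'
  have ha : c s τ ∈ (extChartAt (𝓡 n) a).source := mem_extChartAt_source a
  have hat := (extChartAt (𝓡 n) a).map_source ha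
  have hsrc : ∀ᶠ σ in 𝓝[Icc 0 1] s, c σ τ ∈ (extChartAt (𝓡 n) a).source :=
    (hc.mdifferentiableWithinAt_space hs hτ.le).continuousWithinAt.eventually_mem
      ((isOpen_extChartAt_source (I := 𝓡 n) a).mem_nhds ha)
  have h1 := hasDerivWithinAt_velocity (hc.mdifferentiableWithinAt_space hs hτ.le) ha
  have h2 := hc.hasDerivWithinAt_spaceDeriv hα hs hτ ha
  have h4 := hasDerivWithinAt_bilinear_comp (differentiableAt_metricForm a hat) h1 h2 h2
  refine (h4.congr_of_eventuallyEq (f₁ := fun σ => speedSq n c σ τ) ?_ ?_).congr_deriv ?_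
  · filter_upwards [hsrc] with σ hσ using inner_eq_metricForm a hσ _ _
  · exact inner_eq_metricForm a ha _ _
  · rw [inner_eq_metricForm a ha]
    rw [fderiv_metricForm_eq a hat]
    simp only [map_sub, map_smul, _root_.sub_apply, _root_.smul_apply, smul_eq_mul, spaceDeriv]
    rw [metricForm_comm a _ (toCoord a (c s τ) (timeDeriv c s τ))]
    ring

end FlowInCharts

/-! ### Evolution equations of the squared velocities -/

section PartialDerivatives

variable {E : Type*} [NormedAddCommGroup E] [NormedSpace ℝ E] {f : ℝ × ℝ → E} {z : ℝ × ℝ}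

theorem hasDerivAt_fst_of_differentiableAt (hf : DifferentiableAt ℝ f z) :
    HasDerivAt (fun σ => f (σ, z.2)) (fderiv ℝ f z (1, 0)) z.1 := by
  have h : HasDerivAt (fun σ : ℝ => (σ, z.2)) ((1 : ℝ), (0 : ℝ)) z.1 :=
    (hasDerivAt_id _).prodMk (hasDerivAt_const _ _)
  exact HasFDerivAt.comp_hasDerivAt (l := f) z.1 (hf.hasFDerivAt) h

theorem hasDerivAt_snd_of_differentiableAt (hf : DifferentiableAt ℝ f z) :
    HasDerivAt (fun t => f (z.1, t)) (fderiv ℝ f z (0, 1)) z.2 := by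
  have h : HasDerivAt (fun t : ℝ => (z.1, t)) ((0 : ℝ), (1 : ℝ)) z.2 :=
    (hasDerivAt_const _ _).prodMk (hasDerivAt_id _)
  exact HasFDerivAt.comp_hasDerivAt (l := f) z.2 (hf.hasFDerivAt) h

end PartialDerivatives

section FlowScalars

open Filter Topology

variable {n : ℕ} {M : Type*} [TopologicalSpace M] [ChartedSpace (EuclideanSpace ℝ (Fin n)) M]
  [IsManifold (𝓡 n) ∞ M] [RiemannianBundle (fun x : M => TangentSpace (𝓡 n) x)]
  [IsContMDiffRiemannianBundle (𝓡 n) ∞ (EuclideanSpace ℝ (Fin n))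
      (fun x : M => TangentSpace (𝓡 n) x)]

variable {α : ℝ} {p q : M} {c : ℝ → ℝ → M} {s τ : ℝ}

/-- Not an instance, since the exponent `∞` in the hypothesis does not occur in the conclusion. -/
theorem isContinuousRiemannianBundle_tangent :
    IsContinuousRiemannianBundle (EuclideanSpace ℝ (Fin n))
      (fun x : M => TangentSpace (𝓡 n) x) := by
  obtain ⟨g, hg, h⟩ := IsContMDiffRiemannianBundle.exists_contMDiff (IB := 𝓡 n) (n := ∞)
    (F := EuclideanSpace ℝ (Fin n)) (E := fun x : M => TangentSpace (𝓡 n) x)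
  exact ⟨g, hg.continuous, h⟩

theorem IsHeatFlow.continuousOn_speedSq (hc : IsHeatFlow n α p q c) :
    ContinuousOn (fun z : ℝ × ℝ => speedSq n c z.1 z.2) (Icc 0 1 ×ˢ Ici 0) :=
  have := isContinuousRiemannianBundle_tangent (n := n) (M := M)
  hc.continuousOn.inner_bundle hc.continuousOn

theorem IsHeatFlow.continuousOn_flowSq (hc : IsHeatFlow n α p q c) :
    ContinuousOn (fun z : ℝ × ℝ => flowSq n c z.1 z.2) (Icc 0 1 ×ˢ Ioi 0) := by
  have hU : UniqueMDiffOn 𝓘(ℝ, ℝ × ℝ) (Icc (0 : ℝ) 1 ×ˢ Ioi (0 : ℝ)) :=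
    ((uniqueDiffOn_Icc zero_lt_one).prod isOpen_Ioi.uniqueDiffOn).uniqueMDiffOn
  have h := hc.smooth.continuousOn_tangentMapWithin (by simp) hU
  have hs : ContMDiff 𝓘(ℝ, ℝ × ℝ) (𝓘(ℝ, ℝ × ℝ).prod 𝓘(ℝ, ℝ × ℝ)) ∞
      (fun z : ℝ × ℝ => (⟨z, ((0 : ℝ), (1 : ℝ))⟩ : TangentBundle 𝓘(ℝ, ℝ × ℝ) (ℝ × ℝ))) :=
    contMDiff_vectorSpace_iff_contDiff.2 contDiff_const
  have hJ : ContinuousOn (fun z : ℝ × ℝ =>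
      (⟨c z.1 z.2, timeDeriv c z.1 z.2⟩ : TangentBundle (𝓡 n) M)) (Icc 0 1 ×ˢ Ioi 0) := by
    refine (h.comp hs.continuous.continuousOn (fun z hz => hz)).congr ?_
    rintro ⟨s, τ⟩ ⟨hs, hτ⟩
    have h1 := (hc.smooth.mdifferentiableOn (by simp) (s, τ) ⟨hs, hτ⟩).hasMFDerivWithinAt
    have h2 : HasMFDerivWithinAt 𝓘(ℝ, ℝ) 𝓘(ℝ, ℝ × ℝ) (fun t : ℝ => (s, t)) (Ioi 0) τ
        (ContinuousLinearMap.inr ℝ ℝ ℝ) :=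
      (hasFDerivAt_prodMk_right s τ).hasFDerivWithinAt.hasMFDerivWithinAt
    have h3 := h1.comp τ h2 (fun t ht => ⟨hs, ht⟩)
    have h4 := (h3.hasMFDerivAt (Ioi_mem_nhds hτ)).mfderiv
    simp only [Function.comp, tangentMapWithin, timeDeriv]
    simp only [Function.comp_def] at h4
    rw [h4]
    rfl
  have := isContinuousRiemannianBundle_tangent (n := n) (M := M)
  exact hJ.inner_bundle hJ

theorem flowSq_eq_zero_of_const {p : M} (h : ∀ t, 0 ≤ t → c s t = p) (hτ : 0 < τ) :
    flowSq n c s τ = 0 := by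
  have h1 : (fun t => c s t) =ᶠ[𝓝 τ] fun _ => p := by
    filter_upwards [Ioi_mem_nhds hτ] with t ht using h t (le_of_lt ht)
  have h2 : timeDeriv (n := n) c s τ = 0 := by
    unfold timeDeriv
    rw [h1.mfderiv_eq, mfderiv_const]
    rfl
  unfold flowSq
  rw [h2, inner_zero_left]

/-- Near an interior point, the flow is smooth in a chart and satisfies the chart form of the heat
flow equation. -/
theorem IsHeatFlow.eventually_coord (hc : IsHeatFlow n α p q c)
    (hs : s ∈ Ioo (0 : ℝ) 1) (hτ : 0 < τ) {a : M} (ha : c s τ ∈ (extChartAt (𝓡 n) a).source) :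
    ∀ᶠ z : ℝ × ℝ in 𝓝 (s, τ), z.1 ∈ Ioo (0 : ℝ) 1 ∧ 0 < z.2 ∧
      c z.1 z.2 ∈ (extChartAt (𝓡 n) a).source ∧
      ContDiffAt ℝ ∞ (fun z : ℝ × ℝ => extChartAt (𝓡 n) a (c z.1 z.2)) z ∧
      toCoord a (c z.1 z.2) (spaceDeriv c z.1 z.2)
        = fderiv ℝ (fun z : ℝ × ℝ => extChartAt (𝓡 n) a (c z.1 z.2)) z (1, 0) ∧
      toCoord a (c z.1 z.2) (timeDeriv c z.1 z.2)
        = fderiv ℝ (fun z : ℝ × ℝ => extChartAt (𝓡 n) a (c z.1 z.2)) z (0, 1) := by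
  have hO : IsOpen (Ioo (0 : ℝ) 1 ×ˢ Ioi (0 : ℝ)) := isOpen_Ioo.prod isOpen_Ioi
  have hsub : Ioo (0 : ℝ) 1 ×ˢ Ioi (0 : ℝ) ⊆ Icc (0 : ℝ) 1 ×ˢ Ioi (0 : ℝ) :=
    prod_mono Ioo_subset_Icc_self subset_rfl
  have hcont : ContinuousAt (fun z : ℝ × ℝ => c z.1 z.2) (s, τ) :=
    ((hc.smooth.mono hsub).continuousOn).continuousAt (hO.mem_nhds ⟨hs, hτ⟩)
  filter_upwards [hO.mem_nhds ⟨hs, hτ⟩,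
    hcont.eventually_mem ((isOpen_extChartAt_source (I := 𝓡 n) a).mem_nhds ha)] with z hz hza
  have h1 : ContMDiffAt 𝓘(ℝ, ℝ × ℝ) (𝓡 n) ∞ (fun z : ℝ × ℝ => c z.1 z.2) z :=
    (hc.smooth.mono hsub).contMDiffAt (hO.mem_nhds hz)
  have h2 : ContDiffAt ℝ ∞ (fun z : ℝ × ℝ => extChartAt (𝓡 n) a (c z.1 z.2)) z :=
    ((contMDiffAt_extChartAt' (n := ∞) (by simpa using hza)).comp z h1).contDiffAt
  have hd := h2.differentiableAt (by simp)
  have hz1 : z.1 ∈ Icc (0 : ℝ) 1 := Ioo_subset_Icc_self hz.1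
  refine ⟨hz.1, hz.2, hza, h2, ?_, ?_⟩
  · have h3 := hasDerivWithinAt_velocity
      (hc.mdifferentiableWithinAt_space hz1 (le_of_lt hz.2)) hza
    exact (h3.hasDerivAt (Icc_mem_nhds hz.1.1 hz.1.2)).unique
      (hasDerivAt_fst_of_differentiableAt hd)
  · exact (hasDerivAt_timeDeriv (hc.mdifferentiableAt_time hz1 hz.2) hza).unique
      (hasDerivAt_snd_of_differentiableAt hd)

/-- The heat flow equation near an interior point, as an equation between maps into the model space
for which the covariant calculus of `IsLeviCivitaOn` is available. -/
theorem IsHeatFlow.eventually_flow (hc : IsHeatFlow n α p q c) (hα : 0 < α)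
    (hs : s ∈ Ioo (0 : ℝ) 1) (hτ : 0 < τ) {a : M} (ha : c s τ ∈ (extChartAt (𝓡 n) a).source) :
    ∀ᶠ z : ℝ × ℝ in 𝓝 (s, τ), fderiv ℝ (fun z : ℝ × ℝ => extChartAt (𝓡 n) a (c z.1 z.2)) z (0, 1)
      = α • covAlong (christoffelForm a) (fun z : ℝ × ℝ => extChartAt (𝓡 n) a (c z.1 z.2)) (1, 0)
        (fun z => fderiv ℝ (fun z : ℝ × ℝ => extChartAt (𝓡 n) a (c z.1 z.2)) z (1, 0)) z := by
  filter_upwards [(hc.eventually_coord hs hτ ha).eventually_nhds] with z hz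
  obtain ⟨hz1, hz2, hza, hx, hw, hj⟩ := hz.self_of_nhds
  have h1 := (hc.hasDerivWithinAt_spaceDeriv hα (Ioo_subset_Icc_self hz1) hz2 hza).hasDerivAt
    (Icc_mem_nhds hz1.1 hz1.2)
  have h2 := hasDerivAt_fst_of_differentiableAt
    ((contDiffAt_fderiv_apply hx (1, 0)).differentiableAt (by simp))
  have hcurve : ContinuousAt (fun σ : ℝ => (σ, z.2)) z.1 := by fun_prop
  have h3 : (fun σ => toCoord a (c σ z.2) (spaceDeriv c σ z.2)) =ᶠ[𝓝 z.1]
      fun σ => fderiv ℝ (fun z : ℝ × ℝ => extChartAt (𝓡 n) a (c z.1 z.2)) (σ, z.2) (1, 0) := by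
    filter_upwards [hcurve.eventually hz] with σ hσ using hσ.2.2.2.2.1
  have h4 := (h1.congr_of_eventuallyEq h3.symm).unique h2
  unfold covAlong
  rw [← h4, ← hj, hw, sub_add_cancel, smul_smul, mul_inv_cancel₀ hα.ne', one_smul]

/-- The differential inequality for `b = |∂_τ c|²` at a point where `J = ∂_τ c` does not vanish.
Here `K = |D_s J|²` and `b1 = 2⟨D_s J, J⟩`. The evolution equation
`D_τ J = α (D_s D_s J + R(J, ∂_s c) ∂_s c)` gives
`∂_τ b = α ∂_s² b - 2 α K + 2 α ⟨J, R(J, ∂_s c) ∂_s c⟩`, and the curvature bound enters through the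
last term. -/
theorem IsHeatFlow.flowSq_subsolution (hc : IsHeatFlow n α p q c) (hα : 0 < α)
    (hR : CurvatureBound n c) (hs : s ∈ Ioo (0 : ℝ) 1) (hτ : 0 < τ) (hb : 0 < flowSq n c s τ) :
    ∃ (b1 : ℝ → ℝ) (b2 bt K : ℝ),
      (∀ᶠ σ in 𝓝 s, HasDerivAt (fun σ => flowSq n c σ τ) (b1 σ) σ) ∧ HasDerivAt b1 b2 s ∧
      HasDerivAt (fun t => flowSq n c s t) bt τ ∧ b1 s ^ 2 ≤ 4 * flowSq n c s τ * K ∧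
      bt < α * b2 + 8 * α * flowSq n c s τ - 2 * α * K := by
  set a := c s τ with haa
  have ha : c s τ ∈ (extChartAt (𝓡 n) a).source := mem_extChartAt_source a
  have hL := isLeviCivitaOn_chart (n := n) a
  have hev := hc.eventually_coord hs hτ ha
  have hfl := hc.eventually_flow hα hs hτ ha
  set x : ℝ × ℝ → EuclideanSpace ℝ (Fin n) := fun z => extChartAt (𝓡 n) a (c z.1 z.2) with hx
  set Γ := christoffelForm (n := n) a
  set G := metricForm (n := n) a
  set z₀ : ℝ × ℝ := (s, τ) with hz₀
  set J : ℝ × ℝ → EuclideanSpace ℝ (Fin n) := fun z => fderiv ℝ x z (0, 1) with hJ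
  set DJ := covAlong Γ x (1, 0) J with hDJ
  obtain ⟨-, -, -, hx0, hw0, hj0⟩ := hev.self_of_nhds
  have hJ0 : ContDiffAt ℝ ∞ J z₀ := contDiffAt_fderiv_apply hx0 _
  have hxU : x z₀ ∈ (extChartAt (𝓡 n) a).target := (extChartAt (𝓡 n) a).map_source ha
  have hDJ0 : ContDiffAt ℝ ∞ DJ z₀ := hL.contDiffAt_covAlong hxU hx0 hJ0 _
  set B : ℝ × ℝ → ℝ := fun z => G (x z) (J z) (J z) with hB
  have hBev : ∀ᶠ z in 𝓝 z₀, flowSq n c z.1 z.2 = B z := by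
    filter_upwards [hev] with z hz
    simp only [flowSq, hB, hJ]
    rw [inner_eq_metricForm a hz.2.2.1, hz.2.2.2.2.2]
  have hline1 : ContinuousAt (fun σ : ℝ => (σ, τ)) s := by fun_prop
  have hline2 : ContinuousAt (fun t : ℝ => (s, t)) τ := by fun_prop
  have hB0 : flowSq n c s τ = B z₀ := hBev.self_of_nhds
  have hBd : DifferentiableAt ℝ B z₀ :=
    (contDiffAt_bilinear_comp (hL.contDiffAt_metric hxU) hx0 hJ0 hJ0).differentiableAt (by simp)
  refine ⟨fun σ => 2 * G (x (σ, τ)) (DJ (σ, τ)) (J (σ, τ)),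
    2 * (G (x z₀) (covAlong Γ x (1, 0) DJ z₀) (J z₀) + G (x z₀) (DJ z₀) (DJ z₀)),
    fderiv ℝ B z₀ (0, 1), G (x z₀) (DJ z₀) (DJ z₀), ?_, ?_, ?_, ?_, ?_⟩
  · filter_upwards [hline1.eventually hBev.eventually_nhds, hline1.eventually hev] with σ h1 h2
    obtain ⟨-, -, hσa, hσx, -, -⟩ := h2
    have hσU : x (σ, τ) ∈ (extChartAt (𝓡 n) a).target := (extChartAt (𝓡 n) a).map_source hσa
    have hσJ : ContDiffAt ℝ ∞ J (σ, τ) := contDiffAt_fderiv_apply hσx _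
    have h3 := hasDerivAt_fst_of_differentiableAt
      ((contDiffAt_bilinear_comp (hL.contDiffAt_metric hσU) hσx hσJ hσJ).differentiableAt
        (by simp))
    rw [hL.fderiv_metric_comp hσU hσx hσJ hσJ, hL.metric_comm _ (J (σ, τ)), ← two_mul] at h3
    have hline : ContinuousAt (fun σ : ℝ => (σ, τ)) σ := by fun_prop
    refine h3.congr_of_eventuallyEq ?_
    filter_upwards [hline.eventually h1] with r hr using hr
  · have h3 := hasDerivAt_fst_of_differentiableAt
      ((contDiffAt_bilinear_comp (hL.contDiffAt_metric hxU) hx0 hDJ0 hJ0).differentiableAt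
        (by simp))
    rw [hL.fderiv_metric_comp hxU hx0 hDJ0 hJ0] at h3
    exact h3.const_mul 2
  · refine (hasDerivAt_snd_of_differentiableAt hBd).congr_of_eventuallyEq ?_
    filter_upwards [hline2.eventually hBev] with t ht using ht
  · rw [hB0]
    have := metricForm_sq_le a (x z₀) (DJ z₀) (J z₀)
    simp only [hB]
    nlinarith
  · have hcurv := hR s (Ioo_subset_Icc_self hs) τ hτ (fun h => by
      rw [flowSq, h, inner_zero_left] at hb; exact lt_irrefl _ hb)
    have h5 : fderiv ℝ B z₀ (0, 1) = 2 * G (x z₀) (J z₀) (covAlong Γ x (0, 1) J z₀) := by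
      simp only [hB]
      rw [hL.fderiv_metric_comp hxU hx0 hJ0 hJ0, hL.metric_comm _ _ (J z₀), ← two_mul]
    have h6 : covAlong Γ x (0, 1) J z₀ = α • (covAlong Γ x (1, 0) DJ z₀
        + modelCurvature Γ (x z₀) (J z₀) (fderiv ℝ x z₀ (1, 0)) (fderiv ℝ x z₀ (1, 0))) :=
      hL.covAlong_flow hxU hx0 hfl
    have h7 : G (x z₀) (J z₀)
        (modelCurvature Γ (x z₀) (J z₀) (fderiv ℝ x z₀ (1, 0)) (fderiv ℝ x z₀ (1, 0)))
        < 4 * B z₀ := by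
      rw [← hB0]
      refine lt_of_eq_of_lt ?_ hcurv
      rw [inner_eq_metricForm a ha]
      have := curvature_eq_modelCurvature a (timeDeriv (n := n) c s τ) (spaceDeriv c s τ)
        (spaceDeriv c s τ)
      change toCoord a (c s τ) _ = _ at this
      rw [this]
      change _ = G (x z₀) (toCoord a (c s τ) (timeDeriv c s τ)) (modelCurvature Γ (x z₀)
        (toCoord a (c s τ) (timeDeriv c s τ)) (toCoord a (c s τ) (spaceDeriv c s τ))
        (toCoord a (c s τ) (spaceDeriv c s τ)))
      have hJz : J z₀ = toCoord a (c s τ) (timeDeriv c s τ) := hj0.symm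
      rw [← hw0, hJz]
    rw [h5, h6, hB0, map_smul, map_add, smul_eq_mul, hL.metric_comm _ (J z₀) (covAlong Γ _ _ _ _)]
    nlinarith

/-- The evolution equation `∂_τ a = α ∂_s² a - 2 α⁻¹ |∂_τ c|²` of `a = |∂_s c|²`, with
`a1 = 2⟨D_s ∂_s c, ∂_s c⟩`. The curvature does not enter, as `R(∂_τ c, ∂_s c)` does not appear in
`D_τ ∂_s c = D_s ∂_τ c`. -/
theorem IsHeatFlow.speedSq_equation (hc : IsHeatFlow n α p q c) (hα : 0 < α)
    (hs : s ∈ Ioo (0 : ℝ) 1) (hτ : 0 < τ) :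
    ∃ (a1 : ℝ → ℝ) (a2 : ℝ),
      (∀ᶠ σ in 𝓝 s, HasDerivAt (fun σ => speedSq n c σ τ) (a1 σ) σ) ∧ HasDerivAt a1 a2 s ∧
      HasDerivAt (fun t => speedSq n c s t) (α * a2 - 2 * α⁻¹ * flowSq n c s τ) τ := by
  set a := c s τ with haa
  have ha : c s τ ∈ (extChartAt (𝓡 n) a).source := mem_extChartAt_source a
  have hL := isLeviCivitaOn_chart (n := n) a
  have hev := hc.eventually_coord hs hτ ha
  have hfl := hc.eventually_flow hα hs hτ ha
  set x : ℝ × ℝ → EuclideanSpace ℝ (Fin n) := fun z => extChartAt (𝓡 n) a (c z.1 z.2) with hx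
  set Γ := christoffelForm (n := n) a
  set G := metricForm (n := n) a
  set z₀ : ℝ × ℝ := (s, τ) with hz₀
  set J : ℝ × ℝ → EuclideanSpace ℝ (Fin n) := fun z => fderiv ℝ x z (0, 1) with hJ
  set W : ℝ × ℝ → EuclideanSpace ℝ (Fin n) := fun z => fderiv ℝ x z (1, 0) with hW
  obtain ⟨-, -, -, hx0, hw0, hj0⟩ := hev.self_of_nhds
  have hJ0 : ContDiffAt ℝ ∞ J z₀ := contDiffAt_fderiv_apply hx0 _
  have hW0 : ContDiffAt ℝ ∞ W z₀ := contDiffAt_fderiv_apply hx0 _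
  have hxU : x z₀ ∈ (extChartAt (𝓡 n) a).target := (extChartAt (𝓡 n) a).map_source ha
  set A : ℝ × ℝ → ℝ := fun z => G (x z) (W z) (W z) with hA
  have hAev : ∀ᶠ z in 𝓝 z₀, speedSq n c z.1 z.2 = A z := by
    filter_upwards [hev] with z hz
    simp only [speedSq, hA, hW]
    rw [inner_eq_metricForm a hz.2.2.1, hz.2.2.2.2.1]
  have hline1 : ContinuousAt (fun σ : ℝ => (σ, τ)) s := by fun_prop
  have hline2 : ContinuousAt (fun t : ℝ => (s, t)) τ := by fun_prop
  have hB0 : flowSq n c s τ = G (x z₀) (J z₀) (J z₀) := by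
    simp only [flowSq, hJ]
    rw [inner_eq_metricForm a ha, ← hj0]
  have hAd : DifferentiableAt ℝ A z₀ :=
    (contDiffAt_bilinear_comp (hL.contDiffAt_metric hxU) hx0 hW0 hW0).differentiableAt (by simp)
  have hDW : ∀ᶠ z in 𝓝 z₀, covAlong Γ x (1, 0) W z = α⁻¹ • J z := by
    filter_upwards [hfl] with z hz
    simp only [hJ]
    rw [hz, smul_smul, inv_mul_cancel₀ hα.ne', one_smul]
  refine ⟨fun σ => 2 * α⁻¹ * G (x (σ, τ)) (J (σ, τ)) (W (σ, τ)),
    2 * α⁻¹ * (G (x z₀) (covAlong Γ x (1, 0) J z₀) (W z₀) + α⁻¹ * flowSq n c s τ), ?_, ?_, ?_⟩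
  · filter_upwards [hline1.eventually hAev.eventually_nhds, hline1.eventually hev,
      hline1.eventually hDW] with σ h1 h2 hD
    obtain ⟨-, -, hσa, hσx, -, -⟩ := h2
    have hσU : x (σ, τ) ∈ (extChartAt (𝓡 n) a).target := (extChartAt (𝓡 n) a).map_source hσa
    have hσW : ContDiffAt ℝ ∞ W (σ, τ) := contDiffAt_fderiv_apply hσx _
    have h3 := hasDerivAt_fst_of_differentiableAt
      ((contDiffAt_bilinear_comp (hL.contDiffAt_metric hσU) hσx hσW hσW).differentiableAt
        (by simp))
    rw [hL.fderiv_metric_comp hσU hσx hσW hσW, hL.metric_comm _ (W (σ, τ)), ← two_mul, hD] at h3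
    have hline : ContinuousAt (fun σ : ℝ => (σ, τ)) σ := by fun_prop
    refine (h3.congr_of_eventuallyEq ?_).congr_deriv ?_
    · filter_upwards [hline.eventually h1] with r hr using hr
    · simp only [map_smul, _root_.smul_apply, smul_eq_mul]; ring
  · have h3 := hasDerivAt_fst_of_differentiableAt
      ((contDiffAt_bilinear_comp (hL.contDiffAt_metric hxU) hx0 hJ0 hW0).differentiableAt
        (by simp))
    rw [hL.fderiv_metric_comp hxU hx0 hJ0 hW0, hDW.self_of_nhds] at h3
    refine (h3.const_mul (2 * α⁻¹)).congr_deriv ?_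
    rw [hB0, map_smul, smul_eq_mul]
  · have h5 : fderiv ℝ A z₀ (0, 1) = 2 * G (x z₀) (covAlong Γ x (0, 1) W z₀) (W z₀) := by
      simp only [hA]
      rw [hL.fderiv_metric_comp hxU hx0 hW0 hW0, hL.metric_comm _ (W z₀), ← two_mul]
    have h6 : covAlong Γ x (0, 1) W z₀ = covAlong Γ x (1, 0) J z₀ :=
      hL.covAlong_fderiv_comm (hx0.of_le ENat.LEInfty.out) _ _
    refine ((hasDerivAt_snd_of_differentiableAt hAd).congr_of_eventuallyEq ?_).congr_deriv ?_
    · filter_upwards [hline2.eventually hAev] with t ht using ht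
    · rw [h5, h6]
      field_simp
      ring

end FlowScalars

/-! ### Maximum principles on `[0, 1]` -/

section MaximumPrinciples

open Filter Topology

theorem second_derivative_nonpos_of_isLocalMax {f f1 : ℝ → ℝ} {f2 x : ℝ}
    (h1 : ∀ᶠ y in 𝓝 x, HasDerivAt f (f1 y) y) (h2 : HasDerivAt f1 f2 x) (hmax : IsLocalMax f x) :
    f1 x = 0 ∧ f2 ≤ 0 := by
  have h0 : f1 x = 0 := hmax.hasDerivAt_eq_zero h1.self_of_nhds
  refine ⟨h0, ?_⟩
  by_contra! hpos
  have hd : deriv f =ᶠ[𝓝 x] f1 := by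
    filter_upwards [h1] with y hy using hy.deriv
  have hdd : deriv (deriv f) x = f2 := by rw [hd.deriv_eq, h2.deriv]
  have hmin : IsLocalMin f x := isLocalMin_of_deriv_deriv_pos (by rw [hdd]; exact hpos)
    (by rw [hd.eq_of_nhds, h0]) h1.self_of_nhds.continuousAt
  have hconst : f =ᶠ[𝓝 x] fun _ => f x := by
    filter_upwards [hmin, hmax] with y h3 h4 using le_antisymm h4 h3
  have hd0 : deriv f =ᶠ[𝓝 x] fun _ => 0 := by
    filter_upwards [hconst.eventually_nhds] with y hy
    have : f =ᶠ[𝓝 y] fun _ => f x := hy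
    rw [this.deriv_eq, deriv_const]
  rw [hd0.deriv_eq, deriv_const] at hdd
  exact hpos.ne hdd

/-- First order condition at a maximum over an interval, possibly at an endpoint. -/
theorem hasDerivWithinAt_mul_sub_nonpos_of_max {f : ℝ → ℝ} {f' u v x y : ℝ}
    (h : HasDerivWithinAt f f' (Icc u v) x) (hmax : ∀ z ∈ Icc u v, f z ≤ f x)
    (hx : x ∈ Icc u v) (hy : y ∈ Icc u v) : f' * (y - x) ≤ 0 := by
  have h1 : IsLocalMaxOn f (Icc u v) x := by
    filter_upwards [self_mem_nhdsWithin] with z hz using hmax z hz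
  have h2 : y - x ∈ posTangentConeAt (Icc u v) x :=
    sub_mem_posTangentConeAt_of_segment_subset
      ((convex_Icc u v).segment_subset hx hy)
  have h3 := h1.hasFDerivWithinAt_nonpos h.hasFDerivWithinAt h2
  simpa [mul_comm] using h3

/-- Dirichlet comparison. The hypothesis says that `u = √b` satisfies `∂_τ u < α u'' + 4 α u` where
it is positive. The barrier is `√R φ(s) exp (-α (τ - T))` with `φ = 1/8 + s - s²`: since `φ'' = -2`
and `φ ≤ 3/8 < 2/5`, one has `α φ'' + 4 α φ ≤ -α φ`. The bound is stated for `b = u²` because `u`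
need not be differentiable at its zeros. -/
theorem dirichlet_decay {α R T : ℝ} {b : ℝ → ℝ → ℝ} (hα : 0 < α) (hR : 0 < R)
    (hcont : ContinuousOn (fun z : ℝ × ℝ => b z.1 z.2) (Icc 0 1 ×ˢ Ici T))
    (hb0 : ∀ τ, T < τ → b 0 τ = 0) (hb1 : ∀ τ, T < τ → b 1 τ = 0)
    (hsub : ∀ s ∈ Ioo (0 : ℝ) 1, ∀ τ, T < τ → 0 < b s τ →
      ∃ (b1 : ℝ → ℝ) (b2 bt K : ℝ),
        (∀ᶠ σ in 𝓝 s, HasDerivAt (fun σ => b σ τ) (b1 σ) σ) ∧ HasDerivAt b1 b2 s ∧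
        HasDerivAt (fun t => b s t) bt τ ∧ b1 s ^ 2 ≤ 4 * b s τ * K ∧
        bt < α * b2 + 8 * α * b s τ - 2 * α * K)
    (hinit : ∀ s ∈ Icc (0 : ℝ) 1, b s T ≤ R * (1 / 8 + s - s ^ 2) ^ 2) :
    ∀ s ∈ Icc (0 : ℝ) 1, ∀ τ, T ≤ τ →
      b s τ ≤ R * (1 / 8 + s - s ^ 2) ^ 2 * Real.exp (-2 * α * (τ - T)) := by
  intro s₁ hs₁ T₁ hT₁
  have hφ : ∀ s ∈ Icc (0 : ℝ) 1, 0 < 1 / 8 + s - s ^ 2 := fun s hs => by nlinarith [hs.1, hs.2]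
  by_contra! hcon
  have hK : IsCompact (Icc (0 : ℝ) 1 ×ˢ Icc T T₁) := isCompact_Icc.prod isCompact_Icc
  have hrc : ContinuousOn (fun z : ℝ × ℝ => b z.1 z.2 /
      ((1 / 8 + z.1 - z.1 ^ 2) ^ 2 * Real.exp (-2 * α * (z.2 - T)))) (Icc 0 1 ×ˢ Icc T T₁) := by
    refine (hcont.mono (prod_mono subset_rfl Icc_subset_Ici_self)).div (by fun_prop) ?_
    intro z hz
    exact (mul_pos (pow_pos (hφ _ hz.1) 2) (Real.exp_pos _)).ne'
  -- `Q > R` is the least multiple of the barrier lying above `b`; the two touch at `(s₀, τ₀)`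
  obtain ⟨⟨s₀, τ₀⟩, ⟨hs₀, hτ₀⟩, hmax⟩ := hK.exists_isMaxOn
    ⟨(s₁, T₁), hs₁, hT₁, le_rfl⟩ hrc
  simp only at hs₀ hτ₀
  set e : ℝ → ℝ := fun τ => Real.exp (-2 * α * (τ - T)) with he
  have hepos : ∀ τ, 0 < e τ := fun τ => Real.exp_pos _
  set Q := b s₀ τ₀ / ((1 / 8 + s₀ - s₀ ^ 2) ^ 2 * e τ₀) with hQ
  have hle : ∀ s ∈ Icc (0 : ℝ) 1, ∀ τ ∈ Icc T T₁,
      b s τ ≤ Q * ((1 / 8 + s - s ^ 2) ^ 2 * e τ) := fun s hs τ hτ => by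
    rw [← div_le_iff₀ (mul_pos (pow_pos (hφ _ hs) 2) (hepos _))]
    exact hmax (a := (s, τ)) ⟨hs, hτ⟩
  have hQR : R < Q := by
    have h1 := hle s₁ hs₁ T₁ ⟨hT₁, le_rfl⟩
    have h2 : R * ((1 / 8 + s₁ - s₁ ^ 2) ^ 2 * e T₁) < Q * ((1 / 8 + s₁ - s₁ ^ 2) ^ 2 * e T₁) := by
      rw [← mul_assoc]; exact hcon.trans_le h1
    exact lt_of_mul_lt_mul_right h2 (mul_pos (pow_pos (hφ _ hs₁) 2) (hepos _)).le
  have hQ0 : 0 < Q := hR.trans hQR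
  have hφ0 := hφ s₀ hs₀
  have heq : b s₀ τ₀ = Q * ((1 / 8 + s₀ - s₀ ^ 2) ^ 2 * e τ₀) := by
    rw [hQ, div_mul_cancel₀ _ (mul_pos (pow_pos hφ0 2) (hepos _)).ne']
  have hbpos : 0 < b s₀ τ₀ := by
    rw [heq]; exact mul_pos hQ0 (mul_pos (pow_pos hφ0 2) (hepos _))
  have hTτ : T < τ₀ := by
    refine lt_of_le_of_ne hτ₀.1 fun h => ?_
    subst h
    have h1 := hinit s₀ hs₀
    have h2 : e T = 1 := by simp [he]
    rw [heq, h2, mul_one] at h1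
    exact absurd (le_of_mul_le_mul_right h1 (pow_pos hφ0 2)) (not_le.2 hQR)
  have hs₀' : s₀ ∈ Ioo (0 : ℝ) 1 := by
    refine ⟨lt_of_le_of_ne hs₀.1 fun h => ?_, lt_of_le_of_ne hs₀.2 fun h => ?_⟩
    · rw [← h, hb0 _ hTτ] at hbpos; exact lt_irrefl _ hbpos
    · rw [h, hb1 _ hTτ] at hbpos; exact lt_irrefl _ hbpos
  obtain ⟨b1, b2, bt, K, h1, h2, ht, hK1, hlt⟩ := hsub s₀ hs₀' τ₀ hTτ hbpos
  -- the space derivatives at the maximum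
  have hφd (σ : ℝ) : HasDerivAt (fun σ : ℝ => 1 / 8 + σ - σ ^ 2) (1 - 2 * σ) σ := by
    have := ((hasDerivAt_id σ).const_add (1 / 8)).sub (hasDerivAt_pow 2 σ)
    simpa using! this
  have hmaxs : IsLocalMax (fun σ => b σ τ₀ - Q * e τ₀ * (1 / 8 + σ - σ ^ 2) ^ 2) s₀ := by
    filter_upwards [Icc_mem_nhds hs₀'.1 hs₀'.2] with σ hσ
    have := hle σ hσ τ₀ hτ₀
    have h0 : b s₀ τ₀ - Q * e τ₀ * (1 / 8 + s₀ - s₀ ^ 2) ^ 2 = 0 := by rw [heq]; ring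
    rw [h0]; linarith
  have hd1 : ∀ᶠ σ in 𝓝 s₀, HasDerivAt (fun σ => b σ τ₀ - Q * e τ₀ * (1 / 8 + σ - σ ^ 2) ^ 2)
      (b1 σ - Q * e τ₀ * (2 * (1 / 8 + σ - σ ^ 2) * (1 - 2 * σ))) σ := by
    filter_upwards [h1] with σ hσ
    have := hσ.sub (((hφd σ).pow 2).const_mul (Q * e τ₀))
    simpa using! this
  have hd2 : HasDerivAt (fun σ => b1 σ - Q * e τ₀ * (2 * (1 / 8 + σ - σ ^ 2) * (1 - 2 * σ)))
      (b2 - Q * e τ₀ * (2 * (1 - 2 * s₀) * (1 - 2 * s₀) + 2 * (1 / 8 + s₀ - s₀ ^ 2) * (-2))) s₀ := by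
    have h3 : HasDerivAt (fun σ : ℝ => 1 - 2 * σ) (-2) s₀ := by
      simpa using ((hasDerivAt_id s₀).const_mul 2).const_sub 1
    exact h2.sub ((((hφd s₀).const_mul 2).mul h3).const_mul (Q * e τ₀))
  obtain ⟨e1, e2⟩ := second_derivative_nonpos_of_isLocalMax hd1 hd2 hmaxs
  -- the time derivative at the maximum
  have htime : 0 ≤ bt + 2 * α * (Q * (1 / 8 + s₀ - s₀ ^ 2) ^ 2 * e τ₀) := by
    have hed : HasDerivAt e (e τ₀ * (-2 * α)) τ₀ := by
      refine ((((hasDerivAt_id τ₀).sub_const T).const_mul (-2 * α)).exp).congr_deriv ?_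
      simp [he]
    have h3 := (ht.sub (hed.const_mul (Q * (1 / 8 + s₀ - s₀ ^ 2) ^ 2))).hasDerivWithinAt
      (s := Icc T τ₀)
    have h4 := hasDerivWithinAt_mul_sub_nonpos_of_max h3 (fun t ht => by
      have := hle s₀ hs₀ t ⟨ht.1, ht.2.trans hτ₀.2⟩
      have h0 : b s₀ τ₀ - Q * (1 / 8 + s₀ - s₀ ^ 2) ^ 2 * e τ₀ = 0 := by rw [heq]; ring
      simp only [Pi.sub_apply]
      rw [h0]; linarith) ⟨hTτ.le, le_rfl⟩ ⟨le_rfl, hTτ.le⟩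
    have h5 : 0 < τ₀ - T := sub_pos.2 hTτ
    by_contra! h6
    nlinarith
  have hbq := heq
  set φ := 1 / 8 + s₀ - s₀ ^ 2 with hφdef
  have hQe : 0 < Q * e τ₀ := mul_pos hQ0 (hepos _)
  have hφle : φ ≤ 3 / 8 := by rw [hφdef]; nlinarith [sq_nonneg (s₀ - 1 / 2)]
  -- the hypothesis on `b1` bounds `K` below by the square of the slope of the barrier
  have hKge : Q * e τ₀ * (1 - 2 * s₀) ^ 2 ≤ K := by
    have h7 : b1 s₀ = Q * e τ₀ * (2 * φ * (1 - 2 * s₀)) := by linarith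
    rw [h7, hbq] at hK1
    have h8 : 0 < 4 * (Q * e τ₀) * φ ^ 2 := by positivity
    refine le_of_mul_le_mul_left (?_ : 4 * (Q * e τ₀) * φ ^ 2 * _ ≤ 4 * (Q * e τ₀) * φ ^ 2 * _) h8
    linarith
  rw [hbq] at hlt
  have h9 : 0 < α * (Q * e τ₀) := mul_pos hα hQe
  have h10 : α * b2 ≤ α * (Q * e τ₀ * (2 * (1 - 2 * s₀) * (1 - 2 * s₀) + 2 * φ * (-2))) :=
    mul_le_mul_of_nonneg_left (by linarith) hα.le
  have h11 : α * (Q * e τ₀ * (1 - 2 * s₀) ^ 2) ≤ α * K := mul_le_mul_of_nonneg_left hKge hα.le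
  have h12 : 0 < (α * (Q * e τ₀)) * (φ * (10 * φ - 4)) := by linarith
  have h13 : φ * (10 * φ - 4) ≤ 0 := mul_nonpos_of_nonneg_of_nonpos hφ0.le (by linarith)
  exact absurd h12 (not_lt.2 (mul_nonpos_of_nonneg_of_nonpos h9.le h13))

/-- Maximum principle for subsolutions of the heat equation with Neumann boundary conditions. -/
theorem neumann_max {α T A : ℝ} {a : ℝ → ℝ → ℝ} (hα : 0 < α)
    (hcont : ContinuousOn (fun z : ℝ × ℝ => a z.1 z.2) (Icc 0 1 ×ˢ Ici T))
    (ha0 : ∀ τ, T < τ → HasDerivWithinAt (fun σ => a σ τ) 0 (Icc 0 1) 0)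
    (ha1 : ∀ τ, T < τ → HasDerivWithinAt (fun σ => a σ τ) 0 (Icc 0 1) 1)
    (hsub : ∀ s ∈ Ioo (0 : ℝ) 1, ∀ τ, T < τ → ∃ (a1 : ℝ → ℝ) (a2 at' : ℝ),
        (∀ᶠ σ in 𝓝 s, HasDerivAt (fun σ => a σ τ) (a1 σ) σ) ∧ HasDerivAt a1 a2 s ∧
        HasDerivAt (fun t => a s t) at' τ ∧ at' ≤ α * a2)
    (hinit : ∀ s ∈ Icc (0 : ℝ) 1, a s T ≤ A) :
    ∀ s ∈ Icc (0 : ℝ) 1, ∀ τ, T ≤ τ → a s τ ≤ A := by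
  intro s₁ hs₁ T₁ hT₁
  -- it suffices to treat the strict subsolution `a + ε s (1 - s) - 3 α ε (τ - T)`
  suffices H : ∀ ε > 0, a s₁ T₁ ≤ A + ε * (1 / 4 + 3 * α * (T₁ - T)) by
    refine le_of_forall_pos_le_add fun δ hδ => ?_
    have hpos : 0 < 1 / 4 + 3 * α * (T₁ - T) := by
      have := mul_nonneg hα.le (sub_nonneg.2 hT₁); linarith
    have := H (δ / (1 / 4 + 3 * α * (T₁ - T))) (div_pos hδ hpos)
    rwa [div_mul_cancel₀ _ hpos.ne'] at this
  intro ε hε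
  have hK : IsCompact (Icc (0 : ℝ) 1 ×ˢ Icc T T₁) := isCompact_Icc.prod isCompact_Icc
  have hrc : ContinuousOn (fun z : ℝ × ℝ => a z.1 z.2 + ε * (z.1 - z.1 ^ 2)
      - 3 * α * ε * (z.2 - T)) (Icc 0 1 ×ˢ Icc T T₁) := by
    refine ((hcont.mono (prod_mono subset_rfl Icc_subset_Ici_self)).add (by fun_prop)).sub
      (by fun_prop)
  obtain ⟨⟨s₀, τ₀⟩, ⟨hs₀, hτ₀⟩, hmax⟩ := hK.exists_isMaxOn
    ⟨(s₁, T₁), hs₁, hT₁, le_rfl⟩ hrc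
  simp only at hs₀ hτ₀
  have hle : ∀ s ∈ Icc (0 : ℝ) 1, ∀ τ ∈ Icc T T₁,
      a s τ + ε * (s - s ^ 2) - 3 * α * ε * (τ - T)
        ≤ a s₀ τ₀ + ε * (s₀ - s₀ ^ 2) - 3 * α * ε * (τ₀ - T) := fun s hs τ hτ =>
    hmax (a := (s, τ)) ⟨hs, hτ⟩
  have hψd (σ : ℝ) : HasDerivAt (fun σ : ℝ => ε * (σ - σ ^ 2)) (ε * (1 - 2 * σ)) σ := by
    have := ((hasDerivAt_id σ).sub (hasDerivAt_pow 2 σ)).const_mul ε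
    simpa using! this
  rcases hτ₀.1.eq_or_lt with h | hTτ
  · subst h
    have h1 := hle s₁ hs₁ T₁ ⟨hT₁, le_rfl⟩
    have h2 := hinit s₀ hs₀
    have h3 : ε * (s₀ - s₀ ^ 2) ≤ ε * (1 / 4) :=
      mul_le_mul_of_nonneg_left (by nlinarith [sq_nonneg (s₀ - 1 / 2)]) hε.le
    have h4 : 0 ≤ ε * (s₁ - s₁ ^ 2) := mul_nonneg hε.le (by nlinarith [hs₁.1, hs₁.2])
    linarith
  · exfalso
    have hspace : ∀ s ∈ Icc (0 : ℝ) 1,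
        a s τ₀ + ε * (s - s ^ 2) ≤ a s₀ τ₀ + ε * (s₀ - s₀ ^ 2) := fun s hs => by
      linarith [hle s hs τ₀ hτ₀]
    -- a maximum at an endpoint is excluded: there `ε s (1 - s)` strictly increases into the interval
    rcases hs₀.1.eq_or_lt with h | h0
    · subst h
      have h1 := hasDerivWithinAt_mul_sub_nonpos_of_max
        ((ha0 τ₀ hTτ).add (hψd 0).hasDerivWithinAt) hspace ⟨le_rfl, zero_le_one⟩
        (⟨zero_le_one, le_rfl⟩ : (1 : ℝ) ∈ Icc (0 : ℝ) 1)
      linarith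
    rcases hs₀.2.eq_or_lt with h | h1
    · subst h
      have h1 := hasDerivWithinAt_mul_sub_nonpos_of_max
        ((ha1 τ₀ hTτ).add (hψd 1).hasDerivWithinAt) hspace ⟨zero_le_one, le_rfl⟩
        (⟨le_rfl, zero_le_one⟩ : (0 : ℝ) ∈ Icc (0 : ℝ) 1)
      linarith
    obtain ⟨a1, a2, at', d1, d2, dt, hlt⟩ := hsub s₀ ⟨h0, h1⟩ τ₀ hTτ
    have hmaxs : IsLocalMax (fun σ => a σ τ₀ + ε * (σ - σ ^ 2)) s₀ := by
      filter_upwards [Icc_mem_nhds h0 h1] with σ hσ using hspace σ hσ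
    have hd1 : ∀ᶠ σ in 𝓝 s₀, HasDerivAt (fun σ => a σ τ₀ + ε * (σ - σ ^ 2))
        (a1 σ + ε * (1 - 2 * σ)) σ := by
      filter_upwards [d1] with σ hσ using hσ.add (hψd σ)
    have hd2 : HasDerivAt (fun σ => a1 σ + ε * (1 - 2 * σ)) (a2 + ε * (-2)) s₀ := by
      have h3 : HasDerivAt (fun σ : ℝ => 1 - 2 * σ) (-2) s₀ := by
        simpa using ((hasDerivAt_id s₀).const_mul 2).const_sub 1
      exact d2.add (h3.const_mul ε)
    obtain ⟨-, e2⟩ := second_derivative_nonpos_of_isLocalMax hd1 hd2 hmaxs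
    have h3 : HasDerivAt (fun t => a s₀ t - 3 * α * ε * (t - T)) (at' - 3 * α * ε) τ₀ := by
      simpa using! dt.sub (((hasDerivAt_id τ₀).sub_const T).const_mul (3 * α * ε))
    have h4 := hasDerivWithinAt_mul_sub_nonpos_of_max (h3.hasDerivWithinAt (s := Icc T τ₀))
      (fun t ht => by linarith [hle s₀ hs₀ t ⟨ht.1, ht.2.trans hτ₀.2⟩])
      ⟨hTτ.le, le_rfl⟩ ⟨le_rfl, hTτ.le⟩
    have h5 : 0 < τ₀ - T := sub_pos.2 hTτ
    have h6 : 3 * α * ε ≤ at' := by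
      by_contra! h6
      nlinarith
    have h7 : α * a2 ≤ α * (2 * ε) := mul_le_mul_of_nonneg_left (by linarith) hα.le
    have h8 : 0 < α * ε := mul_pos hα hε
    linarith

end MaximumPrinciples

/-! ### Decay of the flow velocity and convergence of the speed -/

section FlowEstimates

open Filter Topology

variable {n : ℕ} {M : Type*} [TopologicalSpace M] [ChartedSpace (EuclideanSpace ℝ (Fin n)) M]
  [IsManifold (𝓡 n) ∞ M] [RiemannianBundle (fun x : M => TangentSpace (𝓡 n) x)]
  [IsContMDiffRiemannianBundle (𝓡 n) ∞ (EuclideanSpace ℝ (Fin n))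
      (fun x : M => TangentSpace (𝓡 n) x)]

variable {α : ℝ} {p q : M} {c : ℝ → ℝ → M} {s τ : ℝ}

/-- Exponential decay of the flow velocity. Time starts at `1` because `∂_τ c` need not be bounded as
`τ → 0`. -/
theorem IsHeatFlow.exists_flowSq_le (hc : IsHeatFlow n α p q c) (hα : 0 < α)
    (hR : CurvatureBound n c) :
    ∃ B : ℝ, 0 < B ∧ ∀ s ∈ Icc (0 : ℝ) 1, ∀ τ, 1 ≤ τ →
      flowSq n c s τ ≤ (B * Real.exp (-α * τ)) ^ 2 := by
  have hcont : ContinuousOn (fun z : ℝ × ℝ => flowSq n c z.1 z.2) (Icc 0 1 ×ˢ Ici 1) :=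
    hc.continuousOn_flowSq.mono (prod_mono subset_rfl fun t ht =>
      mem_Ioi.2 (one_pos.trans_le (mem_Ici.1 ht)))
  have hslice : ContinuousOn (fun s => flowSq n c s 1) (Icc 0 1) :=
    hcont.comp (f := fun s : ℝ => (s, (1 : ℝ))) (by fun_prop)
      fun s hs => ⟨hs, mem_Ici.2 le_rfl⟩
  obtain ⟨N, hN⟩ := isCompact_Icc.exists_bound_of_continuousOn hslice
  have hN0 : 0 ≤ N := (norm_nonneg _).trans (hN 0 ⟨le_rfl, zero_le_one⟩)
  -- `φ ≥ 1 / 8` makes the barrier with `R ≥ 64 N` lie above the initial values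
  set R := 64 * N + 1 with hRdef
  have hR0 : 0 < R := by positivity
  have hdecay := dirichlet_decay hα hR0 hcont
    (fun τ hτ => flowSq_eq_zero_of_const hc.left_endpoint (one_pos.trans hτ))
    (fun τ hτ => flowSq_eq_zero_of_const hc.right_endpoint (one_pos.trans hτ))
    (fun s hs τ hτ hb => hc.flowSq_subsolution hα hR hs (one_pos.trans hτ) hb)
    (fun s hs => by
      have h1 := (Real.le_norm_self _).trans (hN s hs)
      have h2 : (1 / 8 : ℝ) ≤ 1 / 8 + s - s ^ 2 := by nlinarith [hs.1, hs.2]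
      have h3 : (1 / 64 : ℝ) ≤ (1 / 8 + s - s ^ 2) ^ 2 := by nlinarith
      nlinarith)
  refine ⟨Real.sqrt R * Real.exp α, by positivity, fun s hs τ hτ => ?_⟩
  refine (hdecay s hs τ hτ).trans ?_
  have h2 : 1 / 8 + s - s ^ 2 ≤ 1 := by nlinarith [hs.1, hs.2, sq_nonneg (s - 1 / 2)]
  have h2' : 0 ≤ 1 / 8 + s - s ^ 2 := by nlinarith [hs.1, hs.2]
  have h3 : (1 / 8 + s - s ^ 2) ^ 2 ≤ 1 := pow_le_one₀ h2' h2
  have h4 : (Real.sqrt R * Real.exp α * Real.exp (-α * τ)) ^ 2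
      = R * Real.exp (-2 * α * (τ - 1)) := by
    rw [mul_assoc, ← Real.exp_add, mul_pow, Real.sq_sqrt hR0.le, ← Real.exp_nat_mul]
    congr 2
    push_cast
    ring
  rw [h4]
  refine mul_le_mul_of_nonneg_right ?_ (Real.exp_pos _).le
  nlinarith

/-- The Neumann boundary condition for the squared speed, at an endpoint kept fixed by the flow. -/
theorem IsHeatFlow.hasDerivWithinAt_speedSq_endpoint (hc : IsHeatFlow n α p q c) (hα : 0 < α)
    (hs : s ∈ Icc (0 : ℝ) 1) {x : M} (hx : ∀ t, 0 ≤ t → c s t = x) (hτ : 0 < τ) :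
    HasDerivWithinAt (fun σ => speedSq n c σ τ) 0 (Icc 0 1) s := by
  have h := hc.hasDerivWithinAt_speedSq hα hs hτ
  have h0 : timeDeriv (n := n) c s τ = 0 :=
    inner_self_eq_zero.1 (flowSq_eq_zero_of_const (n := n) hx hτ)
  rwa [h0, inner_zero_right, mul_zero] at h

/-- The speed of the evolving curves never exceeds its maximum at earlier times. -/
theorem IsHeatFlow.speedSq_le_of_le (hc : IsHeatFlow n α p q c) (hα : 0 < α) {T A : ℝ}
    (hT : 0 ≤ T) (hA : ∀ s ∈ Icc (0 : ℝ) 1, speedSq n c s T ≤ A) (hs : s ∈ Icc (0 : ℝ) 1)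
    (hτ : T ≤ τ) : speedSq n c s τ ≤ A := by
  refine neumann_max (α := α) (T := T) hα
    (hc.continuousOn_speedSq.mono (prod_mono subset_rfl fun t ht => hT.trans ht))
    (fun τ hτ => hc.hasDerivWithinAt_speedSq_endpoint hα ⟨le_rfl, zero_le_one⟩ hc.left_endpoint
      (hT.trans_lt hτ))
    (fun τ hτ => hc.hasDerivWithinAt_speedSq_endpoint hα ⟨zero_le_one, le_rfl⟩ hc.right_endpoint
      (hT.trans_lt hτ)) ?_ hA s hs τ hτ
  intro s hs τ hτ
  obtain ⟨a1, a2, h1, h2, h3⟩ := hc.speedSq_equation hα hs (hT.trans_lt hτ)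
  refine ⟨a1, a2, _, h1, h2, h3, ?_⟩
  have : 0 ≤ 2 * α⁻¹ * flowSq n c s τ := mul_nonneg (by positivity) real_inner_self_nonneg
  linarith

theorem IsHeatFlow.exists_speedSq_le (hc : IsHeatFlow n α p q c) (hα : 0 < α) :
    ∃ A : ℝ, 0 < A ∧ ∀ s ∈ Icc (0 : ℝ) 1, ∀ τ, 0 ≤ τ → speedSq n c s τ ≤ A ^ 2 := by
  have hslice : ContinuousOn (fun s => speedSq n c s 0) (Icc 0 1) :=
    hc.continuousOn_speedSq.comp (f := fun s : ℝ => (s, (0 : ℝ))) (by fun_prop)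
      fun s hs => ⟨hs, mem_Ici.2 le_rfl⟩
  obtain ⟨N, hN⟩ := isCompact_Icc.exists_bound_of_continuousOn hslice
  have hN0 : 0 ≤ N := (norm_nonneg _).trans (hN 0 ⟨le_rfl, zero_le_one⟩)
  refine ⟨N + 1, by positivity, fun s hs τ hτ => hc.speedSq_le_of_le hα le_rfl ?_ hs hτ⟩
  intro s hs
  have := (Real.le_norm_self _).trans (hN s hs)
  nlinarith

/-- The oscillation of the squared speed in `s` is small because
`∂_s |∂_s c|² = 2 α⁻¹ ⟨∂_s c, ∂_τ c⟩`. -/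
theorem IsHeatFlow.abs_speedSq_sub_le (hc : IsHeatFlow n α p q c) (hα : 0 < α) {A B : ℝ}
    (hA0 : 0 ≤ A) (hB0 : 0 ≤ B) (hA : ∀ s ∈ Icc (0 : ℝ) 1, ∀ τ, 0 ≤ τ → speedSq n c s τ ≤ A ^ 2)
    (hB : ∀ s ∈ Icc (0 : ℝ) 1, ∀ τ, 1 ≤ τ → flowSq n c s τ ≤ (B * Real.exp (-α * τ)) ^ 2)
    {s s' : ℝ} (hs : s ∈ Icc (0 : ℝ) 1) (hs' : s' ∈ Icc (0 : ℝ) 1) (hτ : 1 ≤ τ) :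
    |speedSq n c s τ - speedSq n c s' τ| ≤ 2 * α⁻¹ * A * B * Real.exp (-α * τ) := by
  have hτ0 : 0 < τ := one_pos.trans_le hτ
  have hbound : ∀ σ ∈ Icc (0 : ℝ) 1, ‖2 * α⁻¹ *
      inner ℝ (spaceDeriv (n := n) c σ τ) (timeDeriv (n := n) c σ τ)‖
        ≤ 2 * α⁻¹ * A * B * Real.exp (-α * τ) := by
    intro σ hσ
    have h1 : (inner ℝ (spaceDeriv (n := n) c σ τ) (timeDeriv (n := n) c σ τ)) ^ 2
        ≤ (A * (B * Real.exp (-α * τ))) ^ 2 := by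
      rw [mul_pow, sq]
      refine (real_inner_mul_inner_self_le _ _).trans ?_
      exact mul_le_mul (hA σ hσ τ hτ0.le) (hB σ hσ τ hτ) real_inner_self_nonneg (sq_nonneg _)
    have h2 := abs_le_of_sq_le_sq h1 (by positivity)
    rw [norm_mul, Real.norm_of_nonneg (by positivity), Real.norm_eq_abs]
    calc _ ≤ 2 * α⁻¹ * (A * (B * Real.exp (-α * τ))) :=
          mul_le_mul_of_nonneg_left h2 (by positivity)
      _ = _ := by ring
  have h := (convex_Icc (0 : ℝ) 1).norm_image_sub_le_of_norm_hasDerivWithin_le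
    (fun σ hσ => hc.hasDerivWithinAt_speedSq hα hσ hτ0) hbound hs' hs
  rw [Real.norm_eq_abs, Real.norm_eq_abs] at h
  refine h.trans (mul_le_of_le_one_right (by positivity) ?_)
  rw [abs_le]
  constructor <;> linarith [hs.1, hs.2, hs'.1, hs'.2]

/-- The squared speed converges exponentially fast as `τ → ∞`: both its maximum and, up to an
exponentially small correction, its minimum are monotone in time, and its oscillation is small. -/
theorem IsHeatFlow.exists_abs_speedSq_sub_le (hc : IsHeatFlow n α p q c) (hα : 0 < α) {A B : ℝ}
    (hA0 : 0 ≤ A) (hB0 : 0 ≤ B) (hA : ∀ s ∈ Icc (0 : ℝ) 1, ∀ τ, 0 ≤ τ → speedSq n c s τ ≤ A ^ 2)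
    (hB : ∀ s ∈ Icc (0 : ℝ) 1, ∀ τ, 1 ≤ τ → flowSq n c s τ ≤ (B * Real.exp (-α * τ)) ^ 2) :
    ∃ C : ℝ, 0 ≤ C ∧ ∀ s ∈ Icc (0 : ℝ) 1, ∀ τ τ', 1 ≤ τ → τ ≤ τ' →
      |speedSq n c s τ' - speedSq n c s τ| ≤ C * Real.exp (-α * τ) := by
  set L := 2 * α⁻¹ * A * B with hL
  set D := B ^ 2 * (α⁻¹) ^ 2 with hD
  have hL0 : 0 ≤ L := by positivity
  have hD0 : 0 ≤ D := by positivity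
  refine ⟨L + D, by positivity, fun s hs τ τ' hτ hττ' => ?_⟩
  have hτ0 : 0 < τ := one_pos.trans_le hτ
  have hosc (σ : ℝ) (hσ : σ ∈ Icc (0 : ℝ) 1) :=
    abs_le.1 (hc.abs_speedSq_sub_le hα hA0 hB0 hA hB hσ hs hτ)
  have hexp : Real.exp (-2 * α * τ) ≤ Real.exp (-α * τ) := by
    rw [Real.exp_le_exp]
    nlinarith [mul_pos hα hτ0]
  have hup : speedSq n c s τ' ≤ speedSq n c s τ + L * Real.exp (-α * τ) :=
    hc.speedSq_le_of_le hα hτ0.le (fun σ hσ => by linarith [(hosc σ hσ).2]) hs hττ'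
  -- `-|∂_s c|²` becomes a subsolution after adding a multiple of `exp (-2 α τ)`
  have hlow : -speedSq n c s τ' + D * Real.exp (-2 * α * τ')
      ≤ -speedSq n c s τ + L * Real.exp (-α * τ) + D * Real.exp (-2 * α * τ) := by
    refine neumann_max (α := α) (T := τ)
      (a := fun s t => -speedSq n c s t + D * Real.exp (-2 * α * t)) hα ?_ ?_ ?_ ?_ ?_ s hs τ' hττ'
    · exact ((hc.continuousOn_speedSq.mono
        (prod_mono subset_rfl fun t ht => hτ0.le.trans ht)).neg).add (by fun_prop)
    · intro t ht
      simpa using! (hc.hasDerivWithinAt_speedSq_endpoint hα ⟨le_rfl, zero_le_one⟩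
        hc.left_endpoint (hτ0.trans ht)).neg.add_const (D * Real.exp (-2 * α * t))
    · intro t ht
      simpa using! (hc.hasDerivWithinAt_speedSq_endpoint hα ⟨zero_le_one, le_rfl⟩
        hc.right_endpoint (hτ0.trans ht)).neg.add_const (D * Real.exp (-2 * α * t))
    · intro σ hσ t ht
      obtain ⟨a1, a2, h1, h2, h3⟩ := hc.speedSq_equation hα hσ (hτ0.trans ht)
      have hexpd : HasDerivAt (fun t => D * Real.exp (-2 * α * t))
          (D * (Real.exp (-2 * α * t) * (-2 * α))) t := by
        have := (((hasDerivAt_id t).const_mul (-2 * α)).exp).const_mul D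
        refine this.congr_deriv ?_
        simp
      refine ⟨fun σ => -a1 σ, -a2, _, ?_, h2.neg, h3.neg.add hexpd, ?_⟩
      · filter_upwards [h1] with r hr using hr.neg.add_const _
      · have h4 := hB σ (Ioo_subset_Icc_self hσ) t (hτ.trans ht.le)
        have h5 : (B * Real.exp (-α * t)) ^ 2 = B ^ 2 * Real.exp (-2 * α * t) := by
          rw [mul_pow, ← Real.exp_nat_mul]
          congr 2
          push_cast; ring
        rw [h5] at h4
        have h6 : 2 * α⁻¹ * flowSq n c σ t ≤ 2 * α⁻¹ * (B ^ 2 * Real.exp (-2 * α * t)) :=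
          mul_le_mul_of_nonneg_left h4 (by positivity)
        have h7 : D * (Real.exp (-2 * α * t) * (-2 * α))
            = -(2 * α⁻¹ * (B ^ 2 * Real.exp (-2 * α * t))) := by
          rw [hD]; field_simp
        linarith
    · intro σ hσ
      linarith [(hosc σ hσ).1]
  have h1 : D * Real.exp (-2 * α * τ) ≤ D * Real.exp (-α * τ) :=
    mul_le_mul_of_nonneg_left hexp hD0
  have h2 : 0 ≤ D * Real.exp (-2 * α * τ') := mul_nonneg hD0 (Real.exp_pos _).le
  have h3 : 0 ≤ D * Real.exp (-α * τ) := mul_nonneg hD0 (Real.exp_pos _).le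
  rw [abs_le]
  constructor <;> linarith

end FlowEstimates

/-! ### Distance estimates and the limit curve -/

section Distances

open Filter Topology Manifold

variable {n : ℕ} {M : Type*} [EMetricSpace M] [ChartedSpace (EuclideanSpace ℝ (Fin n)) M]
  [IsManifold (𝓡 n) ∞ M] [RiemannianBundle (fun x : M => TangentSpace (𝓡 n) x)]
  [IsContMDiffRiemannianBundle (𝓡 n) ∞ (EuclideanSpace ℝ (Fin n))
      (fun x : M => TangentSpace (𝓡 n) x)]
  [IsRiemannianManifold (𝓡 n) M]

variable {α : ℝ} {p q : M} {c : ℝ → ℝ → M} {s τ : ℝ}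

theorem enorm_le_ofReal_of_inner_self_le {x : M} {v : TangentSpace (𝓡 n) x} {b : ℝ} (hb : 0 ≤ b)
    (h : inner ℝ v v ≤ b ^ 2) : ‖v‖ₑ ≤ ENNReal.ofReal b := by
  rw [← ofReal_norm]
  refine ENNReal.ofReal_le_ofReal ?_
  rw [real_inner_self_eq_norm_sq] at h
  exact (pow_le_pow_iff_left₀ (norm_nonneg _) hb two_ne_zero).1 h

/-- The path `t ↦ c s t` on `[τ, τ']` has length at most `∫ B exp (-α t) dt`. -/
theorem IsHeatFlow.edist_time_le (hc : IsHeatFlow n α p q c) (hα : 0 < α) {B : ℝ} (hB0 : 0 ≤ B)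
    (hB : ∀ s ∈ Icc (0 : ℝ) 1, ∀ τ, 1 ≤ τ → flowSq n c s τ ≤ (B * Real.exp (-α * τ)) ^ 2)
    (hs : s ∈ Icc (0 : ℝ) 1) {τ' : ℝ} (hτ : 1 ≤ τ) (hτ' : τ ≤ τ') :
    edist (c s τ) (c s τ') ≤ ENNReal.ofReal (B * α⁻¹ * Real.exp (-α * τ)) := by
  have hsm : ContMDiffOn 𝓘(ℝ, ℝ) (𝓡 n) 1 (fun t => c s t) (Icc τ τ') :=
    ((hc.contMDiffOn_time hs).mono fun t ht =>
      mem_Ioi.2 (one_pos.trans_le (hτ.trans ht.1))).of_le (by simp)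
  rw [IsRiemannianManifold.out (I := 𝓡 n) (c s τ) (c s τ')]
  refine (riemannianEDist_le_pathELength hsm rfl rfl hτ').trans ?_
  rw [pathELength_eq_lintegral_mfderiv_Icc]
  have h1 : ∫⁻ t in Icc τ τ', ‖mfderiv 𝓘(ℝ, ℝ) (𝓡 n) (fun t => c s t) t 1‖ₑ
      ≤ ∫⁻ t in Icc τ τ', ENNReal.ofReal (B * Real.exp (-α * t)) := by
    refine setLIntegral_mono' measurableSet_Icc fun t ht => ?_
    exact enorm_le_ofReal_of_inner_self_le (v := timeDeriv (n := n) c s t)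
      (by positivity) (hB s hs t (hτ.trans ht.1))
  refine h1.trans ?_
  have hint : IntegrableOn (fun t => B * Real.exp (-α * t)) (Icc τ τ') :=
    (Continuous.continuousOn (by fun_prop)).integrableOn_Icc
  rw [← ofReal_integral_eq_lintegral_ofReal hint
    (Eventually.of_forall fun t => by positivity)]
  refine ENNReal.ofReal_le_ofReal ?_
  rw [integral_Icc_eq_integral_Ioc, ← intervalIntegral.integral_of_le hτ']
  have hd (t : ℝ) : HasDerivAt (fun t => -(B * α⁻¹ * Real.exp (-α * t)))
      (B * Real.exp (-α * t)) t := by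
    have := ((((hasDerivAt_id t).const_mul (-α)).exp).const_mul (B * α⁻¹)).neg
    refine this.congr_deriv ?_
    simp only [id, mul_one]
    field_simp
  rw [intervalIntegral.integral_eq_sub_of_hasDerivAt (fun t _ => hd t)
    (Continuous.intervalIntegrable (by fun_prop) _ _)]
  have : 0 ≤ B * α⁻¹ * Real.exp (-α * τ') := by positivity
  linarith

theorem IsHeatFlow.edist_space_le (hc : IsHeatFlow n α p q c) {A : ℝ} (hA0 : 0 ≤ A)
    (hA : ∀ s ∈ Icc (0 : ℝ) 1, ∀ τ, 0 ≤ τ → speedSq n c s τ ≤ A ^ 2)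
    (hs : s ∈ Icc (0 : ℝ) 1) {s' : ℝ} (hs' : s' ∈ Icc (0 : ℝ) 1) (hτ : 0 < τ) :
    edist (c s τ) (c s' τ) ≤ ENNReal.ofReal (A * |s - s'|) := by
  wlog hss : s ≤ s' generalizing s s'
  · rw [edist_comm, abs_sub_comm]
    exact this hs' hs (le_of_not_ge hss)
  have hsm : ContMDiffOn 𝓘(ℝ, ℝ) (𝓡 n) 1 (fun σ => c σ τ) (Icc s s') :=
    ((hc.contMDiffOn_space hτ).mono (Icc_subset_Icc hs.1 hs'.2)).of_le (by simp)
  rw [IsRiemannianManifold.out (I := 𝓡 n) (c s τ) (c s' τ)]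
  refine (riemannianEDist_le_pathELength hsm rfl rfl hss).trans ?_
  rw [pathELength_eq_lintegral_mfderiv_Ioo]
  have h1 : ∫⁻ σ in Ioo s s', ‖mfderiv 𝓘(ℝ, ℝ) (𝓡 n) (fun σ => c σ τ) σ 1‖ₑ
      ≤ ∫⁻ _ in Ioo s s', ENNReal.ofReal A := by
    refine setLIntegral_mono' measurableSet_Ioo fun σ hσ => ?_
    have hσ1 : 0 < σ := hs.1.trans_lt hσ.1
    have hσ2 : σ < 1 := hσ.2.trans_le hs'.2
    rw [← mfderivWithin_of_mem_nhds (Icc_mem_nhds hσ1 hσ2)]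
    exact enorm_le_ofReal_of_inner_self_le (v := spaceDeriv (n := n) c σ τ) hA0
      (hA σ ⟨hσ1.le, hσ2.le⟩ τ hτ.le)
  refine h1.trans ?_
  rw [setLIntegral_const, Real.volume_Ioo, ← ENNReal.ofReal_mul hA0, abs_sub_comm,
    abs_of_nonneg (sub_nonneg.2 hss)]

/-- The curves `c(·, τ)` converge uniformly and exponentially fast. -/
theorem IsHeatFlow.exists_limit [CompleteSpace M] (hc : IsHeatFlow n α p q c) (hα : 0 < α)
    {B : ℝ} (hB0 : 0 ≤ B)
    (hB : ∀ s ∈ Icc (0 : ℝ) 1, ∀ τ, 1 ≤ τ → flowSq n c s τ ≤ (B * Real.exp (-α * τ)) ^ 2) :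
    ∃ γ : ℝ → M, (∀ s ∈ Icc (0 : ℝ) 1, Tendsto (fun τ => c s τ) atTop (𝓝 (γ s))) ∧
      ∀ s ∈ Icc (0 : ℝ) 1, ∀ τ, 1 ≤ τ →
        edist (c s τ) (γ s) ≤ ENNReal.ofReal (B * α⁻¹ * Real.exp (-α * τ)) := by
  have hlim : Tendsto (fun τ => ENNReal.ofReal (B * α⁻¹ * Real.exp (-α * τ))) atTop (𝓝 0) := by
    have h1 : Tendsto (fun τ : ℝ => Real.exp (-α * τ)) atTop (𝓝 0) :=
      Real.tendsto_exp_atBot.comp (tendsto_id.const_mul_atTop_of_neg (neg_lt_zero.2 hα))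
    have h2 := (h1.const_mul (B * α⁻¹))
    rw [mul_zero] at h2
    simpa using ENNReal.tendsto_ofReal h2
  have hex : ∀ s ∈ Icc (0 : ℝ) 1, ∃ x, Tendsto (fun τ => c s τ) atTop (𝓝 x) := by
    intro s hs
    refine CompleteSpace.complete (f := map (fun τ => c s τ) atTop) ?_ |>.imp fun x hx => hx
    rw [EMetric.cauchy_iff]
    refine ⟨(inferInstance : (map (fun τ => c s τ) atTop).NeBot).ne, fun ε hε => ?_⟩
    obtain ⟨T, hT⟩ := ((hlim.eventually_lt_const hε).and (eventually_ge_atTop 1)).exists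
    refine ⟨(fun τ => c s τ) '' Ici T, image_mem_map (Ici_mem_atTop T), ?_⟩
    have key (t t' : ℝ) (ht : T ≤ t) (htt : t ≤ t') : edist (c s t) (c s t') < ε := by
      refine (hc.edist_time_le hα hB0 hB hs (hT.2.trans ht) htt).trans_lt ?_
      refine lt_of_le_of_lt (ENNReal.ofReal_le_ofReal ?_) hT.1
      refine mul_le_mul_of_nonneg_left (Real.exp_le_exp.2 ?_) (by positivity)
      nlinarith
    rintro _ ⟨t, ht, rfl⟩ _ ⟨t', ht', rfl⟩
    rcases le_total t t' with h | h
    · exact key t t' ht h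
    · rw [edist_comm]; exact key t' t ht' h
  have : Nonempty M := ⟨p⟩
  choose! γ hγ using hex
  refine ⟨γ, hγ, fun s hs τ hτ => ?_⟩
  have h1 : Tendsto (fun τ' => edist (c s τ) (c s τ')) atTop (𝓝 (edist (c s τ) (γ s))) :=
    tendsto_const_nhds.edist (hγ s hs)
  refine le_of_tendsto h1 ?_
  filter_upwards [eventually_ge_atTop τ] with τ' hτ' using hc.edist_time_le hα hB0 hB hs hτ hτ'

end Distances

/-! ### Limits of approximate solutions of second order equations -/

section LimitOfCurves

open Filter Topology

variable {E : Type*} [NormedAddCommGroup E] [NormedSpace ℝ E]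

/-- Mean value inequality for `z ↦ f z - z • e`. -/
theorem norm_image_sub_sub_smul_le {f f' : ℝ → E} {u v x y C : ℝ} {e : E}
    (hf : ∀ z ∈ Icc u v, HasDerivWithinAt f (f' z) (Icc u v) z)
    (hx : x ∈ Icc u v) (hy : y ∈ Icc u v)
    (hC : ∀ z ∈ Icc u v, |z - x| ≤ |y - x| → ‖f' z - e‖ ≤ C) :
    ‖f y - f x - (y - x) • e‖ ≤ C * |y - x| := by
  have hsub : uIcc x y ⊆ Icc u v := (convex_Icc u v).ordConnected.uIcc_subset hx hy
  have hg : ∀ z ∈ uIcc x y, HasDerivWithinAt (fun z => f z - z • e) (f' z - e) (uIcc x y) z := by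
    intro z hz
    have h1 := (hf z (hsub hz)).mono hsub
    have h2 : HasDerivWithinAt (fun z : ℝ => z • e) e (uIcc x y) z := by
      simpa using (hasDerivWithinAt_id z (uIcc x y)).smul_const e
    exact h1.sub h2
  have h := (convex_uIcc x y).norm_image_sub_le_of_norm_hasDerivWithin_le hg
    (fun z hz => hC z (hsub hz) (abs_sub_left_of_mem_uIcc hz)) left_mem_uIcc right_mem_uIcc
  rw [Real.norm_eq_abs] at h
  convert h using 2
  rw [sub_smul]; abel

variable {u v : ℝ} {x w w' : ℝ → ℝ → E} {ξ : ℝ → E} {W K : ℝ} {F : E → E → E}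

/-- If curves with uniformly bounded second derivative converge pointwise, so do their velocities:
up to `K h` the velocity is a difference quotient of step `h`. -/
theorem exists_tendsto_velocity [CompleteSpace E] (huv : u < v) (hK : 0 ≤ K)
    (hx : ∀ᶠ τ in atTop, ∀ σ ∈ Icc u v, HasDerivWithinAt (x τ) (w τ σ) (Icc u v) σ)
    (hw : ∀ᶠ τ in atTop, ∀ σ ∈ Icc u v, HasDerivWithinAt (w τ) (w' τ σ) (Icc u v) σ)
    (hw' : ∀ᶠ τ in atTop, ∀ σ ∈ Icc u v, ‖w' τ σ‖ ≤ K)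
    (hlim : ∀ σ ∈ Icc u v, Tendsto (fun τ => x τ σ) atTop (𝓝 (ξ σ))) {σ : ℝ}
    (hσ : σ ∈ Icc u v) :
    ∃ η, Tendsto (fun τ => w τ σ) atTop (𝓝 η) ∧
      ∀ y ∈ Icc u v, ‖ξ y - ξ σ - (y - σ) • η‖ ≤ K * |y - σ| * |y - σ| := by
  have htaylor : ∀ᶠ τ in atTop, ∀ y ∈ Icc u v,
      ‖x τ y - x τ σ - (y - σ) • w τ σ‖ ≤ K * |y - σ| * |y - σ| := by
    filter_upwards [hx, hw, hw'] with τ h1 h2 h3 y hy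
    refine norm_image_sub_sub_smul_le h1 hσ hy fun z hz hzy => ?_
    have h4 := (convex_Icc u v).norm_image_sub_le_of_norm_hasDerivWithin_le h2 h3 hσ hz
    refine h4.trans (mul_le_mul_of_nonneg_left ?_ hK)
    rwa [Real.norm_eq_abs]
  have hcauchy : ∃ η, Tendsto (fun τ => w τ σ) atTop (𝓝 η) := by
    refine CompleteSpace.complete (f := map (fun τ => w τ σ) atTop) ?_ |>.imp fun _ h => h
    rw [Metric.cauchy_iff]
    refine ⟨(inferInstance : (map (fun τ => w τ σ) atTop).NeBot), fun ε hε => ?_⟩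
    -- a step `h` for which the error `K h` is small and which stays in the interval on one side
    obtain ⟨h, hh, hhuv, hKh⟩ : ∃ h : ℝ, 0 < h ∧ h ≤ (v - u) / 2 ∧ K * h ≤ ε / 8 := by
      refine ⟨min ((v - u) / 2) (ε / (8 * (K + 1))), ?_, min_le_left _ _, ?_⟩
      · exact lt_min (by linarith) (by positivity)
      · calc K * min ((v - u) / 2) (ε / (8 * (K + 1))) ≤ K * (ε / (8 * (K + 1))) :=
            mul_le_mul_of_nonneg_left (min_le_right _ _) hK
          _ = (K / (K + 1)) * (ε / 8) := by field_simp
          _ ≤ 1 * (ε / 8) := by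
            refine mul_le_mul_of_nonneg_right ?_ (by positivity)
            rw [div_le_one (by positivity)]; linarith
          _ = ε / 8 := one_mul _
    obtain ⟨y, hy, hyσ⟩ : ∃ y ∈ Icc u v, |y - σ| = h := by
      rcases le_total σ ((u + v) / 2) with h1 | h1
      · exact ⟨σ + h, ⟨by linarith [hσ.1], by linarith⟩, by simp [abs_of_pos hh]⟩
      · exact ⟨σ - h, ⟨by linarith, by linarith [hσ.2]⟩, by simp [abs_of_pos hh]⟩
    have hD : Tendsto (fun τ => x τ y - x τ σ) atTop (𝓝 (ξ y - ξ σ)) :=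
      (hlim y hy).sub (hlim σ hσ)
    have hDε := hD.eventually (Metric.ball_mem_nhds (ξ y - ξ σ) (by positivity : 0 < h * (ε / 8)))
    obtain ⟨T, hT⟩ := eventually_atTop.1 (htaylor.and hDε)
    have key : ∀ t, T ≤ t → ‖(y - σ) • w t σ - (ξ y - ξ σ)‖ ≤ h * (ε / 4) := by
      intro t ht
      have h1 := (hT t ht).1 y hy
      have h2 : ‖x t y - x t σ - (ξ y - ξ σ)‖ < h * (ε / 8) := by
        have := (hT t ht).2
        rwa [dist_eq_norm] at this
      rw [hyσ] at h1
      have h3 : (y - σ) • w t σ - (ξ y - ξ σ)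
          = (x t y - x t σ - (ξ y - ξ σ)) - (x t y - x t σ - (y - σ) • w t σ) := by abel
      rw [h3]
      refine (norm_sub_le _ _).trans ?_
      have h4 : K * h * h ≤ ε / 8 * h := mul_le_mul_of_nonneg_right hKh hh.le
      linarith
    refine ⟨(fun τ => w τ σ) '' Ici T, image_mem_map (Ici_mem_atTop T), ?_⟩
    rintro _ ⟨t, ht, rfl⟩ _ ⟨t', ht', rfl⟩
    have h5 : ‖(y - σ) • (w t σ - w t' σ)‖ ≤ h * (ε / 2) := by
      have : (y - σ) • (w t σ - w t' σ) = ((y - σ) • w t σ - (ξ y - ξ σ))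
          - ((y - σ) • w t' σ - (ξ y - ξ σ)) := by rw [smul_sub]; abel
      rw [this]
      refine (norm_sub_le _ _).trans ?_
      linarith [key t ht, key t' ht']
    rw [norm_smul, Real.norm_eq_abs, hyσ] at h5
    have h6 := le_of_mul_le_mul_left h5 hh
    change dist (w t σ) (w t' σ) < ε
    rw [dist_eq_norm]
    linarith
  obtain ⟨η, hη⟩ := hcauchy
  refine ⟨η, hη, fun y hy => ?_⟩
  have h1 : Tendsto (fun τ => ‖x τ y - x τ σ - (y - σ) • w τ σ‖) atTop
      (𝓝 ‖ξ y - ξ σ - (y - σ) • η‖) :=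
    (((hlim y hy).sub (hlim σ hσ)).sub (hη.const_smul _)).norm
  exact le_of_tendsto h1 (htaylor.mono fun τ h => h y hy)

theorem hasDerivWithinAt_of_norm_sub_le {f : ℝ → E} {e : E} {S : Set ℝ} {σ : ℝ}
    (h : ∀ ε > 0, ∀ᶠ y in 𝓝[S] σ, ‖f y - f σ - (y - σ) • e‖ ≤ ε * |y - σ|) :
    HasDerivWithinAt f e S σ := by
  rw [hasDerivWithinAt_iff_isLittleO, Asymptotics.isLittleO_iff]
  intro ε hε
  simpa only [Real.norm_eq_abs] using h ε hε

/-- Pointwise limits of approximate solutions of `x'' = F(x, x')` with bounded first and second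
derivatives are solutions. -/
theorem limit_secondOrder [CompleteSpace E] (huv : u < v) (hW : 0 ≤ W) (hK : 0 ≤ K)
    (hx : ∀ᶠ τ in atTop, ∀ σ ∈ Icc u v, HasDerivWithinAt (x τ) (w τ σ) (Icc u v) σ)
    (hw : ∀ᶠ τ in atTop, ∀ σ ∈ Icc u v, HasDerivWithinAt (w τ) (w' τ σ) (Icc u v) σ)
    (hwb : ∀ᶠ τ in atTop, ∀ σ ∈ Icc u v, ‖w τ σ‖ ≤ W)
    (hw' : ∀ᶠ τ in atTop, ∀ σ ∈ Icc u v, ‖w' τ σ‖ ≤ K)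
    (hF : ∀ ε > 0, ∀ᶠ τ in atTop, ∀ σ ∈ Icc u v, ‖w' τ σ - F (x τ σ) (w τ σ)‖ ≤ ε)
    (hlim : ∀ σ ∈ Icc u v, Tendsto (fun τ => x τ σ) atTop (𝓝 (ξ σ)))
    (hFc : ∀ σ ∈ Icc u v, ∀ e, ContinuousAt (fun z : E × E => F z.1 z.2) (ξ σ, e)) :
    ∃ η : ℝ → E, (∀ σ ∈ Icc u v, Tendsto (fun τ => w τ σ) atTop (𝓝 (η σ))) ∧
      (∀ σ ∈ Icc u v, HasDerivWithinAt ξ (η σ) (Icc u v) σ) ∧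
      (∀ σ ∈ Icc u v, HasDerivWithinAt η (F (ξ σ) (η σ)) (Icc u v) σ) := by
  have hex : ∀ σ ∈ Icc u v, ∃ η, Tendsto (fun τ => w τ σ) atTop (𝓝 η) ∧
      ∀ y ∈ Icc u v, ‖ξ y - ξ σ - (y - σ) • η‖ ≤ K * |y - σ| * |y - σ| := fun σ hσ =>
    exists_tendsto_velocity huv hK hx hw hw' hlim hσ
  choose! η hη hηT using hex
  refine ⟨η, hη, fun σ hσ => ?_, fun σ hσ => ?_⟩
  · refine hasDerivWithinAt_of_norm_sub_le fun ε hε => ?_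
    have hc : Tendsto (fun y : ℝ => K * |y - σ|) (𝓝[Icc u v] σ) (𝓝 0) := by
      have : Continuous fun y : ℝ => K * |y - σ| := by fun_prop
      simpa using (this.tendsto σ).mono_left nhdsWithin_le_nhds
    filter_upwards [self_mem_nhdsWithin, hc.eventually_le_const hε] with y hy h1
    exact (hηT σ hσ y hy).trans (mul_le_mul_of_nonneg_right h1 (abs_nonneg _))
  · refine hasDerivWithinAt_of_norm_sub_le fun ε hε => ?_
    obtain ⟨δ, hδ, hball⟩ := Metric.continuousAt_iff.1 (hFc σ hσ (η σ)) (ε / 2) (half_pos hε)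
    -- the radius in which `(x τ, w τ)` stays `δ`-close to its limit at `σ`
    set r := δ / (2 * (W + K + 1)) with hr
    have hr0 : 0 < r := by positivity
    have hWr : (W + K + 1) * r = δ / 2 := by rw [hr]; field_simp
    have hnear : ∀ᶠ y in 𝓝[Icc u v] σ, |y - σ| < r := by
      have : ∀ᶠ y in 𝓝 σ, |y - σ| < r := by
        filter_upwards [Metric.ball_mem_nhds σ hr0] with y hy
        rwa [Metric.mem_ball, Real.dist_eq] at hy
      exact this.filter_mono nhdsWithin_le_nhds
    filter_upwards [self_mem_nhdsWithin, hnear] with y hy hyr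
    have hcx := (hlim σ hσ).eventually (Metric.ball_mem_nhds (ξ σ) (half_pos hδ))
    have hcw := (hη σ hσ).eventually (Metric.ball_mem_nhds (η σ) (half_pos hδ))
    have hev : ∀ᶠ τ in atTop,
        ‖w τ y - w τ σ - (y - σ) • F (ξ σ) (η σ)‖ ≤ ε * |y - σ| := by
      filter_upwards [hx, hw, hwb, hw', hF (ε / 2) (half_pos hε), hcx, hcw]
        with τ h1 h2 h3 h4 h5 h6 h7
      refine norm_image_sub_sub_smul_le h2 hσ hy fun z hz hzy => ?_
      have hzr : |z - σ| < r := hzy.trans_lt hyr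
      have m1 := (convex_Icc u v).norm_image_sub_le_of_norm_hasDerivWithin_le h1 h3 hσ hz
      have m2 := (convex_Icc u v).norm_image_sub_le_of_norm_hasDerivWithin_le h2 h4 hσ hz
      rw [Real.norm_eq_abs] at m1 m2
      have m3 : W * |z - σ| < δ / 2 := by
        have : W * |z - σ| ≤ W * r := mul_le_mul_of_nonneg_left hzr.le hW
        nlinarith
      have m4 : K * |z - σ| < δ / 2 := by
        have : K * |z - σ| ≤ K * r := mul_le_mul_of_nonneg_left hzr.le hK
        nlinarith
      have d1 : dist (x τ z) (ξ σ) < δ := by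
        calc dist (x τ z) (ξ σ) ≤ dist (x τ z) (x τ σ) + dist (x τ σ) (ξ σ) := dist_triangle _ _ _
          _ < δ / 2 + δ / 2 := by
            refine add_lt_add ?_ h6
            rw [dist_eq_norm]; exact m1.trans_lt m3
          _ = δ := add_halves δ
      have d2 : dist (w τ z) (η σ) < δ := by
        calc dist (w τ z) (η σ) ≤ dist (w τ z) (w τ σ) + dist (w τ σ) (η σ) := dist_triangle _ _ _
          _ < δ / 2 + δ / 2 := by
            refine add_lt_add ?_ h7
            rw [dist_eq_norm]; exact m2.trans_lt m4
          _ = δ := add_halves δ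
      have d3 : dist (F (x τ z) (w τ z)) (F (ξ σ) (η σ)) < ε / 2 :=
        hball (x := (x τ z, w τ z)) (by rw [Prod.dist_eq]; exact max_lt d1 d2)
      rw [dist_eq_norm] at d3
      have d4 := h5 z hz
      calc ‖w' τ z - F (ξ σ) (η σ)‖
          = ‖(w' τ z - F (x τ z) (w τ z)) + (F (x τ z) (w τ z) - F (ξ σ) (η σ))‖ := by abel_nf
        _ ≤ _ := norm_add_le _ _
        _ ≤ ε := by linarith
    have hl : Tendsto (fun τ => ‖w τ y - w τ σ - (y - σ) • F (ξ σ) (η σ)‖) atTop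
        (𝓝 ‖η y - η σ - (y - σ) • F (ξ σ) (η σ)‖) :=
      (((hη y hy).sub (hη σ hσ)).sub tendsto_const_nhds).norm
    exact le_of_tendsto hl hev

/-- Solutions of a smooth second order equation are smooth. -/
theorem contDiffOn_of_secondOrder {η : ℝ → E} {O : Set (E × E)} (huv : u < v)
    (hF : ContDiffOn ℝ ∞ (fun z : E × E => F z.1 z.2) O)
    (hO : ∀ σ ∈ Icc u v, (ξ σ, η σ) ∈ O)
    (hξ : ∀ σ ∈ Icc u v, HasDerivWithinAt ξ (η σ) (Icc u v) σ)
    (hη : ∀ σ ∈ Icc u v, HasDerivWithinAt η (F (ξ σ) (η σ)) (Icc u v) σ) :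
    ContDiffOn ℝ ∞ ξ (Icc u v) := by
  have hU : UniqueDiffOn ℝ (Icc u v) := uniqueDiffOn_Icc huv
  have key : ∀ k : ℕ, ContDiffOn ℝ k ξ (Icc u v) ∧ ContDiffOn ℝ k η (Icc u v) := by
    intro k
    induction k with
    | zero =>
      exact ⟨contDiffOn_zero.2 fun σ hσ => (hξ σ hσ).continuousWithinAt,
        contDiffOn_zero.2 fun σ hσ => (hη σ hσ).continuousWithinAt⟩
    | succ k ih =>
      have hcomp : ContDiffOn ℝ k (fun σ => F (ξ σ) (η σ)) (Icc u v) :=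
        (hF.of_le (by exact_mod_cast le_top)).comp (ih.1.prodMk ih.2) hO
      push_cast
      constructor
      · rw [contDiffOn_succ_iff_derivWithin hU]
        refine ⟨fun σ hσ => (hξ σ hσ).differentiableWithinAt, by simp, ?_⟩
        exact ih.2.congr fun σ hσ => (hξ σ hσ).derivWithin (hU σ hσ)
      · rw [contDiffOn_succ_iff_derivWithin hU]
        refine ⟨fun σ hσ => (hη σ hσ).differentiableWithinAt, by simp, ?_⟩
        exact hcomp.congr fun σ hσ => (hη σ hσ).derivWithin (hU σ hσ)
  exact contDiffOn_infty.2 fun k => (key k).1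

end LimitOfCurves

/-! ### The limit curve is a geodesic -/

section LimitIsGeodesic

open Filter Topology Manifold

theorem tendsto_bilinear_apply {ι E F : Type*} [NormedAddCommGroup E] [NormedSpace ℝ E]
    [NormedAddCommGroup F] [NormedSpace ℝ F] {l : Filter ι} {L : ι → E →L[ℝ] E →L[ℝ] F}
    {L₀ : E →L[ℝ] E →L[ℝ] F} {x y : ι → E} {x₀ y₀ : E} (hL : Tendsto L l (𝓝 L₀))
    (hx : Tendsto x l (𝓝 x₀)) (hy : Tendsto y l (𝓝 y₀)) :
    Tendsto (fun i => L i (x i) (y i)) l (𝓝 (L₀ x₀ y₀)) := by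
  have h : Continuous fun z : (E →L[ℝ] E →L[ℝ] F) × E × E => z.1 z.2.1 z.2.2 :=
    (continuous_fst.clm_apply (continuous_fst.comp continuous_snd)).clm_apply
      (continuous_snd.comp continuous_snd)
  exact (h.tendsto (L₀, x₀, y₀)).comp (hL.prodMk_nhds (hx.prodMk_nhds hy))

/-- Neighbourhoods of a point in `[0, 1]` contain nondegenerate intervals, the point being an
endpoint if it is `0` or `1`. -/
theorem exists_Icc_mem_nhdsWithin {s : ℝ} (hs : s ∈ Icc (0 : ℝ) 1) {P : ℝ → Prop}
    (hP : ∀ᶠ σ in 𝓝[Icc 0 1] s, P σ) :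
    ∃ u v : ℝ, u < v ∧ Icc u v ⊆ Icc 0 1 ∧ Icc u v ∈ 𝓝[Icc 0 1] s ∧ ∀ σ ∈ Icc u v, P σ := by
  obtain ⟨δ, hδ, hball⟩ := Metric.mem_nhdsWithin_iff.1 hP
  have hsub : Icc (max 0 (s - δ / 2)) (min 1 (s + δ / 2)) ⊆ Icc 0 1 :=
    Icc_subset_Icc (le_max_left _ _) (min_le_left _ _)
  refine ⟨max 0 (s - δ / 2), min 1 (s + δ / 2), ?_, hsub, ?_, fun σ hσ => hball ⟨?_, hsub hσ⟩⟩
  · have := hs.1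
    have := hs.2
    refine max_lt (lt_min (by linarith) (by linarith)) (lt_min (by linarith) (by linarith))
  · rw [← Icc_inter_Icc]
    exact inter_mem_nhdsWithin _ (Icc_mem_nhds (by linarith) (by linarith))
  · rw [Metric.mem_ball, Real.dist_eq]
    have h1 := (le_max_right _ _).trans hσ.1
    have h2 := hσ.2.trans (min_le_right _ _)
    exact (abs_le.2 ⟨by linarith, by linarith⟩ : |σ - s| ≤ δ / 2).trans_lt (by linarith)

variable {n : ℕ} {M : Type*} [EMetricSpace M] [ChartedSpace (EuclideanSpace ℝ (Fin n)) M]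
  [IsManifold (𝓡 n) ∞ M] [RiemannianBundle (fun x : M => TangentSpace (𝓡 n) x)]
  [IsContMDiffRiemannianBundle (𝓡 n) ∞ (EuclideanSpace ℝ (Fin n))
      (fun x : M => TangentSpace (𝓡 n) x)]

theorem eventually_norm_toCoord_le (a : M) :
    ∃ C > 0, ∀ᶠ x in 𝓝 a, ∀ v : TangentSpace (𝓡 n) x, ‖toCoord a x v‖ ≤ C * ‖v‖ := by
  have := isContinuousRiemannianBundle_tangent (n := n) (M := M)
  have : IsManifold (𝓡 n) 1 M := IsManifold.of_le (n := ∞) (by simp)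
  obtain ⟨C, hC, h⟩ := eventually_norm_trivializationAt_lt (EuclideanSpace ℝ (Fin n))
    (fun x : M => TangentSpace (𝓡 n) x) a
  refine ⟨C, hC, ?_⟩
  filter_upwards [h, chart_source_mem_nhds (EuclideanSpace ℝ (Fin n)) a] with x hx hxa v
  have h1 := ContinuousLinearMap.le_of_opNorm_le _ hx.le v
  have h2 := DFunLike.congr_fun
    (TangentBundle.continuousLinearMapAt_trivializationAt (I := 𝓡 n) hxa) v
  exact (congrArg norm h2).symm.trans_le h1

/-- The right hand side of the geodesic equation `x'' = -Γ(x', x')` in the chart at `a`. -/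
def geodesicField (a : M) (y e : EuclideanSpace ℝ (Fin n)) : EuclideanSpace ℝ (Fin n) :=
  -christoffelForm a y e e

theorem contDiffOn_geodesicField (a : M) :
    ContDiffOn ℝ ∞ (fun z : EuclideanSpace ℝ (Fin n) × EuclideanSpace ℝ (Fin n) =>
      geodesicField a z.1 z.2) ((extChartAt (𝓡 n) a).target ×ˢ univ) := by
  unfold geodesicField
  have h : ContDiffOn ℝ ∞ (fun z : EuclideanSpace ℝ (Fin n) × EuclideanSpace ℝ (Fin n) =>
      christoffelForm a z.1) ((extChartAt (𝓡 n) a).target ×ˢ univ) :=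
    (contDiffOn_christoffelForm a).comp contDiff_fst.contDiffOn fun z hz => hz.1
  exact ((h.clm_apply contDiff_snd.contDiffOn).clm_apply contDiff_snd.contDiffOn).neg

variable {α : ℝ} {p q : M} {c : ℝ → ℝ → M} {s τ : ℝ}

/-- If the coordinates of `γ` near `s` solve the geodesic equation with velocity `η`, then `γ` is
smooth at `s` and its velocity has coordinates `η s`. -/
theorem geodesic_of_hasDerivWithinAt {γ : ℝ → M} (hs : s ∈ Icc (0 : ℝ) 1) {u v : ℝ} (huv : u < v)
    (hnhds : Icc u v ∈ 𝓝[Icc 0 1] s)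
    (hsrc : ∀ σ ∈ Icc u v, γ σ ∈ (extChartAt (𝓡 n) (γ s)).source)
    (hcont : ContinuousWithinAt γ (Icc 0 1) s) {η : ℝ → EuclideanSpace ℝ (Fin n)}
    (h1 : ∀ σ ∈ Icc u v, HasDerivWithinAt (fun σ => extChartAt (𝓡 n) (γ s) (γ σ)) (η σ)
      (Icc u v) σ)
    (h2 : ∀ σ ∈ Icc u v, HasDerivWithinAt η
      (geodesicField (γ s) (extChartAt (𝓡 n) (γ s) (γ σ)) (η σ)) (Icc u v) σ) :
    ContMDiffWithinAt 𝓘(ℝ, ℝ) (𝓡 n) ∞ γ (Icc 0 1) s ∧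
      toCoord (γ s) (γ s) (velocity γ s) = η s := by
  have hsuv : s ∈ Icc u v := mem_of_mem_nhdsWithin hs hnhds
  have hU : UniqueDiffOn ℝ (Icc (0 : ℝ) 1) := uniqueDiffOn_Icc zero_lt_one
  have hξ : ContDiffOn ℝ ∞ (fun σ => extChartAt (𝓡 n) (γ s) (γ σ)) (Icc u v) :=
    contDiffOn_of_secondOrder huv (contDiffOn_geodesicField (γ s))
      (fun σ hσ => ⟨(extChartAt (𝓡 n) (γ s)).map_source (hsrc σ hσ), mem_univ _⟩) h1 h2
  have hsm : ContMDiffWithinAt 𝓘(ℝ, ℝ) (𝓡 n) ∞ γ (Icc 0 1) s := by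
    rw [contMDiffWithinAt_iff_target]
    exact ⟨hcont, ((hξ s hsuv).mono_of_mem_nhdsWithin hnhds).contMDiffWithinAt⟩
  refine ⟨hsm, ?_⟩
  have h3 := hasDerivWithinAt_velocity (hsm.mdifferentiableWithinAt (by simp))
    (mem_extChartAt_source (I := 𝓡 n) (γ s))
  have h4 := (h1 s hsuv).mono_of_mem_nhdsWithin hnhds
  exact (hU s hs).eq_deriv _ h3 h4

/-- The covariant derivative at `s` is defined in the chart at `γ s`, where it is `η' + Γ(η, η)`. -/
theorem covDeriv_velocity_eq_zero {γ : ℝ → M} (hs : s ∈ Icc (0 : ℝ) 1)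
    {η : ℝ → EuclideanSpace ℝ (Fin n)}
    (hη : ∀ᶠ σ in 𝓝[Icc 0 1] s, toCoord (γ s) (γ σ) (velocity γ σ) = η σ)
    (h2 : HasDerivWithinAt η (geodesicField (γ s) (extChartAt (𝓡 n) (γ s) (γ s)) (η s))
      (Icc 0 1) s) :
    covDeriv (n := n) γ (velocity γ) s = 0 := by
  have hηs : toCoord (γ s) (γ s) (velocity γ s) = η s := hη.self_of_nhdsWithin hs
  have h3 := h2.congr_of_eventuallyEq hη hηs
  have hU : UniqueDiffOn ℝ (Icc (0 : ℝ) 1) := uniqueDiffOn_Icc zero_lt_one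
  unfold covDeriv
  rw [h3.derivWithin (hU s hs), ← christoffelForm_apply, hηs]
  exact neg_add_cancel (G := EuclideanSpace ℝ (Fin n)) _

variable [IsRiemannianManifold (𝓡 n) M]

theorem IsHeatFlow.continuousOn_limit (hc : IsHeatFlow n α p q c) {A : ℝ} (hA0 : 0 ≤ A)
    (hA : ∀ s ∈ Icc (0 : ℝ) 1, ∀ τ, 0 ≤ τ → speedSq n c s τ ≤ A ^ 2) {γ : ℝ → M}
    (hlim : ∀ s ∈ Icc (0 : ℝ) 1, Tendsto (fun τ => c s τ) atTop (𝓝 (γ s))) :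
    ContinuousOn γ (Icc 0 1) := by
  have hle : ∀ s ∈ Icc (0 : ℝ) 1, ∀ s' ∈ Icc (0 : ℝ) 1,
      edist (γ s) (γ s') ≤ ENNReal.ofReal (A * |s - s'|) := fun s hs s' hs' =>
    le_of_tendsto ((hlim s hs).edist (hlim s' hs'))
      ((eventually_gt_atTop 0).mono fun τ hτ => hc.edist_space_le hA0 hA hs hs' hτ)
  intro s hs
  refine tendsto_iff_edist_tendsto_0.2 ?_
  have h0 : Tendsto (fun σ => ENNReal.ofReal (A * |σ - s|)) (𝓝[Icc 0 1] s) (𝓝 0) := by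
    have : Continuous fun σ : ℝ => ENNReal.ofReal (A * |σ - s|) :=
      ENNReal.continuous_ofReal.comp (by fun_prop)
    simpa using (this.tendsto s).mono_left (nhdsWithin_le_nhds (s := Icc (0 : ℝ) 1))
  refine tendsto_of_tendsto_of_tendsto_of_le_of_le' tendsto_const_nhds h0
    (Eventually.of_forall fun _ => bot_le) ?_
  filter_upwards [self_mem_nhdsWithin] with σ hσ using hle σ hσ s hs

/-- In the chart at a point of the limit curve, the velocities of the flow converge, and the limit
curve solves the geodesic equation. -/
theorem IsHeatFlow.limit_in_chart (hc : IsHeatFlow n α p q c) (hα : 0 < α) {A B : ℝ}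
    (hA0 : 0 ≤ A) (hA : ∀ s ∈ Icc (0 : ℝ) 1, ∀ τ, 0 ≤ τ → speedSq n c s τ ≤ A ^ 2) (hB0 : 0 ≤ B)
    (hB : ∀ s ∈ Icc (0 : ℝ) 1, ∀ τ, 1 ≤ τ → flowSq n c s τ ≤ (B * Real.exp (-α * τ)) ^ 2)
    {γ : ℝ → M} (hlim : ∀ s ∈ Icc (0 : ℝ) 1, Tendsto (fun τ => c s τ) atTop (𝓝 (γ s)))
    (hunif : ∀ s ∈ Icc (0 : ℝ) 1, ∀ τ, 1 ≤ τ →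
      edist (c s τ) (γ s) ≤ ENNReal.ofReal (B * α⁻¹ * Real.exp (-α * τ)))
    (hs : s ∈ Icc (0 : ℝ) 1) :
    ∃ u v : ℝ, u < v ∧ Icc u v ⊆ Icc 0 1 ∧ Icc u v ∈ 𝓝[Icc 0 1] s ∧
      (∀ σ ∈ Icc u v, γ σ ∈ (extChartAt (𝓡 n) (γ s)).source) ∧
      ∃ η : ℝ → EuclideanSpace ℝ (Fin n),
        (∀ σ ∈ Icc u v, Tendsto (fun τ => toCoord (γ s) (c σ τ) (spaceDeriv c σ τ)) atTop
          (𝓝 (η σ))) ∧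
        (∀ σ ∈ Icc u v, HasDerivWithinAt (fun σ => extChartAt (𝓡 n) (γ s) (γ σ)) (η σ)
          (Icc u v) σ) ∧
        (∀ σ ∈ Icc u v, HasDerivWithinAt η
          (geodesicField (γ s) (extChartAt (𝓡 n) (γ s) (γ σ)) (η σ)) (Icc u v) σ) := by
  set a := γ s with ha
  obtain ⟨C, hC, hCa⟩ := eventually_norm_toCoord_le (n := n) a
  have hopen := isOpen_extChartAt_source (I := 𝓡 n) a
  have hG : ∀ᶠ x in 𝓝 a, ‖christoffelForm a (extChartAt (𝓡 n) a x)‖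
      < ‖christoffelForm a (extChartAt (𝓡 n) a a)‖ + 1 := by
    have h1 : ContinuousAt (fun x => christoffelForm a (extChartAt (𝓡 n) a x)) a :=
      ContinuousAt.comp (g := christoffelForm a)
        (differentiableAt_christoffelForm a (mem_extChartAt_target a)).continuousAt
        (continuousAt_extChartAt (I := 𝓡 n) a)
    have h2 : ContinuousAt (fun x => ‖christoffelForm a (extChartAt (𝓡 n) a x)‖) a :=
      ContinuousAt.norm (E := EuclideanSpace ℝ (Fin n) →L[ℝ] EuclideanSpace ℝ (Fin n) →L[ℝ]
        EuclideanSpace ℝ (Fin n)) h1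
    exact h2.eventually_lt_const (lt_add_one _)
  set G := ‖christoffelForm a (extChartAt (𝓡 n) a a)‖ + 1 with hGdef
  have hG0 : 0 ≤ G := by positivity
  -- `r` is the radius of a ball in which the chart is defined, `toCoord` is bounded by `C` and the
  -- Christoffel symbols by `G`
  obtain ⟨r, hr, hball⟩ := EMetric.mem_nhds_iff.1
    ((hCa.and hG).and (hopen.mem_nhds (mem_extChartAt_source a)))
  have hr2 : 0 < r / 2 := ENNReal.half_pos hr.ne'
  have hγ : ∀ᶠ σ in 𝓝[Icc 0 1] s, edist (γ σ) a < r / 2 :=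
    (tendsto_iff_edist_tendsto_0.1 (hc.continuousOn_limit hA0 hA hlim s hs)).eventually_lt_const hr2
  obtain ⟨u, v, huv, hsub, hnhds, hγuv⟩ := exists_Icc_mem_nhdsWithin hs hγ
  have hexp : Tendsto (fun τ : ℝ => Real.exp (-α * τ)) atTop (𝓝 0) :=
    Real.tendsto_exp_atBot.comp (tendsto_id.const_mul_atTop_of_neg (neg_lt_zero.2 hα))
  have hsmall : ∀ᶠ τ in atTop, ENNReal.ofReal (B * α⁻¹ * Real.exp (-α * τ)) < r / 2 := by
    have h2 := hexp.const_mul (B * α⁻¹)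
    rw [mul_zero] at h2
    have h3 := ENNReal.tendsto_ofReal h2
    rw [ENNReal.ofReal_zero] at h3
    exact h3.eventually_lt_const hr2
  have hγsrc : ∀ σ ∈ Icc u v, γ σ ∈ (extChartAt (𝓡 n) a).source := fun σ hσ =>
    (hball (a := γ σ) ((hγuv σ hσ).trans_le ENNReal.half_le_self)).2
  have hcin : ∀ᶠ τ in atTop, 1 ≤ τ ∧ ∀ σ ∈ Icc u v, c σ τ ∈ Metric.eball a r := by
    filter_upwards [hsmall, eventually_ge_atTop 1] with τ h1 h2
    refine ⟨h2, fun σ hσ => ?_⟩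
    calc edist (c σ τ) a ≤ edist (c σ τ) (γ σ) + edist (γ σ) a := edist_triangle _ _ _
      _ < r / 2 + r / 2 :=
        ENNReal.add_lt_add ((hunif σ (hsub hσ) τ h2).trans_lt h1) (hγuv σ hσ)
      _ = r := ENNReal.add_halves r
  -- the bounds in the chart
  have hnorm {x : M} (hx : x ∈ Metric.eball a r) {e : TangentSpace (𝓡 n) x} {b : ℝ} (hb : 0 ≤ b)
      (h : inner ℝ e e ≤ b ^ 2) : ‖toCoord a x e‖ ≤ C * b := by
    refine ((hball hx).1.1 e).trans (mul_le_mul_of_nonneg_left ?_ hC.le)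
    rw [real_inner_self_eq_norm_sq] at h
    exact (pow_le_pow_iff_left₀ (norm_nonneg _) hb two_ne_zero).1 h
  have hw : ∀ᶠ τ in atTop, ∀ σ ∈ Icc u v,
      ‖toCoord a (c σ τ) (spaceDeriv (n := n) c σ τ)‖ ≤ C * A := by
    filter_upwards [hcin] with τ h1 σ hσ
    exact hnorm (h1.2 σ hσ) hA0 (hA σ (hsub hσ) τ (zero_le_one.trans h1.1))
  have hJ : ∀ᶠ τ in atTop, ∀ σ ∈ Icc u v,
      ‖α⁻¹ • toCoord a (c σ τ) (timeDeriv (n := n) c σ τ)‖ ≤ α⁻¹ * C * B * Real.exp (-α * τ) := by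
    filter_upwards [hcin] with τ h1 σ hσ
    rw [norm_smul, Real.norm_of_nonneg (inv_nonneg.2 hα.le)]
    refine (mul_le_mul_of_nonneg_left (hnorm (h1.2 σ hσ) (by positivity)
      (hB σ (hsub hσ) τ h1.1)) (inv_nonneg.2 hα.le)).trans_eq ?_
    ring
  refine ⟨u, v, huv, hsub, hnhds, hγsrc, ?_⟩
  refine limit_secondOrder (x := fun τ σ => extChartAt (𝓡 n) a (c σ τ))
    (w' := fun τ σ => α⁻¹ • toCoord a (c σ τ) (timeDeriv (n := n) c σ τ)
      - christoffelForm a (extChartAt (𝓡 n) a (c σ τ)) (toCoord a (c σ τ) (spaceDeriv c σ τ))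
          (toCoord a (c σ τ) (spaceDeriv c σ τ)))
    (W := C * A) (K := α⁻¹ * C * B + G * (C * A) * (C * A))
    (F := geodesicField a) huv (by positivity) (by positivity) ?_ ?_ hw ?_ ?_ ?_ ?_
  · filter_upwards [hcin] with τ h1 σ hσ
    exact (hasDerivWithinAt_velocity (hc.mdifferentiableWithinAt_space (hsub hσ)
      (zero_le_one.trans h1.1)) (hball (h1.2 σ hσ)).2).mono hsub
  · filter_upwards [hcin] with τ h1 σ hσ
    exact (hc.hasDerivWithinAt_spaceDeriv hα (hsub hσ) (one_pos.trans_le h1.1)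
      (hball (h1.2 σ hσ)).2).mono hsub
  · filter_upwards [hcin, hw, hJ] with τ h1 h2 h3 σ hσ
    refine (norm_sub_le _ _).trans (add_le_add ((h3 σ hσ).trans ?_) ?_)
    · refine mul_le_of_le_one_right (by positivity) (Real.exp_le_one_iff.2 ?_)
      have := h1.1
      nlinarith
    · refine (ContinuousLinearMap.le_opNorm₂ _ _ _).trans ?_
      have hw2 := h2 σ hσ
      have hG2 := (hball (h1.2 σ hσ)).1.2.le
      gcongr
  · intro ε hε
    have h2 := hexp.const_mul (α⁻¹ * C * B)
    rw [mul_zero] at h2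
    filter_upwards [hJ, h2.eventually_le_const hε] with τ h3 h4 σ hσ
    refine le_trans (le_of_eq ?_) ((h3 σ hσ).trans h4)
    unfold geodesicField
    congr 1
    abel
  · intro σ hσ
    exact (continuousAt_extChartAt' (hγsrc σ hσ)).tendsto.comp (hlim σ (hsub hσ))
  · intro σ hσ e
    exact ((contDiffOn_geodesicField a).continuousOn).continuousAt
      (((isOpen_extChartAt_target (I := 𝓡 n) a).prod isOpen_univ).mem_nhds
        ⟨(extChartAt (𝓡 n) a).map_source (hγsrc σ hσ), mem_univ _⟩)

/-- The limit curve is a geodesic, and the squared speeds converge to its squared speed. -/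
theorem IsHeatFlow.isGeodesic_limit (hc : IsHeatFlow n α p q c) (hα : 0 < α) {A B : ℝ}
    (hA0 : 0 ≤ A) (hA : ∀ s ∈ Icc (0 : ℝ) 1, ∀ τ, 0 ≤ τ → speedSq n c s τ ≤ A ^ 2) (hB0 : 0 ≤ B)
    (hB : ∀ s ∈ Icc (0 : ℝ) 1, ∀ τ, 1 ≤ τ → flowSq n c s τ ≤ (B * Real.exp (-α * τ)) ^ 2)
    {γ : ℝ → M} (hlim : ∀ s ∈ Icc (0 : ℝ) 1, Tendsto (fun τ => c s τ) atTop (𝓝 (γ s)))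
    (hunif : ∀ s ∈ Icc (0 : ℝ) 1, ∀ τ, 1 ≤ τ →
      edist (c s τ) (γ s) ≤ ENNReal.ofReal (B * α⁻¹ * Real.exp (-α * τ))) :
    IsGeodesic n γ ∧ ∀ s ∈ Icc (0 : ℝ) 1, Tendsto (fun τ => speedSq n c s τ) atTop
      (𝓝 (inner ℝ (velocity (n := n) γ s) (velocity (n := n) γ s))) := by
  have hcont := hc.continuousOn_limit hA0 hA hlim
  have hsmooth : ContMDiffOn 𝓘(ℝ, ℝ) (𝓡 n) ∞ γ (Icc 0 1) := by
    intro s hs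
    obtain ⟨u, v, huv, hsub, hnhds, hsrc, η, -, h1, h2⟩ :=
      hc.limit_in_chart hα hA0 hA hB0 hB hlim hunif hs
    exact (geodesic_of_hasDerivWithinAt hs huv hnhds hsrc (hcont s hs) h1 h2).1
  refine ⟨⟨hsmooth, fun s hs => ?_⟩, fun s hs => ?_⟩
  · obtain ⟨u, v, huv, hsub, hnhds, hsrc, η, -, h1, h2⟩ :=
      hc.limit_in_chart hα hA0 hA hB0 hB hlim hunif hs
    have hsuv : s ∈ Icc u v := mem_of_mem_nhdsWithin hs hnhds
    refine covDeriv_velocity_eq_zero (η := η) hs ?_ ((h2 s hsuv).mono_of_mem_nhdsWithin hnhds)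
    filter_upwards [hnhds] with σ hσ
    have h3 := hasDerivWithinAt_velocity ((hsmooth σ (hsub hσ)).mdifferentiableWithinAt (by simp))
      (hsrc σ hσ)
    exact (uniqueDiffOn_Icc huv σ hσ).eq_deriv _ (h3.mono hsub) (h1 σ hσ)
  · obtain ⟨u, v, huv, hsub, hnhds, hsrc, η, hw, h1, h2⟩ :=
      hc.limit_in_chart hα hA0 hA hB0 hB hlim hunif hs
    have hsuv : s ∈ Icc u v := mem_of_mem_nhdsWithin hs hnhds
    have hvel := (geodesic_of_hasDerivWithinAt hs huv hnhds hsrc (hcont s hs) h1 h2).2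
    have ha := mem_extChartAt_source (I := 𝓡 n) (γ s)
    rw [inner_eq_metricForm (γ s) ha, hvel]
    have hx : Tendsto (fun τ => extChartAt (𝓡 n) (γ s) (c s τ)) atTop
        (𝓝 (extChartAt (𝓡 n) (γ s) (γ s))) :=
      (continuousAt_extChartAt' ha).tendsto.comp (hlim s hs)
    have hg : Tendsto (fun τ => metricForm (γ s) (extChartAt (𝓡 n) (γ s) (c s τ))) atTop
        (𝓝 (metricForm (γ s) (extChartAt (𝓡 n) (γ s) (γ s)))) :=
      (differentiableAt_metricForm (γ s) (mem_extChartAt_target _)).continuousAt.tendsto.comp hx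
    have hgw : Tendsto (fun τ => metricForm (γ s) (extChartAt (𝓡 n) (γ s) (c s τ))
        (toCoord (γ s) (c s τ) (spaceDeriv c s τ)) (toCoord (γ s) (c s τ) (spaceDeriv c s τ)))
        atTop (𝓝 (metricForm (γ s) (extChartAt (𝓡 n) (γ s) (γ s)) (η s) (η s))) :=
      tendsto_bilinear_apply hg (hw s hsuv) (hw s hsuv)
    refine hgw.congr' ?_
    filter_upwards [(hlim s hs).eventually_mem ((isOpen_extChartAt_source (I := 𝓡 n) _).mem_nhds ha)]
      with τ hτ
    exact (inner_eq_metricForm (γ s) hτ _ _).symm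

end LimitIsGeodesic

/-! ### Exponential convergence -/

section Convergence

open Filter Topology Manifold

theorem l2Dist_le_of_edist_le {X : Type*} [EMetricSpace X] {x y : ℝ → X} {D : ℝ≥0∞}
    (h : ∀ s ∈ Icc (0 : ℝ) 1, edist (x s) (y s) ≤ D) : l2Dist x y ≤ D := by
  have h1 : ∫⁻ s in Icc (0 : ℝ) 1, edist (x s) (y s) ^ 2 ≤ D ^ 2 := by
    refine (setLIntegral_mono' measurableSet_Icc fun s hs => pow_le_pow_left' (h s hs) 2).trans ?_
    rw [setLIntegral_const, Real.volume_Icc, sub_zero, ENNReal.ofReal_one, mul_one]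
  unfold l2Dist
  refine (ENNReal.rpow_le_rpow h1 (by norm_num)).trans_eq ?_
  rw [← ENNReal.rpow_natCast, ← ENNReal.rpow_mul]
  norm_num

variable {n : ℕ} {M : Type*} [EMetricSpace M] [ChartedSpace (EuclideanSpace ℝ (Fin n)) M]
  [IsManifold (𝓡 n) ∞ M] [RiemannianBundle (fun x : M => TangentSpace (𝓡 n) x)]
  [IsContMDiffRiemannianBundle (𝓡 n) ∞ (EuclideanSpace ℝ (Fin n))
      (fun x : M => TangentSpace (𝓡 n) x)]

variable {α : ℝ} {p q : M} {c : ℝ → ℝ → M} {s τ : ℝ}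

/-- If the squared speeds of `c(·, τ)` are within `D` of the constant squared speed of `γ`, the
energies differ by at most `D / 2`. -/
theorem IsHeatFlow.abs_energy_sub_le (hc : IsHeatFlow n α p q c) (hτ : 0 ≤ τ) {γ : ℝ → M}
    {κ D : ℝ} (hκ : ∀ s ∈ Icc (0 : ℝ) 1,
      inner ℝ (velocity (n := n) γ s) (velocity (n := n) γ s) = κ)
    (hD : ∀ s ∈ Icc (0 : ℝ) 1, |speedSq n c s τ - κ| ≤ D) :
    |energy n (fun s => c s τ) - energy n γ| ≤ D / 2 := by
  have hcont : ContinuousOn (fun s => speedSq n c s τ) (Icc 0 1) :=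
    hc.continuousOn_speedSq.comp (f := fun s : ℝ => (s, τ)) (by fun_prop)
      fun s hs => ⟨hs, mem_Ici.2 hτ⟩
  have hint : IntervalIntegrable (fun s => speedSq n c s τ) volume 0 1 :=
    ContinuousOn.intervalIntegrable (by rwa [uIcc_of_le zero_le_one])
  have h1 : energy n γ = 1 / 2 * ∫ _ in (0 : ℝ)..1, κ := by
    unfold energy
    congr 1
    refine intervalIntegral.integral_congr fun s hs => hκ s ?_
    rwa [uIcc_of_le zero_le_one] at hs
  have h2 : energy n (fun s => c s τ) = 1 / 2 * ∫ s in (0 : ℝ)..1, speedSq n c s τ := rfl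
  rw [h1, h2, ← mul_sub, ← intervalIntegral.integral_sub hint intervalIntegrable_const, abs_mul]
  have h3 := intervalIntegral.norm_integral_le_of_norm_le_const (a := (0 : ℝ)) (b := 1)
    (f := fun s => speedSq n c s τ - κ) (C := D) (fun s hs => hD s (by
      rw [uIoc_of_le zero_le_one] at hs
      exact Ioc_subset_Icc_self hs))
  rw [sub_zero, abs_one, mul_one, Real.norm_eq_abs] at h3
  rw [abs_of_pos (by norm_num : (0 : ℝ) < 1 / 2)]
  linarith

variable [IsRiemannianManifold (𝓡 n) M]

/-- At `τ = 0` the curve is only differentiable, and the bound is obtained by letting `τ` decrease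
to `0`. -/
theorem IsHeatFlow.edist_left_endpoint_le (hc : IsHeatFlow n α p q c) {A : ℝ} (hA0 : 0 ≤ A)
    (hA : ∀ s ∈ Icc (0 : ℝ) 1, ∀ τ, 0 ≤ τ → speedSq n c s τ ≤ A ^ 2)
    (hs : s ∈ Icc (0 : ℝ) 1) (hτ : 0 ≤ τ) : edist (c s τ) p ≤ ENNReal.ofReal A := by
  have hpos : ∀ t, 0 < t → edist (c s t) p ≤ ENNReal.ofReal A := by
    intro t ht
    have h := hc.edist_space_le hA0 hA hs ⟨le_rfl, zero_le_one⟩ ht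
    rw [hc.left_endpoint t ht.le, sub_zero, abs_of_nonneg hs.1] at h
    exact h.trans (ENNReal.ofReal_le_ofReal (mul_le_of_le_one_right hA0 hs.2))
  rcases hτ.eq_or_lt with rfl | hτ
  · have h1 : ContinuousOn (fun z : ℝ × ℝ => c z.1 z.2) (Icc 0 1 ×ˢ Ici 0) :=
      (FiberBundle.continuous_proj (EuclideanSpace ℝ (Fin n))
        (fun x : M => TangentSpace (𝓡 n) x)).comp_continuousOn hc.continuousOn
    have h2 : ContinuousOn (fun t => c s t) (Ici 0) :=
      h1.comp (f := fun t : ℝ => (s, t)) (by fun_prop) fun t ht => ⟨hs, ht⟩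
    have h3 : Tendsto (fun t => c s t) (𝓝[>] 0) (𝓝 (c s 0)) :=
      (h2 0 (mem_Ici.2 le_rfl)).mono_left (nhdsWithin_mono _ Ioi_subset_Ici_self)
    refine le_of_tendsto (h3.edist tendsto_const_nhds) ?_
    filter_upwards [self_mem_nhdsWithin] with t ht using hpos t ht
  · exact hpos τ hτ

/-- A solution satisfying the curvature bound converges to a geodesic, with exponential rates for
the distance and for the squared speed, uniformly on `[0, 1] × [0, ∞)`. -/
theorem IsHeatFlow.exists_geodesic_limit [CompleteSpace M] (hc : IsHeatFlow n α p q c)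
    (hα : 0 < α) (hR : CurvatureBound n c) :
    ∃ γ : ℝ → M, IsGeodesic n γ ∧ γ 0 = p ∧ γ 1 = q ∧ ∃ κ C : ℝ, 0 < C ∧
      (∀ s ∈ Icc (0 : ℝ) 1, inner ℝ (velocity (n := n) γ s) (velocity (n := n) γ s) = κ) ∧
      ∀ s ∈ Icc (0 : ℝ) 1, ∀ τ, 0 ≤ τ →
        edist (c s τ) (γ s) ≤ ENNReal.ofReal (C * Real.exp (-α * τ)) ∧
        |speedSq n c s τ - κ| ≤ C * Real.exp (-α * τ) := by
  obtain ⟨A, hA0, hA⟩ := hc.exists_speedSq_le hα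
  obtain ⟨B, hB0, hB⟩ := hc.exists_flowSq_le hα hR
  obtain ⟨D, hD0, hD⟩ := hc.exists_abs_speedSq_sub_le hα hA0.le hB0.le hA hB
  obtain ⟨γ, hlim, hunif⟩ := hc.exists_limit hα hB0.le hB
  obtain ⟨hgeod, hspeed⟩ := hc.isGeodesic_limit hα hA0.le hA hB0.le hB hlim hunif
  have h0 : (0 : ℝ) ∈ Icc (0 : ℝ) 1 := ⟨le_rfl, zero_le_one⟩
  have h1 : (1 : ℝ) ∈ Icc (0 : ℝ) 1 := ⟨zero_le_one, le_rfl⟩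
  have hexp : Tendsto (fun τ : ℝ => Real.exp (-α * τ)) atTop (𝓝 0) :=
    Real.tendsto_exp_atBot.comp (tendsto_id.const_mul_atTop_of_neg (neg_lt_zero.2 hα))
  set κ := fun s => inner ℝ (velocity (n := n) γ s) (velocity (n := n) γ s) with hκ
  -- the oscillation of the squared speed over `[0, 1]` tends to zero
  have hconst : ∀ s ∈ Icc (0 : ℝ) 1, κ s = κ 0 := by
    intro s hs
    have hz := hexp.const_mul (2 * α⁻¹ * A * B)
    rw [mul_zero] at hz
    have h2 : |κ s - κ 0| ≤ 0 := by
      refine le_of_tendsto_of_tendsto (((hspeed s hs).sub (hspeed 0 h0)).abs) hz ?_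
      filter_upwards [eventually_ge_atTop 1] with τ hτ
      exact hc.abs_speedSq_sub_le hα hA0.le hB0.le hA hB hs h0 hτ
    exact sub_eq_zero.1 (abs_eq_zero.1 (le_antisymm h2 (abs_nonneg _)))
  have hκle : ∀ s ∈ Icc (0 : ℝ) 1, κ s ≤ A ^ 2 := fun s hs =>
    le_of_tendsto (hspeed s hs) ((eventually_ge_atTop 0).mono fun τ hτ => hA s hs τ hτ)
  have hγp : γ 0 = p := tendsto_nhds_unique (hlim 0 h0)
    (tendsto_const_nhds.congr' ((eventually_ge_atTop 0).mono fun τ hτ =>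
      (hc.left_endpoint τ hτ).symm))
  have hγq : γ 1 = q := tendsto_nhds_unique (hlim 1 h1)
    (tendsto_const_nhds.congr' ((eventually_ge_atTop 0).mono fun τ hτ =>
      (hc.right_endpoint τ hτ).symm))
  have hdp : ∀ s ∈ Icc (0 : ℝ) 1, edist (γ s) p ≤ ENNReal.ofReal A := fun s hs =>
    le_of_tendsto ((hlim s hs).edist tendsto_const_nhds) ((eventually_ge_atTop 0).mono
      fun τ hτ => hc.edist_left_endpoint_le hA0.le hA hs hτ)
  -- for `τ ≤ 1` crude bounds are absorbed by the factor `exp α`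
  have hE : 0 < Real.exp α := Real.exp_pos α
  have hearly {K τ : ℝ} (hK : 0 ≤ K) (hτ : τ ≤ 1) : K ≤ K * Real.exp α * Real.exp (-α * τ) := by
    rw [mul_assoc, ← Real.exp_add]
    refine le_mul_of_one_le_right hK (Real.one_le_exp ?_)
    nlinarith
  refine ⟨γ, hgeod, hγp, hγq, κ 0,
    B * α⁻¹ + (A + A) * Real.exp α + D + A ^ 2 * Real.exp α, by positivity, hconst,
    fun s hs τ hτ => ⟨?_, ?_⟩⟩
  · rcases le_total τ 1 with h | h
    · calc edist (c s τ) (γ s) ≤ edist (c s τ) p + edist (γ s) p := edist_triangle_right _ _ _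
        _ ≤ ENNReal.ofReal A + ENNReal.ofReal A :=
          add_le_add (hc.edist_left_endpoint_le hA0.le hA hs hτ) (hdp s hs)
        _ = ENNReal.ofReal (A + A) := (ENNReal.ofReal_add hA0.le hA0.le).symm
        _ ≤ _ := ENNReal.ofReal_le_ofReal ((hearly (by positivity) h).trans
          (mul_le_mul_of_nonneg_right ?_ (Real.exp_nonneg _)))
      have : 0 ≤ B * α⁻¹ := by positivity
      have : 0 ≤ A ^ 2 * Real.exp α := by positivity
      linarith
    · refine (hunif s hs τ h).trans (ENNReal.ofReal_le_ofReal
        (mul_le_mul_of_nonneg_right ?_ (Real.exp_nonneg _)))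
      have : 0 ≤ (A + A) * Real.exp α := by positivity
      have : 0 ≤ A ^ 2 * Real.exp α := by positivity
      linarith
  · rw [← hconst s hs]
    rcases le_total τ 1 with h | h
    · have h2 : |speedSq n c s τ - κ s| ≤ A ^ 2 := by
        have h3 : 0 ≤ speedSq n c s τ := real_inner_self_nonneg
        have h4 : 0 ≤ κ s := real_inner_self_nonneg
        exact abs_sub_le_of_nonneg_of_le h3 (hA s hs τ hτ) h4 (hκle s hs)
      refine h2.trans ((hearly (by positivity) h).trans
        (mul_le_mul_of_nonneg_right ?_ (Real.exp_nonneg _)))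
      have : 0 ≤ (A + A) * Real.exp α := by positivity
      have : 0 ≤ B * α⁻¹ := by positivity
      linarith
    · have h2 : |speedSq n c s τ - κ s| ≤ D * Real.exp (-α * τ) := by
        rw [abs_sub_comm]
        exact le_of_tendsto ((hspeed s hs).sub_const _).abs
          ((eventually_ge_atTop τ).mono fun τ' hτ' => hD s hs τ τ' h hτ')
      refine h2.trans (mul_le_mul_of_nonneg_right ?_ (Real.exp_nonneg _))
      have : 0 ≤ (A + A) * Real.exp α := by positivity
      have : 0 ≤ B * α⁻¹ := by positivity
      have : 0 ≤ A ^ 2 * Real.exp α := by positivity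
      linarith

end Convergence

end GeomHeatFlow

end

theorem mainTheorem1 (n : ℕ) (M : Type*) [EMetricSpace M] [CompleteSpace M]
    [ChartedSpace (EuclideanSpace ℝ (Fin n)) M] [IsManifold (𝓡 n) ∞ M]
    [RiemannianBundle (fun x : M => TangentSpace (𝓡 n) x)]
    [IsContMDiffRiemannianBundle (𝓡 n) ∞ (EuclideanSpace ℝ (Fin n))
      (fun x : M => TangentSpace (𝓡 n) x)]
    [IsRiemannianManifold (𝓡 n) M]
    (α : ℝ) (hα : 0 < α) :
    ∃ ρ : ℝ, 0 < ρ ∧ ∀ (p q : M) (c : ℝ → ℝ → M),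
      GeomHeatFlow.IsHeatFlow n α p q c → GeomHeatFlow.CurvatureBound n c →
      ∃ γ : ℝ → M, GeomHeatFlow.IsGeodesic n γ ∧ γ 0 = p ∧ γ 1 = q ∧
        ∃ C : ℝ, 0 < C ∧ ∀ τ : ℝ, 0 ≤ τ →
          GeomHeatFlow.l2Dist (fun s => c s τ) γ ≤ ENNReal.ofReal (C * Real.exp (-ρ * τ)) ∧
          |GeomHeatFlow.energy n (fun s => c s τ) - GeomHeatFlow.energy n γ|
            ≤ C * Real.exp (-ρ * τ) := by
  refine ⟨α, hα, fun p q c hc hR => ?_⟩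
  obtain ⟨γ, hγ, hp, hq, κ, C, hC, hκ, h⟩ := hc.exists_geodesic_limit hα hR
  refine ⟨γ, hγ, hp, hq, C, hC, fun τ hτ => ⟨?_, ?_⟩⟩
  · exact GeomHeatFlow.l2Dist_le_of_edist_le fun s hs => (h s hs τ hτ).1
  · refine (hc.abs_energy_sub_le hτ hκ fun s hs => (h s hs τ hτ).2).trans ?_
    have : 0 < C * Real.exp (-α * τ) := by positivity
    linarith
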